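/- \textbf{Setting.} Let $\eta_1,\eta_2,\dots$ be i.i.d. measurable second-order processes on $[0,1]$ with $\mathrm E\int_0^1\eta_i^2(x)\,dx<\infty$, mean function $m(x)=\mathrm E\,\eta_i(x)$, and stationary covariance $G(x,x')=\mathrm{Cov}\{\eta_i(x),\eta_i(x')\}=C(|x-x'|)$; put $Z_i=\eta_i-m$. Let $\lambda_1\ge\lambda_2\ge\dots\ge0$, $\sum_k\lambda_k<\infty$, be the eigenvalues of $G$, with eigenfunctions $\psi_k$ forming an orthonormal basis of $L^2[0,1]$ ($\int_0^1 G(x,x')\psi_k(x')\,dx'=\lambda_k\psi_k(x)$ for all $x\in[0,1]$). Put $\phi_k=\sqrt{\lambda_k}\,\psi_k$, and let $\xi_{ik}$ be the principal component scores: $\int_0^1 Z_i\phi_k=\lambda_k\xi_{ik}$; for each $i$ they are uncorrelated with mean $0$ and variance $1$, and the sequences $(\xi_{ik})_{k\ge1}$ are i.i.d. in $i$. Let $\varepsilon_{ij}$ be i.i.d. with mean $0$ and variance $1$, independent of $(\eta_i)_i$. With $n=n(N)$, one observes $$Y_{ij}=\eta_i(j/N)+\sigma(j/N)\,\varepsilon_{ij},\qquad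 1\le i\le n,\ 1\le j\le N .$$ For an integer $p\ge1$ and $J_s=J_s(N)$, let $\mathcal S^{(p-2)}$ be the space of functions on $[0,1]$ that are $p-2$ times continuously differentiable (no condition if $p=1$) and polynomials of degree at most $p-1$ on each interval $[t_\ell,t_{\ell+1})$, $0\le\ell<J_s$, and on $[t_{J_s},1]$, where $t_\ell=\ell/(J_s+1)$. Let $\widehat\eta_i$ be a minimizer of $\sum_{j=1}^N\{Y_{ij}-g(j/N)\}^2$ over $g\in\mathcal S^{(p-2)}$, $\widehat m=n^{-1}\sum_{i=1}^n\widehat\eta_i$, $\widehat Z_i=\widehat\eta_i-\widehat m$. Fix $h_0\in(0,1)$ and, for $h\in[0,h_0]$, put $$\widehat C(h)=\frac1{1-h}\int_0^{1-h}\frac1n\sum_{i=1}^n\widehat Z_i(x)\widehat Z_i(x+h)\,dx,\qquad \widetilde C(h)=\frac1{1-h}\int_0^{1-h}\frac1n\sum_{i=1}^nZ_i(x)Z_i(x+h)\,dx .$$ Let $\mathcal H^{(q,\mu)}[0,1]$ be the space of functions whose $q$th derivative is $\mu$-H\"older on $[0,1]$, with seminorm $\|\varphi\|_{q,\mu}=\sup_{x\ne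 y}|\varphi^{(q)}(x)-\varphi^{(q)}(y)|/|x-y|^\mu$, and $\|\varphi\|_\infty=\sup_{[0,1]}|\varphi|$. \textbf{Assumptions.} (A1) $m\in\mathcal H^{(q,\mu)}[0,1]$ for an integer $q>0$ and $\mu\in(0,1]$; put $p^*=q+\mu$. (A2) The standard deviation function $\sigma\ge0$ lies in $\mathcal H^{(0,\nu)}[0,1]$ for some $\nu\in(0,1]$, $\sup_{[0,1]}\sigma\le M_\sigma$ and $\sup_{h\in[0,h_0]}|C(h)|\le M_0$ for some constants $M_\sigma,M_0>0$. (A3) As $N\to\infty$, $n=n(N)\to\infty$ and $n=O(N^\theta)$ for some $\theta>0$. (A4) $\phi_k\in\mathcal H^{(q,\mu)}[0,1]$ for all $k$, $\sum_k\|\phi_k\|_{q,\mu}<\infty$, $\sum_k\|\phi_k\|_\infty<\infty$; and there are nondecreasing positive integers $k_n$ with $\sum_{k>k_n}\|\phi_k\|_\infty=o(n^{-1/2})$ and $k_n=O(n^\omega)$ for some $\omega>0$. (A5) There are constants $c_1,c_2>0$, $\gamma_1,\gamma_2>1$, $\beta_1,\beta_2\in(0,1/2)$ with $$\theta<\min\Big\{\frac{2(1-\beta_2)p^*}{3+(1+\beta_1)p^*},\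 \frac{2(\nu-\beta_2)}{1+\beta_1}\Big\},$$ and for all sufficiently large $N$ there are i.i.d. $N(0,1)$ variables $\{U_{ik,\xi}\}_{i\le n,k\le k_n}$ and i.i.d. $N(0,1)$ variables $\{U_{ij,\varepsilon}\}_{i\le n,j\le N}$ such that $$\Pr\Big\{\max_{1\le k\le k_n}\max_{1\le t\le n}\Big|\sum_{i=1}^t\xi_{ik}-\sum_{i=1}^tU_{ik,\xi}\Big|>n^{\beta_1}\Big\}<c_1n^{-\gamma_1},\qquad \Pr\Big\{\max_{1\le i\le n}\max_{1\le t\le N}\Big|\sum_{j=1}^t\varepsilon_{ij}-\sum_{j=1}^tU_{ij,\varepsilon}\Big|>N^{\beta_2}\Big\}<c_2N^{-\gamma_2}.$$ (A6) The spline order satisfies $p\ge p^*$; $J_s$ is of the same order as $N^\gamma d_N$ (that is, $J_s/(N^\gamma d_N)$ is bounded away from $0$ and $\infty$ for large $N$), where $d_N>0$ for all sufficiently large $N$ and $d_N+d_N^{-1}=O(\log^\tau N)$ for some $\tau>0$, and $$\max\Big\{\frac{5\theta}{4p^*},\ \frac{\theta+(\gamma_1+1+\omega)^{-1}8\theta\beta_1}{2p^*},\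 1-\nu\Big\}<\gamma<1-\frac\theta2-\beta_2-\frac\theta2\beta_1 .$$ \textbf{Conclusion.} Under (A1)--(A6), as $N\to\infty$, $$\sup_{h\in[0,h_0]}\big|\widehat C(h)-\widetilde C(h)\big|=o_p(n^{-1/2}).$$ -/

import Mathlib

open MeasureTheory ProbabilityTheory Filter Set Asymptotics
open scoped Topology ENNReal NNReal

noncomputable section

/-- The Hölder seminorm of order `(q, μ)` on `[0,1]`:
the supremum over `x ≠ y` of `|f⁽q⁾(x) - f⁽q⁾(y)| / |x - y| ^ μ`, with values in `[0, ∞]`. -/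
def holderSeminorm (q : ℕ) (μ : ℝ≥0) (f : ℝ → ℝ) : ℝ≥0∞ :=
  eHolderNorm μ ((Icc (0 : ℝ) 1).domRestrict (iteratedDerivWithin q f (Icc 0 1)))

/-- The space of functions on `[0,1]` whose `q`-th derivative is `μ`-Hölder continuous. -/
def holderSpace (q : ℕ) (μ : ℝ≥0) : Set (ℝ → ℝ) :=
  {f | ContDiffOn ℝ q f (Icc 0 1) ∧ holderSeminorm q μ f < ⊤}

/-- The supremum norm on `[0,1]`, with values in `[0, ∞]`. -/
def supNorm01 (f : ℝ → ℝ) : ℝ≥0∞ := ⨆ x ∈ Icc (0 : ℝ) 1, ‖f x‖ₑ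

/-- The knots `t_ℓ = ℓ / (J + 1)`. -/
def knot (J ℓ : ℕ) : ℝ := (ℓ : ℝ) / ((J : ℝ) + 1)

/-- The subintervals `[t_ℓ, t_{ℓ+1})` for `ℓ < J`, and `[t_J, 1]` for `ℓ = J`. -/
def knotInterval (J ℓ : ℕ) : Set ℝ :=
  if ℓ < J then Ico (knot J ℓ) (knot J (ℓ + 1)) else Icc (knot J J) 1

/-- Polynomial splines of order `p` on `[0,1]` with `J` equally spaced interior knots:
`p - 2` times continuously differentiable on `[0,1]` (no condition if `p < 2`), and a polynomial
of degree at most `p - 1` on each subinterval. Values outside `[0,1]` play no role. -/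
def splineSpace (p J : ℕ) : Set (ℝ → ℝ) :=
  {g | (∀ r : ℕ, r + 2 ≤ p → ContDiffOn ℝ r g (Icc 0 1)) ∧
    ∀ ℓ ≤ J, ∃ Q : Polynomial ℝ, Q.degree < p ∧ ∀ x ∈ knotInterval J ℓ, g x = Q.eval x}

/-- The design points: `gridPoint N j = (j + 1) / N`, for `j = 0, …, N - 1`. -/
def gridPoint (N j : ℕ) : ℝ := ((j : ℝ) + 1) / (N : ℝ)

/-- The residual sum of squares of `g` for the observations `y 0, …, y (N - 1)` at the design
points. -/
def residualSS (N : ℕ) (y : ℕ → ℝ) (g : ℝ → ℝ) : ℝ :=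
  ∑ j ∈ Finset.range N, (y j - g (gridPoint N j)) ^ 2

/-- `g` is a least squares spline for the observations `y`. -/
def IsLeastSquaresSpline (p J N : ℕ) (y : ℕ → ℝ) (g : ℝ → ℝ) : Prop :=
  g ∈ splineSpace p J ∧ ∀ f ∈ splineSpace p J, residualSS N y g ≤ residualSS N y f

/-- The covariance estimator
`h ↦ (1 - h)⁻¹ ∫₀^{1-h} n⁻¹ ∑_{i < n} z_i(x) z_i(x + h) dx` built on curves `z_0, …, z_{n-1}`. -/
def lagCov (n : ℕ) (z : ℕ → ℝ → ℝ) (h : ℝ) : ℝ :=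
  1 / (1 - h) * ∫ x in (0 : ℝ)..(1 - h),
    1 / (n : ℝ) * ∑ i ∈ Finset.range n, z i x * z i (x + h)

/-- The curves minus their average over the first `n` of them. -/
def centered (n : ℕ) (z : ℕ → ℝ → ℝ) (i : ℕ) (x : ℝ) : ℝ :=
  z i x - 1 / (n : ℝ) * ∑ i' ∈ Finset.range n, z i' x

variable {Ω : Type*} [MeasurableSpace Ω]

/-- The mean function of a process. -/
def meanFun (P : Measure Ω) (X : ℝ → Ω → ℝ) (x : ℝ) : ℝ := ∫ ω, X x ω ∂P

/-- The covariance function of a process. -/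
def covFun (P : Measure Ω) (X : ℝ → Ω → ℝ) (x x' : ℝ) : ℝ := cov[X x, X x'; P]

/-- The process restricted to `[0,1]`, as a random element of `ℝ^[0,1]`. -/
def trajectory (X : ℝ → Ω → ℝ) (ω : Ω) (x : Icc (0 : ℝ) 1) : ℝ := X x ω

/-- `η 0, η 1, …` are i.i.d. (measurable) second order processes on `[0,1]` with
`E ∫ η² < ∞` and stationary covariance `Cov (η(x), η(x')) = C (|x - x'|)`. -/
structure IsStationarySample (P : Measure Ω) (η : ℕ → ℝ → Ω → ℝ) (C : ℝ → ℝ) : Prop where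
  measurable : ∀ i, Measurable (Function.uncurry (η i))
  memLp : ∀ i, ∀ x ∈ Icc (0 : ℝ) 1, MemLp (η i x) 2 P
  integrable_sq : ∀ i,
    Integrable (fun z : ℝ × Ω => η i z.1 z.2 ^ 2) ((volume.restrict (Icc (0 : ℝ) 1)).prod P)
  indep : iIndepFun (fun i => trajectory (η i)) P
  identDistrib : ∀ i, IdentDistrib (trajectory (η i)) (trajectory (η 0)) P P
  stationary : ∀ x ∈ Icc (0 : ℝ) 1, ∀ x' ∈ Icc (0 : ℝ) 1, covFun P (η 0) x x' = C |x - x'|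

/-- `lam 0 ≥ lam 1 ≥ … ≥ 0` (summable) are the eigenvalues of the kernel `G` on `[0,1]²`, with
eigenfunctions `ψ 0, ψ 1, …` that form an orthonormal basis of `L²[0,1]`. -/
structure IsEigenSystem (G : ℝ → ℝ → ℝ) (lam : ℕ → ℝ) (ψ : ℕ → ℝ → ℝ) : Prop where
  antitone : Antitone lam
  nonneg : ∀ k, 0 ≤ lam k
  summable : Summable lam
  basis : ∃ b : HilbertBasis ℕ ℝ (Lp ℝ 2 (volume.restrict (Icc (0 : ℝ) 1))),
    ∀ k, (b k : ℝ → ℝ) =ᵐ[volume.restrict (Icc (0 : ℝ) 1)] ψ k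
  eigen : ∀ k, ∀ x ∈ Icc (0 : ℝ) 1, ∫ x' in (0 : ℝ)..1, G x x' * ψ k x' = lam k * ψ k x

/-- The rescaled eigenfunctions `φ_k = √λ_k ψ_k` (functional principal components). -/
def fpc (lam : ℕ → ℝ) (ψ : ℕ → ℝ → ℝ) (k : ℕ) (x : ℝ) : ℝ := √(lam k) * ψ k x

/-- `ξ i k` is the `k`-th functional principal component score of `η i`: it satisfies
`∫ (η_i - m) φ_k = λ_k ξ_ik`, the scores of one process are uncorrelated with mean `0` and
variance `1`, and the score sequences of the processes are i.i.d. (The last two properties follow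
from the first one for the scores with `λ_k ≠ 0`; they fix the convention for the scores with
`λ_k = 0`, which do not contribute to `η_i`.) -/
structure IsFPCScores (P : Measure Ω) (η : ℕ → ℝ → Ω → ℝ) (lam : ℕ → ℝ) (ψ : ℕ → ℝ → ℝ)
    (ξ : ℕ → ℕ → Ω → ℝ) : Prop where
  score : ∀ i k, ∀ᵐ ω ∂P,
    ∫ x in (0 : ℝ)..1, (η i x ω - meanFun P (η i) x) * fpc lam ψ k x = lam k * ξ i k ω
  memLp : ∀ i k, MemLp (ξ i k) 2 P
  mean : ∀ i k, ∫ ω, ξ i k ω ∂P = 0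
  uncorrelated : ∀ i k k', ∫ ω, ξ i k ω * ξ i k' ω ∂P = if k = k' then 1 else 0
  indep : iIndepFun (fun i ω k => ξ i k ω) P
  identDistrib : ∀ i, IdentDistrib (fun ω k => ξ i k ω) (fun ω k => ξ 0 k ω) P P

/-- `ε i j` are i.i.d. errors with mean `0` and variance `1`, independent of the processes `η i`. -/
structure IsErrorArray (P : Measure Ω) (η : ℕ → ℝ → Ω → ℝ) (ε : ℕ → ℕ → Ω → ℝ) : Prop where
  memLp : ∀ i j, MemLp (ε i j) 2 P
  mean : ∀ i j, ∫ ω, ε i j ω ∂P = 0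
  variance : ∀ i j, ∫ ω, ε i j ω ^ 2 ∂P = 1
  indep : iIndepFun (fun a : ℕ × ℕ => ε a.1 a.2) P
  identDistrib : ∀ i j, IdentDistrib (ε i j) (ε 0 0) P P
  indep_process :
    IndepFun (fun ω (i : ℕ) => trajectory (η i) ω) (fun ω (a : ℕ × ℕ) => ε a.1 a.2 ω) P

/-- `U i j`, `i < a`, `j < b`, are i.i.d. standard normal. -/
def IsStdNormalArray (P : Measure Ω) (a b : ℕ) (U : ℕ → ℕ → Ω → ℝ) : Prop :=
  iIndepFun (fun s : Fin a × Fin b => U s.1 s.2) P ∧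
    ∀ i < a, ∀ j < b, HasLaw (U i j) (gaussianReal 0 1) P

/-- The observations `Y_ij = η_i(x_j) + σ(x_j) ε_ij` at the design points of size `N`. -/
def observation (η : ℕ → ℝ → Ω → ℝ) (σ : ℝ → ℝ) (ε : ℕ → ℕ → Ω → ℝ) (N i : ℕ) (ω : Ω) (j : ℕ) :
    ℝ :=
  η i (gridPoint N j) ω + σ (gridPoint N j) * ε i j ω

/-- The infeasible estimator, computed from the true `Z_i = η_i - m`, `i < n`. -/
def Ctilde (P : Measure Ω) (η : ℕ → ℝ → Ω → ℝ) (n : ℕ) (ω : Ω) (h : ℝ) : ℝ :=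
  lagCov n (fun i x => η i x ω - meanFun P (η i) x) h

/-- The two-step estimator, computed from the residuals of the fitted curves,
`Ẑ_i = η̂_i - m̂` with `m̂ = n⁻¹ ∑_i η̂_i`. -/
def Chat (n : ℕ) (etaHat : ℕ → Ω → ℝ → ℝ) (ω : Ω) (h : ℝ) : ℝ :=
  lagCov n (centered n (fun i => etaHat i ω)) h

/-- `X N = o_p (a N)` as `N → ∞`, for `[0, ∞]`-valued `X N`. -/
def IsLittleOp (P : Measure Ω) (X : ℕ → Ω → ℝ≥0∞) (a : ℕ → ℝ) : Prop :=
  ∀ δ : ℝ, 0 < δ → Tendsto (fun N => P {ω | ENNReal.ofReal (δ * a N) < X N ω}) atTop (𝓝 0)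

end

/-! All estimates take place in L²[0,1] and use second moments only. For fixed h, integrating f(x)
g(x + h) over [0, 1 - h] is a bilinear form bounded by ‖f‖‖g‖, with constant 1 for every h
(`abs_lagForm_le`), and 1/(1-h) ≤ 1/(1-h₀). A bound on the difference of two empirical second
moments that involves norms only is therefore uniform in h. It is enough to bound `covErrorBound`,
one random variable free of h, by o(n^{-1/2}) in mean and to apply Markov's inequality
(`measure_lt_iSup_le`).

Least squares fitting is linear in the data. Up to the fit of the mean function, which is common to
all curves and cancels in the centering, the i-th fitted curve is T_i + r_i + e_i. Here T_i =
∑_{k<K} ξ_ik s_k with splines s_k close to φ_k is reproduced exactly by the fit, r_i is the fit of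
the grid values of Z_i - T_i, and e_i is the fit of the noise. The true process is Z_i = T_i + ρ_i.
Let Δ dominate the spline approximation error, of order J^{-p*}, plus the tail ∑_{k≥K} ‖φ_k‖_∞, and
let H be of order J/N. Then r_i and ρ_i have mean squares of order Δ², while e_i has mean square at
most H, since the fit factors through a projection of rank O(J) (`exists_linear_fit`,
`hasMeanLE_norm_starProjection_sq`).

In the expansion (`abs_centered_sub_le`) the pairings of T_i with r_i and ρ_i cost O(Δ), the squares
cost O(Δ² + H), and the centering costs a further O(1/n). The pairing of T_i with e_i is the
delicate one: Cauchy-Schwarz for each i would only give √H. It is summed over i first, which leaves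
∑_i ξ_ik e_i paired with s_k. As scores and errors are independent, this sum has mean square at most
nH, so the pairing costs O(√(H/n)). The knot conditions give √n Δ → 0 and √n H → 0
(`tendsto_knot_rates`), so every term is o(n^{-1/2}).

Two facts about the processes support this. The truncated Karhunen-Loève expansion must be accurate
at every design point, not just in L²; this follows from Mercer's formula on the diagonal
(`hasSum_fpc_sq`). The scores must be independent of the errors although only the point evaluations
of the trajectories are assumed to be so (`condExp_coeff`, `indepFun_scores_errors`). -/

/-! ### Spline approximation of Hölder functions. -/

/-- Functions on the line that are polynomials of degree less than `r` between consecutive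
multiples of `H`, and `r - 2` times continuously differentiable. -/
structure IsUniformSpline (H : ℝ) (r : ℕ) (g : ℝ → ℝ) : Prop where
  intervalIntegrable : ∀ a b, IntervalIntegrable g volume a b
  contDiff : ∀ s : ℕ, s + 2 ≤ r → ContDiff ℝ s g
  poly : ∀ l : ℤ, ∃ Q : Polynomial ℝ, Q.degree < r ∧
    ∀ x ∈ Ico (l * H) ((l + 1) * H), g x = Q.eval x

theorem Polynomial.exists_antiderivative {r : ℕ} (Q : Polynomial ℝ) (hQ : Q.degree < r) :
    ∃ R : Polynomial ℝ, R.degree < (r + 1 : ℕ) ∧ R.derivative = Q := by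
  refine ⟨∑ n ∈ Finset.range r, Polynomial.monomial (n + 1) (Q.coeff n / (n + 1)), ?_, ?_⟩
  · rw [← Polynomial.mem_degreeLT]
    refine Submodule.sum_mem _ fun n hn => ?_
    rw [Polynomial.mem_degreeLT]
    refine (Polynomial.degree_monomial_le _ _).trans_lt ?_
    exact_mod_cast Nat.succ_lt_succ (Finset.mem_range.1 hn)
  · rw [Polynomial.derivative_sum]
    have hterm : ∀ n : ℕ, (Polynomial.monomial (n + 1) (Q.coeff n / (n + 1))).derivative
        = Polynomial.monomial n (Q.coeff n) := fun n => by
      rw [Polynomial.derivative_monomial]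
      have : (n + 1 : ℝ) ≠ 0 := by positivity
      simp [this]
    simp_rw [hterm]
    ext m
    rw [Polynomial.finsetSum_coeff]
    simp only [Polynomial.coeff_monomial, Finset.sum_ite_eq', Finset.mem_range]
    split_ifs with h
    · rfl
    · exact (Polynomial.coeff_eq_zero_of_degree_lt
        (hQ.trans_le (by exact_mod_cast not_lt.1 h))).symm

namespace IsUniformSpline

variable {H : ℝ} {r : ℕ} {g g' : ℝ → ℝ}

theorem add (hg : IsUniformSpline H r g) (hg' : IsUniformSpline H r g') :
    IsUniformSpline H r (fun x => g x + g' x) where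
  intervalIntegrable a b := (hg.1 a b).add (hg'.1 a b)
  contDiff s hs := (hg.2 s hs).add (hg'.2 s hs)
  poly l := by
    obtain ⟨Q, hQ, h⟩ := hg.3 l
    obtain ⟨Q', hQ', h'⟩ := hg'.3 l
    refine ⟨Q + Q', (Polynomial.degree_add_le _ _).trans_lt (max_lt hQ hQ'), fun x hx => ?_⟩
    rw [Polynomial.eval_add, h x hx, h' x hx]

theorem const_mul (hg : IsUniformSpline H r g) (c : ℝ) :
    IsUniformSpline H r (fun x => c * g x) where
  intervalIntegrable a b := (hg.1 a b).const_mul c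
  contDiff s hs := contDiff_const.mul (hg.2 s hs)
  poly l := by
    obtain ⟨Q, hQ, h⟩ := hg.3 l
    refine ⟨Polynomial.C c * Q, ?_, fun x hx => ?_⟩
    · rw [← Polynomial.smul_eq_C_mul]
      exact (Polynomial.degree_smul_le _ _).trans_lt hQ
    · rw [Polynomial.eval_mul, Polynomial.eval_C, h x hx]

theorem comp_sub (hg : IsUniformSpline H r g) : IsUniformSpline H r (fun x => g (x - H)) where
  intervalIntegrable a b := by simpa using (hg.1 (a - H) (b - H)).comp_sub_right H
  contDiff s hs := (hg.2 s hs).comp (contDiff_id.sub contDiff_const)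
  poly l := by
    obtain ⟨Q, hQ, h⟩ := hg.3 (l - 1)
    refine ⟨Polynomial.taylor (-H) Q, by rwa [Polynomial.degree_taylor], fun x hx => ?_⟩
    · rw [h (x - H)]
      · rw [Polynomial.taylor_eval, sub_eq_add_neg]
      · push_cast
        constructor <;> linarith [hx.1, hx.2]

theorem continuous (hg : IsUniformSpline H r g) (hr : 2 ≤ r) : Continuous g :=
  (hg.contDiff 0 (by simpa using hr)).continuous

theorem primitive (hg : IsUniformSpline H r g) :
    IsUniformSpline H (r + 1) (fun x => ∫ t in (0 : ℝ)..x, g t) := by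
  have hcont : Continuous (fun x => ∫ t in (0 : ℝ)..x, g t) :=
    intervalIntegral.continuous_primitive hg.1 0
  refine ⟨fun a b => hcont.intervalIntegrable a b, fun s hs => ?_, fun l => ?_⟩
  · rcases s with _ | s
    · exact contDiff_zero.2 hcont
    · have hgc : Continuous g := hg.continuous (by omega)
      have hd : ∀ x, HasDerivAt (fun x => ∫ t in (0 : ℝ)..x, g t) (g x) x := fun x =>
        intervalIntegral.integral_hasDerivAt_right (hg.1 _ _)
          hgc.aestronglyMeasurable.stronglyMeasurableAtFilter hgc.continuousAt
      rw [Nat.cast_add, Nat.cast_one, contDiff_succ_iff_deriv]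
      refine ⟨fun x => (hd x).differentiableAt, by simp, ?_⟩
      rw [show deriv (fun x => ∫ t in (0 : ℝ)..x, g t) = g from funext fun x => (hd x).deriv]
      exact hg.contDiff s (by omega)
  · obtain ⟨Q, hQ, h⟩ := hg.3 l
    obtain ⟨R, hR, hRQ⟩ := Polynomial.exists_antiderivative Q hQ
    refine ⟨R + Polynomial.C ((∫ t in (0 : ℝ)..(l * H), g t) - R.eval (l * H)), ?_,
      fun x hx => ?_⟩
    · refine (Polynomial.degree_add_le _ _).trans_lt (max_lt hR ?_)
      refine Polynomial.degree_C_le.trans_lt ?_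
      exact_mod_cast Nat.succ_pos r
    · have h1 : ∫ t in (l * H)..x, g t = R.eval x - R.eval (l * H) := by
        rw [← intervalIntegral.integral_eq_sub_of_hasDerivAt (f := fun x => R.eval x)
          (f' := fun x => Q.eval x) (fun y _ => hRQ ▸ R.hasDerivAt y)
          (Q.continuous.intervalIntegrable _ _)]
        refine intervalIntegral.integral_congr fun y hy => ?_
        rw [uIcc_of_le hx.1] at hy
        exact h y ⟨hy.1, hy.2.trans_lt hx.2⟩
      rw [← intervalIntegral.integral_add_adjacent_intervals (hg.1 0 (l * H)) (hg.1 (l * H) x), h1]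
      simp only [Polynomial.eval_add, Polynomial.eval_C]
      ring

/-- Averaging over a window of length `H` raises the order of a spline. -/
theorem average (hg : IsUniformSpline H r g) :
    IsUniformSpline H (r + 1) (fun x => H⁻¹ * ∫ t in (x - H)..x, g t) := by
  have h := (hg.primitive.add (hg.primitive.comp_sub.const_mul (-1))).const_mul H⁻¹
  convert h using 3 with x
  rw [← intervalIntegral.integral_interval_sub_left (hg.1 0 x) (hg.1 0 (x - H))]
  ring

end IsUniformSpline

/-- Local approximation of a function by splines of every order. -/
theorem exists_isUniformSpline_forall_abs_sub_le {H : ℝ} (hH : 0 < H) {F : ℝ → ℝ}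
    (hF : Measurable F) {B : ℝ} (hB : ∀ x, |F x| ≤ B) (r : ℕ) :
    ∃ g, IsUniformSpline H (r + 1) g ∧ ∀ x c ρ,
      (∀ y ∈ Icc (x - (r + 1) * H) x, |F y - c| ≤ ρ) → |g x - c| ≤ ρ := by
  induction r with
  | zero =>
    -- Order one: sample at the last knot before x, which lies in the window [x - H, x].
    refine ⟨fun x => F (H * ⌊x / H⌋), ⟨fun a b => ?_, fun s hs => by omega, fun l => ?_⟩, ?_⟩
    · refine (intervalIntegrable_const (c := B)).mono_fun ?_ ?_
      · refine Measurable.aestronglyMeasurable ?_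
        fun_prop
      · refine Eventually.of_forall fun x => ?_
        simp only [Real.norm_eq_abs]
        exact (hB _).trans (le_abs_self B)
    · refine ⟨Polynomial.C (F (H * l)), ?_, fun x hx => ?_⟩
      · refine Polynomial.degree_C_le.trans_lt ?_
        norm_num
      · have : ⌊x / H⌋ = l := by
          rw [Int.floor_eq_iff]
          exact ⟨(le_div_iff₀ hH).2 hx.1, (div_lt_iff₀ hH).2 hx.2⟩
        rw [this, Polynomial.eval_C]
    · intro x c ρ h
      refine h _ ⟨?_, ?_⟩
      · have := Int.lt_floor_add_one (x / H)
        rw [div_lt_iff₀ hH] at this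
        simp only [CharP.cast_eq_zero, zero_add, one_mul]
        nlinarith
      · have := Int.floor_le (x / H)
        rw [le_div_iff₀ hH] at this
        linarith
  | succ r ih =>
    obtain ⟨g, hg, hgc⟩ := ih
    -- An average of values within ρ of c is within ρ of c, and averaging lengthens the window of
    -- dependence by H. This keeps the approximation local while the order rises.
    refine ⟨_, hg.average, fun x c ρ h => ?_⟩
    have h1 : H⁻¹ * (∫ t in (x - H)..x, g t) - c = H⁻¹ * ∫ t in (x - H)..x, (g t - c) := by
      rw [intervalIntegral.integral_sub (hg.1 _ _) intervalIntegrable_const,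
        intervalIntegral.integral_const]
      simp only [sub_sub_cancel, smul_eq_mul]
      field_simp
    have h2 : ‖∫ t in (x - H)..x, (g t - c)‖ ≤ ρ * |x - (x - H)| := by
      refine intervalIntegral.norm_integral_le_of_norm_le_const fun t ht => ?_
      rw [uIoc_of_le (by linarith)] at ht
      refine hgc t c ρ fun y hy => h y ⟨?_, hy.2.trans ht.2⟩
      push_cast
      linarith [hy.1, ht.1]
    rw [h1, abs_mul, abs_of_pos (inv_pos.2 hH)]
    rw [Real.norm_eq_abs, sub_sub_cancel, abs_of_pos hH] at h2
    rw [inv_mul_le_iff₀ hH]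
    linarith

/-- The averaging windows reach to the left of 0, so f is first extended by constants through
`projIcc`, which does not increase its modulus of continuity. On a window of length (r + 1)H behind
x the extension differs from f x by at most L((r + 1)H)^α, and the local approximation takes c = f
x. -/
theorem exists_isUniformSpline_of_holder {H : ℝ} (hH : 0 < H) {α L : ℝ} (hα : 0 < α) (hL : 0 ≤ L)
    {f : ℝ → ℝ} (hf : ∀ x ∈ Icc (0 : ℝ) 1, ∀ y ∈ Icc (0 : ℝ) 1, |f x - f y| ≤ L * |x - y| ^ α)
    (r : ℕ) :
    ∃ g, IsUniformSpline H (r + 1) g ∧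
      ∀ x ∈ Icc (0 : ℝ) 1, |f x - g x| ≤ L * ((r + 1) * H) ^ α := by
  set F : ℝ → ℝ := fun x => f (projIcc 0 1 zero_le_one x) with hFdef
  have hF : ∀ x y, |F x - F y| ≤ L * |x - y| ^ α := fun x y => by
    refine (hf _ (projIcc 0 1 zero_le_one x).2 _ (projIcc 0 1 zero_le_one y).2).trans ?_
    exact mul_le_mul_of_nonneg_left (Real.rpow_le_rpow (abs_nonneg _)
      (abs_projIcc_sub_projIcc (zero_le_one (α := ℝ))) hα.le) hL
  have hFc : Continuous F := by
    rw [Metric.continuous_iff']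
    intro a ε hε
    have : Tendsto (fun x => L * |x - a| ^ α) (𝓝 a) (𝓝 (L * |a - a| ^ α)) := by
      refine Continuous.tendsto ?_ a
      exact continuous_const.mul ((continuous_abs.comp (continuous_id.sub continuous_const)).rpow_const
        fun _ => Or.inr hα.le)
    rw [sub_self, abs_zero, Real.zero_rpow hα.ne', mul_zero] at this
    filter_upwards [this.eventually_lt_const hε] with x hx
    exact (hF x a).trans_lt hx
  have hFB : ∀ x, |F x| ≤ |F 0| + L := fun x => by
    have h0 : |f (projIcc 0 1 zero_le_one x) - f 0| ≤ L := by
      refine (hf _ (projIcc 0 1 zero_le_one x).2 0 (by simp)).trans ?_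
      have h1 := (projIcc (0 : ℝ) 1 zero_le_one x).2
      have h2 : |((projIcc (0 : ℝ) 1 zero_le_one x : Icc (0 : ℝ) 1) : ℝ) - 0| ^ α ≤ 1 := by
        refine Real.rpow_le_one (abs_nonneg _) ?_ hα.le
        rw [sub_zero, abs_of_nonneg h1.1]
        exact h1.2
      nlinarith
    have h3 : F 0 = f 0 := by simp [hFdef]
    have : F x = F 0 + (F x - F 0) := by ring
    rw [this]
    refine (abs_add_le _ _).trans ?_
    rw [h3]
    gcongr
  obtain ⟨g, hg, hgF⟩ := exists_isUniformSpline_forall_abs_sub_le hH hFc.measurable hFB r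
  refine ⟨g, hg, fun x hx => ?_⟩
  have h0 : F x = f x := by simp [hFdef, projIcc_of_mem zero_le_one hx]
  rw [← h0, abs_sub_comm]
  refine hgF x _ _ fun y hy => (hF y x).trans ?_
  gcongr
  rw [abs_le]
  constructor <;> nlinarith [hy.1, hy.2]

/-- Induction on q: approximate f' by a spline with error E and integrate it. What is left of f is
E-Lipschitz, so the Hölder case with exponent 1 applied to the remainder gains one more factor H.
The sum of the primitive and the second spline approximates f. -/
theorem exists_isUniformSpline_of_iteratedDerivWithin_holder {H : ℝ} (hH : 0 < H) {α L : ℝ}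
    (hα : 0 < α) (hL : 0 ≤ L) (q r : ℕ) (hqr : q ≤ r) {f : ℝ → ℝ}
    (hfq : ContDiffOn ℝ q f (Icc 0 1))
    (hf : ∀ x ∈ Icc (0 : ℝ) 1, ∀ y ∈ Icc (0 : ℝ) 1,
      |iteratedDerivWithin q f (Icc 0 1) x - iteratedDerivWithin q f (Icc 0 1) y|
        ≤ L * |x - y| ^ α) :
    ∃ g, IsUniformSpline H (r + 1) g ∧
      ∀ x ∈ Icc (0 : ℝ) 1, |f x - g x| ≤ L * ((r + 1) * H) ^ (q + α) := by
  induction q generalizing r f with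
  | zero =>
    simpa using exists_isUniformSpline_of_holder hH hα hL (by simpa using hf) r
  | succ q ih =>
    obtain ⟨r, rfl⟩ : ∃ r', r = r' + 1 := ⟨r - 1, by omega⟩
    have huniq : UniqueDiffOn ℝ (Icc (0 : ℝ) 1) := uniqueDiffOn_Icc zero_lt_one
    have hfq' := hfq
    rw [Nat.cast_add, Nat.cast_one, contDiffOn_succ_iff_derivWithin huniq] at hfq'
    obtain ⟨hfd, -, hfd'⟩ := hfq'
    obtain ⟨g, hg, hfg⟩ := ih r (by omega) hfd' (fun x hx y hy => by
      have := hf x hx y hy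
      rwa [iteratedDerivWithin_succ'] at this)
    set E : ℝ := L * ((r + 1) * H) ^ (q + α) with hE
    have hE0 : 0 ≤ E := by positivity
    have hcf' : ContinuousOn (derivWithin f (Icc 0 1)) (Icc 0 1) := hfd'.continuousOn
    have hsub : ∀ x ∈ Icc (0 : ℝ) 1, ∀ y ∈ Icc (0 : ℝ) 1, x ≤ y → Icc x y ⊆ Icc 0 1 :=
      fun x hx y hy _ => Icc_subset_Icc hx.1 hy.2
    have key : ∀ x ∈ Icc (0 : ℝ) 1, ∀ y ∈ Icc (0 : ℝ) 1, x ≤ y →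
        |(f x - ∫ t in (0 : ℝ)..x, g t) - (f y - ∫ t in (0 : ℝ)..y, g t)| ≤ E * |x - y| := by
      intro x hx y hy hxy
      have hi : IntervalIntegrable (derivWithin f (Icc 0 1)) volume x y :=
        (hcf'.mono (by rw [uIcc_of_le hxy]; exact hsub x hx y hy hxy)).intervalIntegrable
      have h1 : ∫ t in x..y, derivWithin f (Icc 0 1) t = f y - f x := by
        refine intervalIntegral.integral_eq_sub_of_hasDerivAt_of_le hxy
          (hfq.continuousOn.mono (hsub x hx y hy hxy)) (fun t ht => ?_) hi
        have htt : Icc (0 : ℝ) 1 ∈ 𝓝 t :=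
          Icc_mem_nhds (hx.1.trans_lt ht.1) (ht.2.trans_le hy.2)
        exact (hfd t (mem_of_mem_nhds htt)).hasDerivWithinAt.hasDerivAt htt
      have h2 := intervalIntegral.integral_interval_sub_left (hg.1 0 y) (hg.1 0 x)
      have h3 : (f x - ∫ t in (0 : ℝ)..x, g t) - (f y - ∫ t in (0 : ℝ)..y, g t)
          = -∫ t in x..y, (derivWithin f (Icc 0 1) t - g t) := by
        rw [intervalIntegral.integral_sub hi (hg.1 _ _), h1, ← h2]
        ring
      rw [h3, abs_neg, abs_sub_comm x y]
      rw [← Real.norm_eq_abs]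
      refine intervalIntegral.norm_integral_le_of_norm_le_const fun t ht => ?_
      rw [uIoc_of_le hxy] at ht
      exact hfg t ⟨hx.1.trans ht.1.le, ht.2.trans hy.2⟩
    -- The order is r + 2 here, to match that of the primitive of g.
    obtain ⟨g₂, hg₂, hfg₂⟩ := exists_isUniformSpline_of_holder hH one_pos hE0
      (f := fun x => f x - ∫ t in (0 : ℝ)..x, g t) (fun x hx y hy => by
        rw [Real.rpow_one]
        rcases le_total x y with h | h
        · exact key x hx y hy h
        · rw [abs_sub_comm, abs_sub_comm x y]
          exact key y hy x hx h) (r + 1)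
    refine ⟨_, hg.primitive.add hg₂, fun x hx => ?_⟩
    have h4 := hfg₂ x hx
    rw [Real.rpow_one] at h4
    rw [← sub_sub]
    refine h4.trans ?_
    have h5 : (((r + 1 : ℕ) : ℝ) + 1) * H = (r + 1 + 1) * H := by push_cast; ring
    have h6 : ((q + 1 : ℕ) : ℝ) + α = (q + α) + 1 := by push_cast; ring
    rw [h5, h6, Real.rpow_add_one (by positivity), ← mul_assoc L]
    have h7 : E ≤ L * ((r + 1 + 1) * H) ^ (q + α) := by
      rw [hE]
      gcongr
      linarith
    exact mul_le_mul_of_nonneg_right h7 (by positivity)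

/-- The pieces of a uniform spline live on half-open intervals, whereas the last knot interval
contains its right end 1. The polynomial identity passes to the closure because order at least two
makes the spline continuous. -/
theorem IsUniformSpline.mem_splineSpace {p J : ℕ} (hp : 2 ≤ p) {g : ℝ → ℝ}
    (hg : IsUniformSpline (1 / ((J : ℝ) + 1)) p g) : g ∈ splineSpace p J := by
  have hJ : (0 : ℝ) < J + 1 := by positivity
  refine ⟨fun s hs => (hg.contDiff s hs).contDiffOn, fun l hl => ?_⟩
  obtain ⟨Q, hQ, h⟩ := hg.poly l
  have h' : ∀ x ∈ Ico (knot J l) (knot J (l + 1)), g x = Q.eval x := fun x hx => by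
    refine h x ?_
    simpa [knot, div_eq_mul_inv] using hx
  refine ⟨Q, hQ, fun x hx => ?_⟩
  rw [knotInterval] at hx
  split_ifs at hx with hlJ
  · exact h' x hx
  · obtain rfl : l = J := by omega
    have h1 : knot l (l + 1) = 1 := by
      simp only [knot, Nat.cast_add, Nat.cast_one]
      field_simp
    rw [h1] at h'
    have h2 : knot l l ≠ 1 := by
      simp only [knot]
      rw [ne_eq, div_eq_iff hJ.ne']
      linarith
    have h3 : EqOn g (fun x => Q.eval x) (closure (Ico (knot l l) 1)) :=
      EqOn.closure h' (hg.continuous hp) Q.continuous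
    rw [closure_Ico h2] at h3
    exact h3 hx

theorem holderSeminorm_spec {q : ℕ} {μ : ℝ≥0} {f : ℝ → ℝ} (hf : f ∈ holderSpace q μ)
    {x y : ℝ} (hx : x ∈ Icc (0 : ℝ) 1) (hy : y ∈ Icc (0 : ℝ) 1) :
    |iteratedDerivWithin q f (Icc 0 1) x - iteratedDerivWithin q f (Icc 0 1) y|
      ≤ (holderSeminorm q μ f).toReal * |x - y| ^ (μ : ℝ) := by
  have h := (eHolderNorm_lt_top.1 hf.2).holderWith
  have := h.dist_le ⟨x, hx⟩ ⟨y, hy⟩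
  exact this

/-- Splines of order `p` with `J` equally spaced interior knots approximate functions of Hölder
smoothness `q + μ ≤ p` at the rate `J ^ (-(q + μ))`. -/
theorem exists_mem_splineSpace_abs_sub_le {p q : ℕ} {μ : ℝ≥0} (hμ : 0 < μ) (hq : q + 1 ≤ p)
    (hp : 2 ≤ p) (J : ℕ) {f : ℝ → ℝ} (hf : f ∈ holderSpace q μ) :
    ∃ g ∈ splineSpace p J, ∀ x ∈ Icc (0 : ℝ) 1,
      |f x - g x| ≤ (holderSeminorm q μ f).toReal * (p / ((J : ℝ) + 1)) ^ ((q : ℝ) + μ) := by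
  obtain ⟨r, rfl⟩ : ∃ r, p = r + 1 := ⟨p - 1, by omega⟩
  obtain ⟨g, hg, h⟩ := exists_isUniformSpline_of_iteratedDerivWithin_holder
    (H := 1 / ((J : ℝ) + 1)) (by positivity) (α := μ) (by exact_mod_cast hμ)
    ENNReal.toReal_nonneg q r (by omega) hf.1 (fun x hx y hy => holderSeminorm_spec hf hx hy)
  refine ⟨g, hg.mem_splineSpace hp, fun x hx => ?_⟩
  have := h x hx
  rwa [mul_one_div, ← Nat.cast_add_one] at this

/-! ### Norm equivalence for polynomials of bounded degree. -/

/-- The integral is continuous and homogeneous of degree 2 in the coefficients, and positive off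
zero because a polynomial vanishing on [0,1] is zero. Its minimum over the compact unit sphere is
the constant. -/
theorem exists_pos_mul_norm_sq_le_integral_poly (p : ℕ) :
    ∃ m : ℝ, 0 < m ∧ ∀ c : Fin p → ℝ,
      m * ‖c‖ ^ 2 ≤ ∫ x in (0 : ℝ)..1, (∑ i, c i * x ^ (i : ℕ)) ^ 2 := by
  set F : (Fin p → ℝ) → ℝ := fun c => ∫ x in (0 : ℝ)..1, (∑ i, c i * x ^ (i : ℕ)) ^ 2 with hFdef
  have hFc : Continuous F := by
    refine intervalIntegral.continuous_parametric_intervalIntegral_of_continuous' ?_ 0 1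
    simp only [Function.uncurry_def]
    fun_prop
  have hFpos : ∀ c, c ≠ 0 → 0 < F c := by
    intro c hc
    refine intervalIntegral.integral_pos one_pos (by fun_prop) (fun x _ => sq_nonneg _) ?_
    by_contra! hcon
    refine hc ?_
    set Q := (Polynomial.degreeLTEquiv ℝ p).symm c with hQ
    have hQe : ∀ x, (Q : Polynomial ℝ).eval x = ∑ i, c i * x ^ (i : ℕ) := fun x => by
      rw [Polynomial.eval_eq_sum_degreeLTEquiv Q.2]
      simp [hQ]
    have hQ0 : (Q : Polynomial ℝ) = 0 := by
      refine Polynomial.eq_zero_of_infinite_isRoot _ ((Icc_infinite (zero_lt_one (α := ℝ))).mono ?_)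
      intro x hx
      change (Q : Polynomial ℝ).eval x = 0
      rw [hQe]
      exact pow_eq_zero_iff two_ne_zero |>.1 (le_antisymm (hcon x hx) (sq_nonneg _))
    have : Q = 0 := Subtype.ext hQ0
    rwa [hQ, LinearEquiv.symm_apply_eq, map_zero] at this
  have hhom : ∀ (t : ℝ) c, F (t • c) = t ^ 2 * F c := fun t c => by
    simp only [hFdef]
    rw [← intervalIntegral.integral_const_mul]
    refine intervalIntegral.integral_congr fun x _ => ?_
    simp only [Pi.smul_apply, smul_eq_mul, mul_assoc, ← Finset.mul_sum, mul_pow]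
  -- The sphere is empty when p = 0; any constant works then.
  rcases (Metric.sphere (0 : Fin p → ℝ) 1).eq_empty_or_nonempty with he | hne
  · refine ⟨1, one_pos, fun c => ?_⟩
    have : c = 0 := by
      by_contra hc
      have : ‖c‖⁻¹ • c ∈ Metric.sphere (0 : Fin p → ℝ) 1 := by
        rw [mem_sphere_zero_iff_norm, norm_smul, norm_inv, norm_norm,
          inv_mul_cancel₀ (norm_ne_zero_iff.2 hc)]
      simp [he] at this
    simp [this]
  · obtain ⟨c₀, hc₀, hmin⟩ := (isCompact_sphere (0 : Fin p → ℝ) 1).exists_isMinOn hne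
      hFc.continuousOn
    refine ⟨F c₀, hFpos _ (ne_zero_of_mem_unit_sphere (⟨c₀, hc₀⟩ : Metric.sphere _ _)),
      fun c => ?_⟩
    by_cases hc : c = 0
    · simp [hc]
    have hcn : ‖c‖ ≠ 0 := norm_ne_zero_iff.2 hc
    have h1 : F c₀ ≤ F (‖c‖⁻¹ • c) := hmin (by
      rw [mem_sphere_zero_iff_norm, norm_smul, norm_inv, norm_norm, inv_mul_cancel₀ hcn])
    rw [hhom, inv_pow, ← div_eq_inv_mul, le_div_iff₀ (by positivity)] at h1
    exact h1

/-- Norm equivalence on polynomials of bounded degree over `[0,1]`. -/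
theorem exists_polynomial_sq_le_integral_unit (p : ℕ) :
    ∃ C : ℝ, 0 < C ∧ ∀ Q : Polynomial ℝ, Q.degree < p → ∀ x ∈ Icc (0 : ℝ) 1,
      Q.eval x ^ 2 ≤ C * (∫ t in (0 : ℝ)..1, Q.eval t ^ 2) ∧ ∀ y ∈ Icc (0 : ℝ) 1,
      |Q.eval x ^ 2 - Q.eval y ^ 2| ≤ C * |x - y| * ∫ t in (0 : ℝ)..1, Q.eval t ^ 2 := by
  obtain ⟨m, hm, hmc⟩ := exists_pos_mul_norm_sq_le_integral_poly p
  -- On [0,1] the polynomial is bounded by p‖c‖ and is p²‖c‖-Lipschitz, so its square is bounded by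
  -- p²‖c‖² and is 2p³‖c‖²-Lipschitz. The 1 keeps the constant positive when p = 0.
  refine ⟨(p ^ 2 + 2 * p ^ 3 + 1) / m, by positivity, fun Q hQ x hx => ?_⟩
  set c := Polynomial.degreeLTEquiv ℝ p ⟨Q, Polynomial.mem_degreeLT.2 hQ⟩
  have hQe : ∀ x, Q.eval x = ∑ i, c i * x ^ (i : ℕ) := fun x =>
    Polynomial.eval_eq_sum_degreeLTEquiv (Polynomial.mem_degreeLT.2 hQ) x
  have hI : ‖c‖ ^ 2 ≤ (∫ t in (0 : ℝ)..1, Q.eval t ^ 2) / m := by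
    rw [le_div_iff₀ hm, mul_comm]
    simp only [hQe]
    exact hmc c
  have hb : ∀ x ∈ Icc (0 : ℝ) 1, |Q.eval x| ≤ p * ‖c‖ := fun x hx => by
    rw [hQe]
    refine (Finset.abs_sum_le_sum_abs _ _).trans ?_
    refine (Finset.sum_le_card_nsmul _ _ ‖c‖ fun i _ => ?_).trans (by simp)
    rw [abs_mul]
    have h1 : |x ^ (i : ℕ)| ≤ 1 := by
      rw [abs_pow, abs_of_nonneg hx.1]
      exact pow_le_one₀ hx.1 hx.2
    have h2 : |c i| ≤ ‖c‖ := norm_le_pi_norm c i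
    nlinarith [abs_nonneg (c i), abs_nonneg (x ^ (i : ℕ))]
  have hl : ∀ y ∈ Icc (0 : ℝ) 1, |Q.eval x - Q.eval y| ≤ p ^ 2 * ‖c‖ * |x - y| := fun y hy => by
    rw [hQe, hQe, ← Finset.sum_sub_distrib]
    refine (Finset.abs_sum_le_sum_abs _ _).trans ?_
    refine (Finset.sum_le_card_nsmul _ _ (p * ‖c‖ * |x - y|) fun i _ => ?_).trans
      (le_of_eq (by simp; ring))
    rw [← mul_sub, abs_mul]
    have h1 : |x ^ (i : ℕ) - y ^ (i : ℕ)| ≤ p * |x - y| := by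
      refine (abs_pow_sub_pow_le x y i).trans ?_
      have h3 : max |x| |y| ^ ((i : ℕ) - 1) ≤ 1 := by
        refine pow_le_one₀ (le_max_of_le_left (abs_nonneg _)) (max_le ?_ ?_)
        · rw [abs_of_nonneg hx.1]; exact hx.2
        · rw [abs_of_nonneg hy.1]; exact hy.2
      have h4 : ((i : ℕ) : ℝ) ≤ p := by exact_mod_cast i.2.le
      calc |x - y| * (i : ℕ) * max |x| |y| ^ ((i : ℕ) - 1) ≤ |x - y| * p * 1 := by gcongr
        _ = p * |x - y| := by ring
    have h2 : |c i| ≤ ‖c‖ := norm_le_pi_norm c i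
    calc |c i| * |x ^ (i : ℕ) - y ^ (i : ℕ)| ≤ ‖c‖ * (p * |x - y|) := by gcongr
      _ = p * ‖c‖ * |x - y| := by ring
  have hc2 : 0 ≤ ‖c‖ ^ 2 := by positivity
  have hI0 : (0 : ℝ) ≤ p ^ 2 + 2 * p ^ 3 + 1 := by positivity
  refine ⟨?_, fun y hy => ?_⟩
  · rw [div_mul_eq_mul_div, mul_div_assoc]
    calc Q.eval x ^ 2 = |Q.eval x| ^ 2 := (sq_abs _).symm
      _ ≤ (p * ‖c‖) ^ 2 := by gcongr; exact hb x hx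
      _ = p ^ 2 * ‖c‖ ^ 2 := by ring
      _ ≤ (p ^ 2 + 2 * p ^ 3 + 1) * ‖c‖ ^ 2 := by
        gcongr
        have : (0 : ℝ) ≤ p ^ 3 := by positivity
        linarith
      _ ≤ _ := by gcongr
  · have h1 : Q.eval x ^ 2 - Q.eval y ^ 2 = (Q.eval x + Q.eval y) * (Q.eval x - Q.eval y) := by ring
    rw [h1, abs_mul]
    have h2 : |Q.eval x + Q.eval y| ≤ 2 * p * ‖c‖ := by
      refine (abs_add_le _ _).trans ?_
      linarith [hb x hx, hb y hy]
    calc |Q.eval x + Q.eval y| * |Q.eval x - Q.eval y|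
        ≤ (2 * p * ‖c‖) * (p ^ 2 * ‖c‖ * |x - y|) := by gcongr; exact hl y hy
      _ = (2 * p ^ 3) * |x - y| * ‖c‖ ^ 2 := by ring
      _ ≤ (p ^ 2 + 2 * p ^ 3 + 1) * |x - y| * ((∫ t in (0 : ℝ)..1, Q.eval t ^ 2) / m) := by
        gcongr
        have : (0 : ℝ) ≤ p ^ 2 := by positivity
        linarith
      _ = _ := by ring

/-- Norm equivalence on polynomials of bounded degree over an interval. -/
theorem exists_polynomial_sq_le_integral (p : ℕ) :
    ∃ C : ℝ, 0 < C ∧ ∀ Q : Polynomial ℝ, Q.degree < p → ∀ a H : ℝ, 0 < H →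
      ∀ x ∈ Icc a (a + H),
      Q.eval x ^ 2 ≤ C / H * (∫ t in a..(a + H), Q.eval t ^ 2) ∧ ∀ y ∈ Icc a (a + H),
      |Q.eval x ^ 2 - Q.eval y ^ 2| ≤ C / H * (|x - y| / H) * ∫ t in a..(a + H), Q.eval t ^ 2 := by
  obtain ⟨C, hC, h⟩ := exists_polynomial_sq_le_integral_unit p
  refine ⟨C, hC, fun Q hQ a H hH x hx => ?_⟩
  set R : Polynomial ℝ := Q.comp (Polynomial.C H * Polynomial.X + Polynomial.C a) with hR
  have hRe : ∀ x, R.eval x = Q.eval (H * x + a) := fun x => by simp [hR]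
  have hRd : R.degree < p := by
    rw [hR, Polynomial.degree_comp (by rw [Polynomial.degree_linear hH.ne']; exact one_pos),
      Polynomial.degree_linear hH.ne', mul_one]
    exact hQ
  have hint : ∫ t in (0 : ℝ)..1, R.eval t ^ 2 = H⁻¹ * ∫ t in a..(a + H), Q.eval t ^ 2 := by
    simp only [hRe]
    rw [intervalIntegral.integral_comp_mul_add (fun t => Q.eval t ^ 2) hH.ne' a]
    simp [add_comm]
  have hu : ∀ x ∈ Icc a (a + H), (x - a) / H ∈ Icc (0 : ℝ) 1 ∧ R.eval ((x - a) / H) = Q.eval x := by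
    intro x hx
    refine ⟨⟨div_nonneg (by linarith [hx.1]) hH.le, (div_le_one hH).2 (by linarith [hx.2])⟩, ?_⟩
    rw [hRe, mul_div_cancel₀ _ hH.ne']
    simp
  obtain ⟨h1, h2⟩ := h R hRd _ (hu x hx).1
  refine ⟨?_, fun y hy => ?_⟩
  · rw [(hu x hx).2, hint] at h1
    rwa [div_eq_mul_inv, mul_assoc]
  · have h3 := h2 _ (hu y hy).1
    rw [(hu x hx).2, (hu y hy).2, hint, ← sub_div, abs_div, abs_of_pos hH] at h3
    refine h3.trans (le_of_eq ?_)
    rw [sub_sub_sub_cancel_right]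
    ring

/-! ### The spline space, and its L² norm against the grid norm. -/

/-- The splines of order `p` with `J` equally spaced interior knots as a linear subspace. -/
def splineSubmodule (p J : ℕ) : Submodule ℝ (ℝ → ℝ) where
  carrier := splineSpace p J
  add_mem' := by
    rintro f g ⟨hf, hf'⟩ ⟨hg, hg'⟩
    refine ⟨fun r hr => (hf r hr).add (hg r hr), fun l hl => ?_⟩
    obtain ⟨Q, hQ, h⟩ := hf' l hl
    obtain ⟨Q', hQ', h'⟩ := hg' l hl
    refine ⟨Q + Q', (Polynomial.degree_add_le _ _).trans_lt (max_lt hQ hQ'), fun x hx => ?_⟩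
    rw [Polynomial.eval_add, Pi.add_apply, h x hx, h' x hx]
  zero_mem' := ⟨fun _ _ => contDiffOn_const, fun _ _ => ⟨0, by
    rw [Polynomial.degree_zero]; exact WithBot.bot_lt_coe p, by simp⟩⟩
  smul_mem' := by
    rintro c f ⟨hf, hf'⟩
    refine ⟨fun r hr => contDiffOn_const.smul (hf r hr), fun l hl => ?_⟩
    obtain ⟨Q, hQ, h⟩ := hf' l hl
    exact ⟨c • Q, (Polynomial.degree_smul_le _ _).trans_lt hQ, fun x hx => by
      rw [Polynomial.eval_smul, Pi.smul_apply, h x hx]⟩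

theorem knot_zero (J : ℕ) : knot J 0 = 0 := by simp [knot]

theorem knot_last (J : ℕ) : knot J (J + 1) = 1 := by
  have : (J : ℝ) + 1 ≠ 0 := by positivity
  simp [knot, this]

theorem knot_succ (J l : ℕ) : knot J (l + 1) = knot J l + 1 / ((J : ℝ) + 1) := by
  simp only [knot, Nat.cast_add, Nat.cast_one]
  ring

theorem knot_le_succ (J l : ℕ) : knot J l ≤ knot J (l + 1) := by
  rw [knot_succ]
  have : (0 : ℝ) ≤ 1 / ((J : ℝ) + 1) := by positivity
  linarith

theorem Ico_subset_knotInterval {J l : ℕ} (hl : l ≤ J) :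
    Ico (knot J l) (knot J (l + 1)) ⊆ knotInterval J l := by
  rw [knotInterval]
  split_ifs with h
  · exact subset_rfl
  · obtain rfl : l = J := by omega
    rw [knot_last]
    exact Ico_subset_Icc_self

theorem exists_mem_knotInterval (J : ℕ) {x : ℝ} (hx : x ∈ Icc (0 : ℝ) 1) :
    ∃ l, l ≤ J ∧ x ∈ knotInterval J l := by
  have hJ : (0 : ℝ) < J + 1 := by positivity
  rcases lt_or_ge x (knot J J) with h | h
  · refine ⟨⌊x * (J + 1)⌋₊, ?_, ?_⟩
    · rw [knot, lt_div_iff₀ hJ] at h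
      exact (Nat.floor_lt (by nlinarith [hx.1])).2 h |>.le
    · have h' := h
      rw [knot, lt_div_iff₀ hJ] at h'
      have h2 : ⌊x * (J + 1)⌋₊ < J := (Nat.floor_lt (by nlinarith [hx.1])).2 h'
      rw [knotInterval, if_pos h2, knot, knot, mem_Ico, div_le_iff₀ hJ, lt_div_iff₀ hJ]
      refine ⟨Nat.floor_le (by nlinarith [hx.1]), ?_⟩
      push_cast
      exact Nat.lt_floor_add_one _
  · exact ⟨J, le_rfl, by rw [knotInterval, if_neg (lt_irrefl J)]; exact ⟨h, hx.2⟩⟩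

theorem intervalIntegrable_comp_spline {p J : ℕ} {g : ℝ → ℝ} (hg : g ∈ splineSpace p J)
    {F : ℝ → ℝ} (hF : Continuous F) {l : ℕ} (hl : l ≤ J) :
    IntervalIntegrable (fun x => F (g x)) volume (knot J l) (knot J (l + 1)) := by
  obtain ⟨Q, -, h⟩ := hg.2 l hl
  refine ((hF.comp Q.continuous).intervalIntegrable _ _).congr_uIoo fun x hx => ?_
  rw [uIoo_of_le (knot_le_succ J l)] at hx
  simp only [Function.comp_apply]
  rw [h x (Ico_subset_knotInterval hl (Ioo_subset_Ico_self hx))]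

theorem intervalIntegrable_comp_spline_unit {p J : ℕ} {g : ℝ → ℝ} (hg : g ∈ splineSpace p J)
    {F : ℝ → ℝ} (hF : Continuous F) : IntervalIntegrable (fun x => F (g x)) volume 0 1 := by
  have := IntervalIntegrable.trans_iterate (a := knot J) (n := J + 1) fun k hk =>
    intervalIntegrable_comp_spline hg hF (Nat.lt_succ_iff.1 hk)
  rwa [knot_zero, knot_last] at this

/-- Lebesgue measure on `[0,1]`. -/
noncomputable abbrev volIcc : Measure ℝ := volume.restrict (Icc (0 : ℝ) 1)

theorem intervalIntegrable_iff_integrable_volIcc {f : ℝ → ℝ} :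
    IntervalIntegrable f volume 0 1 ↔ Integrable f volIcc :=
  intervalIntegrable_iff_integrableOn_Icc_of_le zero_le_one

theorem integral_volIcc (f : ℝ → ℝ) : ∫ x, f x ∂volIcc = ∫ x in (0 : ℝ)..1, f x := by
  rw [intervalIntegral.integral_of_le zero_le_one, integral_Icc_eq_integral_Ioc]

theorem memLp_of_mem_splineSpace {p J : ℕ} {g : ℝ → ℝ} (hg : g ∈ splineSpace p J) :
    MemLp g 2 volIcc := by
  rw [memLp_two_iff_integrable_sq]
  · exact intervalIntegrable_iff_integrable_volIcc.1
      (intervalIntegrable_comp_spline_unit hg (F := fun y => y ^ 2) (by fun_prop))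
  · exact (intervalIntegrable_iff_integrable_volIcc.1
      (intervalIntegrable_comp_spline_unit hg continuous_id)).aestronglyMeasurable

theorem norm_toLp_sq {f : ℝ → ℝ} (hf : MemLp f 2 volIcc) :
    ‖hf.toLp f‖ ^ 2 = ∫ x in (0 : ℝ)..1, f x ^ 2 := by
  rw [← real_inner_self_eq_norm_sq, L2.inner_def, ← integral_volIcc]
  refine integral_congr_ae ?_
  filter_upwards [hf.coeFn_toLp] with x hx
  simp [hx, sq]

/-- Rounding up to the grid of mesh `1 / N`. -/
noncomputable def gridRound (N : ℕ) (x : ℝ) : ℝ := (⌈(N : ℝ) * x⌉ : ℝ) / N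

theorem le_gridRound {N : ℕ} (hN : 0 < N) (x : ℝ) : x ≤ gridRound N x := by
  have : (0 : ℝ) < N := by exact_mod_cast hN
  rw [gridRound, le_div_iff₀ this, mul_comm]
  exact Int.le_ceil _

theorem gridRound_lt {N : ℕ} (hN : 0 < N) (x : ℝ) : gridRound N x < x + 1 / N := by
  have : (0 : ℝ) < N := by exact_mod_cast hN
  rw [gridRound, div_lt_iff₀ this, add_mul, one_div_mul_cancel this.ne', mul_comm x]
  exact Int.ceil_lt_add_one _

theorem gridRound_eq {N : ℕ} (hN : 0 < N) {j : ℕ} {x : ℝ}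
    (hx : x ∈ Ioc ((j : ℝ) / N) ((j + 1 : ℕ) / N)) : gridRound N x = gridPoint N j := by
  have h0 : (0 : ℝ) < N := by exact_mod_cast hN
  have : ⌈(N : ℝ) * x⌉ = (j : ℤ) + 1 := by
    rw [Int.ceil_eq_iff]
    have h1 := hx.1
    have h2 := hx.2
    rw [div_lt_iff₀ h0] at h1
    rw [le_div_iff₀ h0] at h2
    push_cast at h2 ⊢
    constructor <;> linarith
  rw [gridRound, gridPoint, this]
  push_cast
  ring

/-- Each design point is the right end of its cell (j/N, (j+1)/N], so rounding up turns a grid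
average into the integral of a step function exactly. The grid norm can then be compared with the L²
norm by integrals over knot intervals, even though the grid and the knots are not aligned. -/
theorem intervalIntegrable_comp_gridRound {N : ℕ} (hN : 0 < N) (F : ℝ → ℝ) :
    IntervalIntegrable (fun x => F (gridRound N x)) volume 0 1 ∧
      ∫ x in (0 : ℝ)..1, F (gridRound N x) = 1 / N * ∑ j ∈ Finset.range N, F (gridPoint N j) := by
  have h0 : (N : ℝ) ≠ 0 := by exact_mod_cast hN.ne'
  have hle : ∀ j : ℕ, (j : ℝ) / N ≤ ((j + 1 : ℕ) : ℝ) / N := fun j => by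
    gcongr; simp
  have hcell : ∀ j : ℕ, IntervalIntegrable (fun x => F (gridRound N x)) volume
      ((j : ℝ) / N) ((j + 1 : ℕ) / N) := fun j => by
    refine (intervalIntegrable_const (c := F (gridPoint N j))).congr fun x hx => ?_
    rw [uIoc_of_le (hle j)] at hx
    rw [gridRound_eq hN hx]
  have hint : ∀ j : ℕ, ∫ x in ((j : ℝ) / N)..((j + 1 : ℕ) / N), F (gridRound N x)
      = 1 / N * F (gridPoint N j) := fun j => by
    rw [intervalIntegral.integral_congr_Ioo_of_le (g := fun _ => F (gridPoint N j)) (hle j)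
      (fun x hx => by simp only [gridRound_eq hN (Ioo_subset_Ioc_self hx)]),
      intervalIntegral.integral_const, smul_eq_mul]
    push_cast
    ring
  constructor
  · have := IntervalIntegrable.trans_iterate (a := fun j : ℕ => (j : ℝ) / N) (n := N)
      fun k _ => hcell k
    simpa [h0] using this
  · have := intervalIntegral.sum_integral_adjacent_intervals (a := fun j : ℕ => (j : ℝ) / N) (n := N)
      fun k _ => hcell k
    simp only [hint, ← Finset.mul_sum] at this
    rw [this]
    simp [h0]

/-- On splines the `L²` norm is bounded by the norm over a fine grid. -/
theorem exists_integral_sq_spline_le (p : ℕ) :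
    ∃ M : ℝ, 1 ≤ M ∧ ∀ J N : ℕ, M * ((J : ℝ) + 1) ≤ N → ∀ g ∈ splineSpace p J,
      ∫ x in (0 : ℝ)..1, g x ^ 2 ≤ 2 * (1 / N * ∑ j ∈ Finset.range N, g (gridPoint N j) ^ 2) := by
  obtain ⟨C, hC, hpoly⟩ := exists_polynomial_sq_le_integral p
  -- The 4C bounds the relative error on each knot interval by 1/2, and the 1 ensures that a knot
  -- interval is at least 1/N long.
  refine ⟨4 * C + 1, by linarith, fun J N hJN g hg => ?_⟩
  have hJ : (0 : ℝ) < J + 1 := by positivity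
  have hN0 : (0 : ℝ) < N := by nlinarith
  have hN : 0 < N := by exact_mod_cast hN0
  obtain ⟨hri, hrint⟩ := intervalIntegrable_comp_gridRound hN (fun x => g x ^ 2)
  set H : ℝ := 1 / ((J : ℝ) + 1) with hH
  have hH0 : 0 < H := by positivity
  have hHN : 4 * C * (1 / N) ≤ H ∧ 1 / N ≤ H := by
    have h1 : (4 * C + 1) / N ≤ H := by
      rw [hH, div_le_div_iff₀ hN0 hJ]; linarith
    have h2 : (0 : ℝ) < 1 / N := by positivity
    have h3 : (4 * C + 1) / N = 4 * C * (1 / N) + 1 / N := by ring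
    have h4 : 0 ≤ 4 * C * (1 / (N : ℝ)) := by positivity
    constructor <;> linarith
  have hsub : ∀ l ≤ J, uIcc (knot J l) (knot J (l + 1)) ⊆ uIcc 0 1 := fun l hl => by
    rw [uIcc_of_le (knot_le_succ J l), uIcc_of_le zero_le_one]
    refine Icc_subset_Icc (by rw [knot]; positivity) ?_
    rw [knot, div_le_one hJ]
    exact_mod_cast Nat.succ_le_succ hl
  have hri' : ∀ l ≤ J, IntervalIntegrable (fun x => g (gridRound N x) ^ 2) volume
      (knot J l) (knot J (l + 1)) := fun l hl => hri.mono_set (hsub l hl)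
  have hgi : ∀ l ≤ J, IntervalIntegrable (fun x => g x ^ 2) volume (knot J l) (knot J (l + 1)) :=
    fun l hl => intervalIntegrable_comp_spline hg (F := fun y => y ^ 2) (by fun_prop) hl
  have key : ∀ l ≤ J, ∫ x in (knot J l)..(knot J (l + 1)), g x ^ 2 ≤
      (∫ x in (knot J l)..(knot J (l + 1)), g (gridRound N x) ^ 2)
        + 1 / 2 * ∫ x in (knot J l)..(knot J (l + 1)), g x ^ 2 := by
    intro l hl
    obtain ⟨Q, hQ, h⟩ := hg.2 l hl
    have hgi' := hgi l hl
    have hri'' := hri' l hl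
    have hle := knot_le_succ J l
    have hQg : ∀ x ∈ Ico (knot J l) (knot J (l + 1)), g x = Q.eval x := fun x hx =>
      h x (Ico_subset_knotInterval hl hx)
    have hintQ : ∫ x in (knot J l)..(knot J (l + 1)), g x ^ 2
        = ∫ x in (knot J l)..(knot J l + H), Q.eval x ^ 2 := by
      rw [← knot_succ]
      exact intervalIntegral.integral_congr_Ioo_of_le hle fun x hx => by
        simp only [hQg x (Ioo_subset_Ico_self hx)]
    set I := ∫ x in (knot J l)..(knot J (l + 1)), g x ^ 2 with hI
    have hI0 : 0 ≤ I := intervalIntegral.integral_nonneg hle fun x _ => sq_nonneg _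
    -- Left of b, rounding up stays in the same knot interval, so only one polynomial is involved
    -- and its Lipschitz bound applies. The remaining piece of length 1/N is controlled by the
    -- supremum bound alone.
    set b := knot J (l + 1) - 1 / N with hb
    have hab : knot J l ≤ b := by rw [hb, knot_succ]; linarith [hHN.2]
    have hbc : b ≤ knot J (l + 1) := by
      rw [hb]; have : (0 : ℝ) < 1 / N := by positivity
      linarith
    have hbmem : b ∈ uIcc (knot J l) (knot J (l + 1)) := by
      rw [uIcc_of_le hle]; exact ⟨hab, hbc⟩
    have hg1 := hgi'.mono_set (uIcc_subset_uIcc_left hbmem)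
    have hg2 := hgi'.mono_set (uIcc_subset_uIcc_right hbmem)
    have hr1 := hri''.mono_set (uIcc_subset_uIcc_left hbmem)
    have hr2 := hri''.mono_set (uIcc_subset_uIcc_right hbmem)
    have e1 : ∫ x in (knot J l)..b, g x ^ 2 ≤ (∫ x in (knot J l)..b, g (gridRound N x) ^ 2)
        + H * (C / H * (1 / N / H) * I) := by
      have : ∫ x in (knot J l)..b, g x ^ 2 ≤ ∫ x in (knot J l)..b,
          (g (gridRound N x) ^ 2 + C / H * (1 / N / H) * I) := by
        refine intervalIntegral.integral_mono_on_of_le_Ioo hab hg1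
          (hr1.add intervalIntegrable_const) fun x hx => ?_
        have hx1 : x ∈ Ico (knot J l) (knot J (l + 1)) := ⟨hx.1.le, hx.2.trans_le hbc⟩
        have h1 := le_gridRound hN x
        have h2 := gridRound_lt hN x
        have hx2 : gridRound N x ∈ Ico (knot J l) (knot J (l + 1)) :=
          ⟨hx.1.le.trans h1, by rw [hb] at hx; linarith [hx.2]⟩
        have h3 := (hpoly Q hQ (knot J l) H hH0 x
          (by rw [← knot_succ]; exact Ico_subset_Icc_self hx1)).2 _
          (by rw [← knot_succ]; exact Ico_subset_Icc_self hx2)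
        rw [← hintQ, ← hQg x hx1, ← hQg _ hx2] at h3
        have h4 : |x - gridRound N x| ≤ 1 / N := by
          rw [abs_le]; constructor <;> linarith
        have h5 : C / H * (|x - gridRound N x| / H) * I ≤ C / H * (1 / N / H) * I := by gcongr
        linarith [le_abs_self (g x ^ 2 - g (gridRound N x) ^ 2)]
      rw [intervalIntegral.integral_add hr1 intervalIntegrable_const,
        intervalIntegral.integral_const, smul_eq_mul] at this
      refine this.trans ?_
      gcongr
      rw [hb, knot_succ]
      have : (0 : ℝ) < 1 / N := by positivity
      linarith
    have e2 : ∫ x in b..(knot J (l + 1)), g x ^ 2 ≤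
        (∫ x in b..(knot J (l + 1)), g (gridRound N x) ^ 2) + 1 / N * (C / H * I) := by
      have h1 : ∫ x in b..(knot J (l + 1)), g x ^ 2 ≤ ∫ x in b..(knot J (l + 1)), C / H * I := by
        refine intervalIntegral.integral_mono_on_of_le_Ioo hbc hg2
          intervalIntegrable_const fun x hx => ?_
        have hx1 : x ∈ Ico (knot J l) (knot J (l + 1)) := ⟨hab.trans hx.1.le, hx.2⟩
        have h3 := (hpoly Q hQ (knot J l) H hH0 x
          (by rw [← knot_succ]; exact Ico_subset_Icc_self hx1)).1
        rwa [← hintQ, ← hQg x hx1] at h3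
      rw [intervalIntegral.integral_const, smul_eq_mul] at h1
      have h2 : 0 ≤ ∫ x in b..(knot J (l + 1)), g (gridRound N x) ^ 2 :=
        intervalIntegral.integral_nonneg hbc fun x _ => sq_nonneg _
      have h3 : knot J (l + 1) - b = 1 / N := by rw [hb]; ring
      rw [h3] at h1
      linarith
    have e3 := intervalIntegral.integral_add_adjacent_intervals hg1 hg2
    have e4 := intervalIntegral.integral_add_adjacent_intervals hr1 hr2
    -- Both errors equal C I / (N H); together they are at most I/2, which is absorbed into the left
    -- side and produces the factor 2 of the conclusion.
    have e5 : H * (C / H * (1 / N / H) * I) + 1 / N * (C / H * I) ≤ 1 / 2 * I := by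
      have h1 : H * (C / H * (1 / N / H) * I) + 1 / N * (C / H * I)
          = (4 * C * (1 / N)) / H * I / 2 := by
        field_simp
        ring
      rw [h1]
      have h2 : (4 * C * (1 / N)) / H ≤ 1 := (div_le_one hH0).2 hHN.1
      nlinarith
    rw [← hI] at e3
    linarith
  have hs1 := intervalIntegral.sum_integral_adjacent_intervals (a := knot J) (n := J + 1)
    fun k hk => hgi k (Nat.lt_succ_iff.1 hk)
  have hs2 := intervalIntegral.sum_integral_adjacent_intervals (a := knot J) (n := J + 1)
    fun k hk => hri' k (Nat.lt_succ_iff.1 hk)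
  rw [knot_zero, knot_last] at hs1 hs2
  have hs3 := Finset.sum_le_sum fun l hl => key l (Nat.lt_succ_iff.1 (Finset.mem_range.1 hl))
  rw [Finset.sum_add_distrib, ← Finset.mul_sum, hs1, hs2, hrint] at hs3
  linarith

/-! ### Least squares as an orthogonal projection. -/

/-- The vector of values of a spline at the design points. -/
noncomputable def splineValues (p J N : ℕ) : splineSubmodule p J →ₗ[ℝ] EuclideanSpace ℝ (Fin N) where
  toFun g := WithLp.toLp 2 fun j => (g : ℝ → ℝ) (gridPoint N j)
  map_add' _ _ := rfl
  map_smul' _ _ := rfl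

theorem splineValues_apply {p J N : ℕ} (g : splineSubmodule p J) (j : Fin N) :
    splineValues p J N g j = (g : ℝ → ℝ) (gridPoint N j) := rfl

theorem splineValues_eq {p J N : ℕ} (g : splineSubmodule p J) :
    splineValues p J N g = WithLp.toLp 2 fun j : Fin N => (g : ℝ → ℝ) (gridPoint N j) := rfl

/-- A spline as an element of `L²[0,1]`. -/
noncomputable def splineToLp (p J : ℕ) : splineSubmodule p J →ₗ[ℝ] Lp ℝ 2 volIcc where
  toFun g := (memLp_of_mem_splineSpace g.2).toLp g
  map_add' _ _ := rfl
  map_smul' _ _ := rfl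

theorem splineToLp_eq {p J : ℕ} (g : splineSubmodule p J) :
    splineToLp p J g = (memLp_of_mem_splineSpace g.2).toLp g := rfl

theorem norm_sq_eq_sum_range {N : ℕ} (f : ℕ → ℝ) :
    ‖(WithLp.toLp 2 fun j : Fin N => f j : EuclideanSpace ℝ (Fin N))‖ ^ 2
      = ∑ j ∈ Finset.range N, f j ^ 2 := by
  rw [EuclideanSpace.norm_sq_eq, Finset.sum_range]
  simp

theorem gridPoint_mem {N j : ℕ} (hj : j < N) : gridPoint N j ∈ Icc (0 : ℝ) 1 := by
  have : (0 : ℝ) < N := by exact_mod_cast (Nat.zero_le j).trans_lt hj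
  rw [gridPoint]
  refine ⟨by positivity, ?_⟩
  rw [div_le_one this]
  exact_mod_cast hj

/-- The grid values depend linearly on the p coefficients of each of the J + 1 polynomial pieces.
Smoothness at the knots only shrinks the range, so it can be ignored for an upper bound. -/
theorem finrank_range_splineValues_le (p J N : ℕ) :
    Module.finrank ℝ (LinearMap.range (splineValues p J N)) ≤ (J + 1) * p := by
  choose! l hl hx using fun (x : ℝ) (hx : x ∈ Icc (0 : ℝ) 1) => exists_mem_knotInterval J hx
  let Φ : (Fin (J + 1) × Fin p → ℝ) →ₗ[ℝ] EuclideanSpace ℝ (Fin N) :=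
    { toFun := fun c => WithLp.toLp 2 fun j =>
        -- The remainder only makes the index typecheck; at design points the index is already at
        -- most J.
        ∑ i : Fin p, c (⟨l (gridPoint N j) % (J + 1), Nat.mod_lt _ J.succ_pos⟩, i) * gridPoint N j ^ (i : ℕ)
      map_add' := fun c c' => by
        ext j
        simp [add_mul, Finset.sum_add_distrib]
      map_smul' := fun c c' => by
        ext j
        simp [mul_assoc, Finset.mul_sum] }
  have hle : LinearMap.range (splineValues p J N) ≤ LinearMap.range Φ := by
    rintro _ ⟨⟨g, hg⟩, rfl⟩
    have hg' : ∀ k : Fin (J + 1), ∃ c : Fin p → ℝ, ∀ x ∈ knotInterval J k,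
        g x = ∑ i, c i * x ^ (i : ℕ) := fun k => by
      obtain ⟨Q, hQ, h⟩ := hg.2 k (Nat.lt_succ_iff.1 k.2)
      exact ⟨Polynomial.degreeLTEquiv ℝ p ⟨Q, Polynomial.mem_degreeLT.2 hQ⟩, fun x hx => by
        rw [h x hx]
        exact Polynomial.eval_eq_sum_degreeLTEquiv (Polynomial.mem_degreeLT.2 hQ) x⟩
    choose c hc using hg'
    refine ⟨fun k => c k.1 k.2, ?_⟩
    ext j
    have hj := gridPoint_mem j.2
    refine (hc _ _ ?_).symm
    have := hx _ hj
    change _ ∈ knotInterval J (l (gridPoint N j) % (J + 1))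
    rwa [Nat.mod_eq_of_lt (Nat.lt_succ_iff.2 (hl _ hj))]
  calc Module.finrank ℝ (LinearMap.range (splineValues p J N))
      ≤ Module.finrank ℝ (LinearMap.range Φ) := Submodule.finrank_mono hle
    _ ≤ Module.finrank ℝ (Fin (J + 1) × Fin p → ℝ) := LinearMap.finrank_range_le _
    _ = (J + 1) * p := by simp

/-- First-order condition: the splines form a subspace, so the residual cannot be shortened along
any spline direction and is orthogonal to all grid vectors of splines. -/
theorem IsLeastSquaresSpline.starProjection_eq {p J N : ℕ} {y : ℕ → ℝ} {g : ℝ → ℝ}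
    (h : IsLeastSquaresSpline p J N y g) :
    (LinearMap.range (splineValues p J N)).starProjection (WithLp.toLp 2 fun j : Fin N => y j)
      = splineValues p J N ⟨g, h.1⟩ := by
  refine Submodule.eq_starProjection_of_mem_of_inner_eq_zero ⟨_, rfl⟩ ?_
  rintro _ ⟨f, rfl⟩
  obtain ⟨u, hu⟩ : ∃ u, u = (WithLp.toLp 2 fun j : Fin N => y j) -
    splineValues p J N ⟨g, h.1⟩ := ⟨_, rfl⟩
  obtain ⟨v, hv⟩ : ∃ v, v = splineValues p J N f := ⟨_, rfl⟩
  rw [← hu, ← hv]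
  have hmin : ∀ t : ℝ, ‖u‖ ^ 2 ≤ ‖u - t • v‖ ^ 2 := fun t => by
    have h1 := h.2 (g + t • (f : ℝ → ℝ)) ((splineSubmodule p J).add_mem h.1
      ((splineSubmodule p J).smul_mem t f.2))
    rw [residualSS, residualSS, ← norm_sq_eq_sum_range, ← norm_sq_eq_sum_range] at h1
    have e1 : u = WithLp.toLp 2 fun j : Fin N => y j - g (gridPoint N j) := by
      rw [hu]; rfl
    have e2 : u - t • v = WithLp.toLp 2 fun j : Fin N =>
        y j - (g + t • (f : ℝ → ℝ)) (gridPoint N j) := by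
      ext j
      rw [PiLp.sub_apply, PiLp.smul_apply, e1, hv, splineValues_apply]
      simp only [Pi.add_apply, Pi.smul_apply, smul_eq_mul]
      ring
    rwa [e2, e1]
  have hexp : ∀ t : ℝ, 0 ≤ t ^ 2 * ‖v‖ ^ 2 - 2 * t * inner ℝ u v := fun t => by
    have := hmin t
    rw [norm_sub_sq_real, norm_smul, inner_smul_right, mul_pow, Real.norm_eq_abs, sq_abs] at this
    linarith
  by_contra hne
  have hv : 0 < ‖v‖ ^ 2 := by
    have : v ≠ 0 := by
      intro h0; rw [h0, inner_zero_right] at hne; exact hne rfl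
    positivity
  -- The minimizer of the quadratic in t, where its value is negative unless the inner product
  -- vanishes.
  have h2 := hexp (inner ℝ u v / ‖v‖ ^ 2)
  have h3 : (inner ℝ u v / ‖v‖ ^ 2) ^ 2 * ‖v‖ ^ 2 - 2 * (inner ℝ u v / ‖v‖ ^ 2) * inner ℝ u v
      = -(inner ℝ u v ^ 2 / ‖v‖ ^ 2) := by
    field_simp
    ring
  have h4 : 0 < inner ℝ u v ^ 2 / ‖v‖ ^ 2 := by positivity
  linarith

/-- Least squares spline smoothing as a linear operator from the data to `L²[0,1]`: it is controlled
by the projection of the data onto a subspace `V` of small dimension, and reproduces splines. -/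
theorem exists_linear_fit (p : ℕ) :
    ∃ M : ℝ, 1 ≤ M ∧ ∀ J N : ℕ, M * ((J : ℝ) + 1) ≤ N →
      ∃ (V : Submodule ℝ (EuclideanSpace ℝ (Fin N)))
        (fit : EuclideanSpace ℝ (Fin N) →ₗ[ℝ] Lp ℝ 2 volIcc),
        Module.finrank ℝ V ≤ (J + 1) * p ∧
        (∀ y, ‖fit y‖ ^ 2 ≤ 2 / N * ‖V.starProjection y‖ ^ 2) ∧
        (∀ (g : ℝ → ℝ) (hg : g ∈ splineSpace p J),
          fit (WithLp.toLp 2 fun j : Fin N => g (gridPoint N j))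
            = (memLp_of_mem_splineSpace hg).toLp g) ∧
        ∀ (y : ℕ → ℝ) (g : ℝ → ℝ) (hg : IsLeastSquaresSpline p J N y g),
          fit (WithLp.toLp 2 fun j : Fin N => y j) = (memLp_of_mem_splineSpace hg.1).toLp g := by
  obtain ⟨M, hM, hcomp⟩ := exists_integral_sq_spline_le p
  refine ⟨M, hM, fun J N hJN => ?_⟩
  have hnorm : ∀ g : splineSubmodule p J,
      ‖splineToLp p J g‖ ^ 2 ≤ 2 / N * ‖splineValues p J N g‖ ^ 2 := fun g => by
    have h1 := hcomp J N hJN g g.2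
    have h2 := norm_toLp_sq (memLp_of_mem_splineSpace g.2)
    have h3 : ‖splineValues p J N g‖ ^ 2 = ∑ j ∈ Finset.range N, (g : ℝ → ℝ) (gridPoint N j) ^ 2 :=
      norm_sq_eq_sum_range fun j => (g : ℝ → ℝ) (gridPoint N j)
    rw [splineToLp_eq, h2, h3]
    refine h1.trans (le_of_eq ?_)
    ring
  -- The norm comparison shows that grid values determine a spline in L². Every least squares
  -- minimizer therefore gives the same element of L², and the choice of preimages below is
  -- immaterial.
  have hker : ∀ g g' : splineSubmodule p J, splineValues p J N g = splineValues p J N g' →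
      splineToLp p J g = splineToLp p J g' := fun g g' h => by
    rw [← sub_eq_zero, ← map_sub]
    have := hnorm (g - g')
    rw [map_sub (splineValues p J N), h, sub_self, norm_zero] at this
    rw [← norm_eq_zero, ← sq_eq_zero_iff]
    exact le_antisymm (by simpa using this) (sq_nonneg _)
  obtain ⟨s, hs⟩ := LinearMap.exists_rightInverse_of_surjective (splineValues p J N).rangeRestrict
    (LinearMap.range_rangeRestrict _)
  have hs' : ∀ v : LinearMap.range (splineValues p J N), splineValues p J N (s v) = v := fun v =>
    congrArg Subtype.val (LinearMap.congr_fun hs v)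
  set P := (LinearMap.range (splineValues p J N)).orthogonalProjectionOnto
  have hP : ∀ y, (P y : EuclideanSpace ℝ (Fin N))
      = (LinearMap.range (splineValues p J N)).starProjection y := fun y => rfl
  obtain ⟨fit, hfit⟩ : ∃ fit : EuclideanSpace ℝ (Fin N) →ₗ[ℝ] Lp ℝ 2 volIcc,
      ∀ y, fit y = splineToLp p J (s (P y)) :=
    ⟨(splineToLp p J).comp (s.comp P.toLinearMap), fun y => by
      simp only [LinearMap.comp_apply, ContinuousLinearMap.coe_coe]⟩
  refine ⟨LinearMap.range (splineValues p J N), fit,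
    finrank_range_splineValues_le p J N, fun y => ?_, fun g hg => ?_, fun y g hg => ?_⟩
  · rw [hfit, ← hP, ← hs' (P y)]
    exact hnorm (s (P y))
  · rw [hfit]
    refine (hker (s (P _)) ⟨g, hg⟩ ?_).trans (splineToLp_eq ⟨g, hg⟩)
    rw [hs', hP, ← splineValues_eq ⟨g, hg⟩]
    exact Submodule.starProjection_eq_self_iff.2 ⟨_, rfl⟩
  · rw [hfit]
    refine (hker (s (P _)) ⟨g, hg.1⟩ ?_).trans (splineToLp_eq ⟨g, hg.1⟩)
    rw [hs', hP, hg.starProjection_eq]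

/-! ### Deterministic comparison of empirical second moments. -/

theorem norm_sum_sq_le {E : Type*} [NormedAddCommGroup E] (n : ℕ) (v : ℕ → E) :
    ‖∑ i ∈ Finset.range n, v i‖ ^ 2 ≤ n * ∑ i ∈ Finset.range n, ‖v i‖ ^ 2 := by
  calc ‖∑ i ∈ Finset.range n, v i‖ ^ 2 ≤ (∑ i ∈ Finset.range n, ‖v i‖) ^ 2 := by
        gcongr; exact norm_sum_le _ _
    _ ≤ _ := by simpa using sq_sum_le_card_mul_sum_sq (s := Finset.range n) (f := fun i => ‖v i‖)

/-- Cauchy-Schwarz with weights a k. If the weights have bounded sum and the x k have bounded second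
moments, the mean of the right side is bounded independently of K. -/
theorem sum_mul_sq_le_weighted (K : ℕ) (a x : ℕ → ℝ) (ha : ∀ k, 0 ≤ a k) :
    (∑ k ∈ Finset.range K, a k * |x k|) ^ 2
      ≤ (∑ k ∈ Finset.range K, a k) * ∑ k ∈ Finset.range K, a k * x k ^ 2 := by
  refine Finset.sum_sq_le_sum_mul_sum_of_sq_le_mul _ (fun k _ => ha k)
    (fun k _ => mul_nonneg (ha k) (sq_nonneg _)) fun k _ => ?_
  rw [mul_pow, sq_abs]; exact le_of_eq (by ring)

theorem norm_sum_smul_sq_le {E : Type*} [NormedAddCommGroup E] [NormedSpace ℝ E] (K : ℕ)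
    (x : ℕ → ℝ) (s : ℕ → E) :
    ‖∑ k ∈ Finset.range K, x k • s k‖ ^ 2
      ≤ (∑ k ∈ Finset.range K, ‖s k‖) * ∑ k ∈ Finset.range K, ‖s k‖ * x k ^ 2 := by
  refine le_trans ?_ (sum_mul_sq_le_weighted K (fun k => ‖s k‖) x fun _ => norm_nonneg _)
  gcongr
  refine (norm_sum_le _ _).trans (Finset.sum_le_sum fun k _ => ?_)
  rw [norm_smul, Real.norm_eq_abs, mul_comm]

section Bilinear

variable {E : Type*} [NormedAddCommGroup E] [NormedSpace ℝ E] (B : E →ₗ[ℝ] E →ₗ[ℝ] ℝ)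

/-- The variance identity: centering subtracts a single term in the total, and removes any vector
common to all the a i. -/
theorem sum_centered_bilin (n : ℕ) (hn : 0 < n) (a : ℕ → E) :
    ∑ i ∈ Finset.range n, B (a i - (1 / n : ℝ) • ∑ j ∈ Finset.range n, a j)
        (a i - (1 / n : ℝ) • ∑ j ∈ Finset.range n, a j)
      = (∑ i ∈ Finset.range n, B (a i) (a i))
        - 1 / n * B (∑ j ∈ Finset.range n, a j) (∑ j ∈ Finset.range n, a j) := by
  have hn' : (n : ℝ) ≠ 0 := by exact_mod_cast hn.ne'
  set A := ∑ j ∈ Finset.range n, a j with hA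
  simp only [map_sub, LinearMap.sub_apply, Finset.sum_sub_distrib, map_smul, LinearMap.smul_apply,
    smul_eq_mul, ← Finset.mul_sum, Finset.sum_const, Finset.card_range, nsmul_eq_mul]
  have h1 : ∀ u, ∑ i ∈ Finset.range n, B (a i) u = B A u := fun u => by
    rw [hA, map_sum, LinearMap.sum_apply]
  have h2 : ∀ u, ∑ i ∈ Finset.range n, B u (a i) = B u A := fun u => (map_sum _ _ _).symm
  rw [h1, h2]
  field_simp
  ring

variable {B}

/-- Comparison of the empirical second moments of `T i + r i + e i` (centered) and of `T i + ρ i`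
under a bounded bilinear form, where `T i = ∑ k, x i k • s k`. -/
theorem abs_centered_sub_le (hB : ∀ u v, |B u v| ≤ ‖u‖ * ‖v‖) {n : ℕ} (hn : 0 < n) (K : ℕ)
    (x : ℕ → ℕ → ℝ) (s : ℕ → E) (T r e ρ a z : ℕ → E)
    (hT : ∀ i, T i = ∑ k ∈ Finset.range K, x i k • s k) (ha : ∀ i, a i = T i + r i + e i)
    (hz : ∀ i, z i = T i + ρ i) {κ₁ κ₂ : ℝ} (hκ₁ : 0 < κ₁) (hκ₂ : 0 < κ₂) :
    |(∑ i ∈ Finset.range n, B (a i - (1 / n : ℝ) • ∑ j ∈ Finset.range n, a j)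
        (a i - (1 / n : ℝ) • ∑ j ∈ Finset.range n, a j)) - ∑ i ∈ Finset.range n, B (z i) (z i)|
      ≤ (∑ k ∈ Finset.range K,
          ‖s k‖ * (κ₂ + ‖∑ i ∈ Finset.range n, x i k • e i‖ ^ 2 / κ₂))
        + (∑ i ∈ Finset.range n, (2 * κ₁ * ‖T i‖ ^ 2 + (‖r i‖ ^ 2 + ‖ρ i‖ ^ 2) / κ₁
            + 5 * ‖r i‖ ^ 2 + 5 * ‖e i‖ ^ 2 + ‖ρ i‖ ^ 2))
        + 3 / n * ‖∑ i ∈ Finset.range n, T i‖ ^ 2 := by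
  have hn' : (0 : ℝ) < n := by exact_mod_cast hn
  -- The sum over i is taken inside the form before the norm bound, so the cancellation in ∑_i x_ik
  -- e_i is kept. The inequality 2w ≤ κ₂ + w²/κ₂ then replaces the norm by its square, whose mean is
  -- computable.
  have hcross : |(∑ i ∈ Finset.range n, B (T i) (e i)) + ∑ i ∈ Finset.range n, B (e i) (T i)|
      ≤ ∑ k ∈ Finset.range K, ‖s k‖ * (κ₂ + ‖∑ i ∈ Finset.range n, x i k • e i‖ ^ 2 / κ₂) := by
    have h1 : ∑ i ∈ Finset.range n, B (T i) (e i)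
        = ∑ k ∈ Finset.range K, B (s k) (∑ i ∈ Finset.range n, x i k • e i) := by
      simp only [hT, map_sum, LinearMap.sum_apply, map_smul, LinearMap.smul_apply]
      rw [Finset.sum_comm]
    have h2 : ∑ i ∈ Finset.range n, B (e i) (T i)
        = ∑ k ∈ Finset.range K, B (∑ i ∈ Finset.range n, x i k • e i) (s k) := by
      simp only [hT, map_sum, LinearMap.sum_apply, map_smul, LinearMap.smul_apply]
      rw [Finset.sum_comm]
    rw [h1, h2, ← Finset.sum_add_distrib]
    refine (Finset.abs_sum_le_sum_abs _ _).trans (Finset.sum_le_sum fun k _ => ?_)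
    set w := ∑ i ∈ Finset.range n, x i k • e i
    have h3 : 2 * ‖w‖ ≤ κ₂ + ‖w‖ ^ 2 / κ₂ := by
      rw [← sub_nonneg]
      have : κ₂ + ‖w‖ ^ 2 / κ₂ - 2 * ‖w‖ = (κ₂ - ‖w‖) ^ 2 / κ₂ := by field_simp; ring
      rw [this]; positivity
    refine (abs_add_le _ _).trans ?_
    have h4 := hB (s k) w
    have h5 := hB w (s k)
    nlinarith [norm_nonneg (s k)]
  -- The pairings with r and ρ are small enough to be bounded separately for each i. The parameter
  -- κ₁ balances the bounded ‖T i‖² against the small ‖r i‖² and ‖ρ i‖².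
  have hterm : ∀ i, |B (T i) (r i) + B (r i) (T i) + B (r i + e i) (r i + e i)
      - (B (T i) (ρ i) + B (ρ i) (T i) + B (ρ i) (ρ i))|
      ≤ 2 * κ₁ * ‖T i‖ ^ 2 + (‖r i‖ ^ 2 + ‖ρ i‖ ^ 2) / κ₁ + 2 * ‖r i‖ ^ 2 + 2 * ‖e i‖ ^ 2
        + ‖ρ i‖ ^ 2 := fun i => by
    have am : ∀ u : ℝ, 2 * (‖T i‖ * u) ≤ κ₁ * ‖T i‖ ^ 2 + u ^ 2 / κ₁ := fun u => by
      rw [← sub_nonneg]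
      have : κ₁ * ‖T i‖ ^ 2 + u ^ 2 / κ₁ - 2 * (‖T i‖ * u) = (κ₁ * ‖T i‖ - u) ^ 2 / κ₁ := by
        field_simp; ring
      rw [this]; positivity
    have h1 := hB (T i) (r i)
    have h2 := hB (r i) (T i)
    have h3 := hB (r i + e i) (r i + e i)
    have h4 := hB (T i) (ρ i)
    have h5 := hB (ρ i) (T i)
    have h6 := hB (ρ i) (ρ i)
    have h7 : ‖r i + e i‖ * ‖r i + e i‖ ≤ 2 * ‖r i‖ ^ 2 + 2 * ‖e i‖ ^ 2 := by
      have := norm_add_le (r i) (e i)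
      nlinarith [norm_nonneg (r i + e i), sq_nonneg (‖r i‖ - ‖e i‖), norm_nonneg (r i),
        norm_nonneg (e i)]
    have h8 := am ‖r i‖
    have h9 := am ‖ρ i‖
    have h10 : (‖r i‖ ^ 2 + ‖ρ i‖ ^ 2) / κ₁ = ‖r i‖ ^ 2 / κ₁ + ‖ρ i‖ ^ 2 / κ₁ := add_div _ _ _
    rw [h10]
    rw [abs_le] at *
    constructor <;> nlinarith
  have hmean : |1 / n * B (∑ j ∈ Finset.range n, a j) (∑ j ∈ Finset.range n, a j)|
      ≤ 3 / n * ‖∑ i ∈ Finset.range n, T i‖ ^ 2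
        + ∑ i ∈ Finset.range n, (3 * ‖r i‖ ^ 2 + 3 * ‖e i‖ ^ 2) := by
    rw [abs_mul, abs_of_pos (by positivity : (0 : ℝ) < 1 / n)]
    have h1 : ∑ j ∈ Finset.range n, a j = (∑ j ∈ Finset.range n, T j)
        + (∑ j ∈ Finset.range n, r j) + ∑ j ∈ Finset.range n, e j := by
      simp only [ha, Finset.sum_add_distrib]
    rw [h1]
    set t' := ∑ j ∈ Finset.range n, T j
    have hr := norm_sum_sq_le n r
    have he := norm_sum_sq_le n e
    set r' := ∑ j ∈ Finset.range n, r j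
    set e' := ∑ j ∈ Finset.range n, e j
    have h2 : |B (t' + r' + e') (t' + r' + e')| ≤ 3 * ‖t'‖ ^ 2 + 3 * ‖r'‖ ^ 2 + 3 * ‖e'‖ ^ 2 := by
      refine (hB _ _).trans ?_
      have h3 : ‖t' + r' + e'‖ ≤ ‖t'‖ + ‖r'‖ + ‖e'‖ := norm_add₃_le
      calc ‖t' + r' + e'‖ * ‖t' + r' + e'‖
          ≤ (‖t'‖ + ‖r'‖ + ‖e'‖) * (‖t'‖ + ‖r'‖ + ‖e'‖) := by gcongr
        _ ≤ _ := by
          nlinarith [sq_nonneg (‖t'‖ - ‖r'‖), sq_nonneg (‖t'‖ - ‖e'‖), sq_nonneg (‖r'‖ - ‖e'‖)]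
    rw [Finset.sum_add_distrib, ← Finset.mul_sum, ← Finset.mul_sum]
    calc 1 / n * |B (t' + r' + e') (t' + r' + e')|
        ≤ 1 / n * (3 * ‖t'‖ ^ 2 + 3 * (n * ∑ i ∈ Finset.range n, ‖r i‖ ^ 2)
          + 3 * (n * ∑ i ∈ Finset.range n, ‖e i‖ ^ 2)) := by
          gcongr
          linarith
      _ = _ := by field_simp; ring
  rw [sum_centered_bilin B n hn a]
  have hsplit : (∑ i ∈ Finset.range n, B (a i) (a i)) - ∑ i ∈ Finset.range n, B (z i) (z i)
      = ((∑ i ∈ Finset.range n, B (T i) (e i)) + ∑ i ∈ Finset.range n, B (e i) (T i))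
        + ∑ i ∈ Finset.range n, (B (T i) (r i) + B (r i) (T i) + B (r i + e i) (r i + e i)
          - (B (T i) (ρ i) + B (ρ i) (T i) + B (ρ i) (ρ i))) := by
    rw [← Finset.sum_sub_distrib, ← Finset.sum_add_distrib, ← Finset.sum_add_distrib]
    refine Finset.sum_congr rfl fun i _ => ?_
    rw [ha, hz]
    simp only [map_add, LinearMap.add_apply]
    ring
  have hsum : |∑ i ∈ Finset.range n, (B (T i) (r i) + B (r i) (T i) + B (r i + e i) (r i + e i)
          - (B (T i) (ρ i) + B (ρ i) (T i) + B (ρ i) (ρ i)))|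
      ≤ ∑ i ∈ Finset.range n, (2 * κ₁ * ‖T i‖ ^ 2 + (‖r i‖ ^ 2 + ‖ρ i‖ ^ 2) / κ₁
        + 2 * ‖r i‖ ^ 2 + 2 * ‖e i‖ ^ 2 + ‖ρ i‖ ^ 2) :=
    (Finset.abs_sum_le_sum_abs _ _).trans (Finset.sum_le_sum fun i _ => hterm i)
  -- The coefficients 5 split as 2 from the square of r + e and 3 from the centering term.
  have hfin : ∑ i ∈ Finset.range n, (2 * κ₁ * ‖T i‖ ^ 2 + (‖r i‖ ^ 2 + ‖ρ i‖ ^ 2) / κ₁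
            + 5 * ‖r i‖ ^ 2 + 5 * ‖e i‖ ^ 2 + ‖ρ i‖ ^ 2)
      = (∑ i ∈ Finset.range n, (2 * κ₁ * ‖T i‖ ^ 2 + (‖r i‖ ^ 2 + ‖ρ i‖ ^ 2) / κ₁
        + 2 * ‖r i‖ ^ 2 + 2 * ‖e i‖ ^ 2 + ‖ρ i‖ ^ 2))
        + ∑ i ∈ Finset.range n, (3 * ‖r i‖ ^ 2 + 3 * ‖e i‖ ^ 2) := by
    rw [← Finset.sum_add_distrib]
    exact Finset.sum_congr rfl fun i _ => by ring
  rw [sub_right_comm, hsplit, hfin]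
  refine (abs_sub _ _).trans ((add_le_add_left (abs_add_le _ _) _).trans ?_)
  linarith

end Bilinear

/-! ### The lagged product form on `L²[0,1]` -/

theorem restrict_Ioc_le_volIcc {a b : ℝ} (ha : 0 ≤ a) (hb : b ≤ 1) :
    volume.restrict (Ioc a b) ≤ volIcc :=
  Measure.restrict_mono (Ioc_subset_Icc_self.trans (Icc_subset_Icc ha hb)) le_rfl

theorem measurePreserving_add_lag (h : ℝ) :
    MeasurePreserving (fun x : ℝ => x + h) (volume.restrict (Ioc 0 (1 - h)))
      (volume.restrict (Ioc h 1)) := by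
  have := (measurePreserving_add_right (volume : Measure ℝ) h).restrict_preimage
    (s := Ioc h 1) measurableSet_Ioc
  simpa using this

section Lag

variable {h : ℝ} {f g f' g' : ℝ → ℝ}

theorem MemLp.restrict_lag_left (hh : h ∈ Icc (0 : ℝ) 1) (hf : MemLp f 2 volIcc) :
    MemLp f 2 (volume.restrict (Ioc 0 (1 - h))) :=
  hf.mono_measure (restrict_Ioc_le_volIcc le_rfl (by linarith [hh.1]))

theorem MemLp.restrict_lag_right (hh : h ∈ Icc (0 : ℝ) 1) (hg : MemLp g 2 volIcc) :
    MemLp (fun x => g (x + h)) 2 (volume.restrict (Ioc 0 (1 - h))) :=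
  (hg.mono_measure (restrict_Ioc_le_volIcc hh.1 le_rfl)).comp_measurePreserving
    (measurePreserving_add_lag h)

theorem integrable_lag (hh : h ∈ Icc (0 : ℝ) 1) (hf : MemLp f 2 volIcc) (hg : MemLp g 2 volIcc) :
    Integrable (fun x => f x * g (x + h)) (volume.restrict (Ioc 0 (1 - h))) :=
  (MemLp.restrict_lag_left hh hf).integrable_mul (MemLp.restrict_lag_right hh hg)

theorem ae_eq_lag (hh : h ∈ Icc (0 : ℝ) 1) (hf : f =ᵐ[volIcc] f') (hg : g =ᵐ[volIcc] g') :
    (fun x => f x * g (x + h)) =ᵐ[volume.restrict (Ioc 0 (1 - h))]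
      fun x => f' x * g' (x + h) := by
  have h1 := ae_mono (restrict_Ioc_le_volIcc le_rfl (by linarith [hh.1] : 1 - h ≤ 1)) hf
  have h2 := (measurePreserving_add_lag h).quasiMeasurePreserving.ae
    (ae_mono (restrict_Ioc_le_volIcc hh.1 le_rfl) hg)
  filter_upwards [h1, h2] with x hx hx'
  rw [hx, hx']

/-- Cauchy-Schwarz on [0, 1 - h], followed by translation invariance to move the shifted factor back
into [0,1]. The absence of h on the right is the source of the uniformity in the lag. -/
theorem abs_integral_lag_le (hh : h ∈ Icc (0 : ℝ) 1) (hf : MemLp f 2 volIcc) (hg : MemLp g 2 volIcc) :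
    |∫ x in Ioc 0 (1 - h), f x * g (x + h)| ≤ ‖hf.toLp f‖ * ‖hg.toLp g‖ := by
  have hf' := MemLp.restrict_lag_left hh hf
  have hg' := MemLp.restrict_lag_right hh hg
  have h1 : ∫ x in Ioc 0 (1 - h), f x * g (x + h) = inner ℝ (hg'.toLp _) (hf'.toLp f) := by
    rw [L2.inner_def]
    refine integral_congr_ae ?_
    filter_upwards [hf'.coeFn_toLp, hg'.coeFn_toLp] with x hx hx'
    simp [hx, hx']
  rw [h1]
  refine (abs_real_inner_le_norm _ _).trans ?_
  rw [mul_comm, Lp.norm_toLp, Lp.norm_toLp, Lp.norm_toLp, Lp.norm_toLp]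
  gcongr
  · exact hf.eLpNorm_ne_top
  · exact restrict_Ioc_le_volIcc le_rfl (by linarith [hh.1])
  · exact hg.eLpNorm_ne_top
  · have := eLpNorm_comp_measurePreserving (p := 2)
      (hg.mono_measure (restrict_Ioc_le_volIcc hh.1 le_rfl)).aestronglyMeasurable
      (measurePreserving_add_lag h)
    refine this.le.trans ?_
    exact eLpNorm_mono_measure _ (restrict_Ioc_le_volIcc hh.1 le_rfl)

end Lag

/-- The bilinear form `(f, g) ↦ ∫₀^{1-h} f(x) g(x + h) dx` on `L²[0,1]`. -/
noncomputable def lagForm {h : ℝ} (hh : h ∈ Icc (0 : ℝ) 1) :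
    Lp ℝ 2 volIcc →ₗ[ℝ] Lp ℝ 2 volIcc →ₗ[ℝ] ℝ :=
  LinearMap.mk₂ ℝ (fun f g => ∫ x in Ioc 0 (1 - h), f x * g (x + h))
    (fun f f' g => by
      rw [← integral_add (integrable_lag hh (Lp.memLp f) (Lp.memLp g))
        (integrable_lag hh (Lp.memLp f') (Lp.memLp g))]
      refine integral_congr_ae ((ae_eq_lag hh (Lp.coeFn_add f f') ae_eq_rfl).trans
        (Eventually.of_forall fun x => ?_))
      simp [add_mul])
    (fun c f g => by
      rw [smul_eq_mul, ← integral_const_mul]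
      refine integral_congr_ae ((ae_eq_lag hh (Lp.coeFn_smul c f) ae_eq_rfl).trans
        (Eventually.of_forall fun x => ?_))
      simp [mul_assoc])
    (fun f g g' => by
      rw [← integral_add (integrable_lag hh (Lp.memLp f) (Lp.memLp g))
        (integrable_lag hh (Lp.memLp f) (Lp.memLp g'))]
      refine integral_congr_ae ((ae_eq_lag hh ae_eq_rfl (Lp.coeFn_add g g')).trans
        (Eventually.of_forall fun x => ?_))
      simp [mul_add])
    (fun c f g => by
      rw [smul_eq_mul, ← integral_const_mul]
      refine integral_congr_ae ((ae_eq_lag hh ae_eq_rfl (Lp.coeFn_smul c g)).trans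
        (Eventually.of_forall fun x => ?_))
      simp [mul_left_comm])

theorem lagForm_toLp {h : ℝ} (hh : h ∈ Icc (0 : ℝ) 1) {f g : ℝ → ℝ} (hf : MemLp f 2 volIcc)
    (hg : MemLp g 2 volIcc) :
    lagForm hh (hf.toLp f) (hg.toLp g) = ∫ x in Ioc 0 (1 - h), f x * g (x + h) :=
  integral_congr_ae (ae_eq_lag hh hf.coeFn_toLp hg.coeFn_toLp)

theorem abs_lagForm_le {h : ℝ} (hh : h ∈ Icc (0 : ℝ) 1) (f g : Lp ℝ 2 volIcc) :
    |lagForm hh f g| ≤ ‖f‖ * ‖g‖ := by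
  have := abs_integral_lag_le hh (Lp.memLp f) (Lp.memLp g)
  rwa [Lp.toLp_coeFn, Lp.toLp_coeFn] at this

/-- The covariance estimator in terms of the lagged product form. -/
theorem lagCov_eq {h : ℝ} (hh : h ∈ Icc (0 : ℝ) 1) (n : ℕ) {z : ℕ → ℝ → ℝ} {w : ℕ → Lp ℝ 2 volIcc}
    (hz : ∀ i < n, ∃ hm : MemLp (z i) 2 volIcc, w i = hm.toLp (z i)) :
    lagCov n z h = 1 / (1 - h) * (1 / n * ∑ i ∈ Finset.range n, lagForm hh (w i) (w i)) := by
  rw [lagCov, intervalIntegral.integral_of_le (by linarith [hh.2]), integral_const_mul,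
    integral_finsetSum]
  · congr 2
    refine Finset.sum_congr rfl fun i hi => ?_
    obtain ⟨hm, hw⟩ := hz i (Finset.mem_range.1 hi)
    rw [hw, lagForm_toLp]
  · intro i hi
    obtain ⟨hm, -⟩ := hz i (Finset.mem_range.1 hi)
    exact integrable_lag hh hm hm

/-! ### Second-order fields and the Karhunen-Loève expansion. -/

section Fields

variable {Ω : Type*} [mΩ : MeasurableSpace Ω]

/-- A jointly measurable random field on `[0,1]` with constant second moment. -/
structure IsL2Field (P : Measure Ω) (Z : ℝ → Ω → ℝ) (v : ℝ) : Prop where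
  measurable : Measurable (Function.uncurry Z)
  memLp : ∀ x ∈ Icc (0 : ℝ) 1, MemLp (Z x) 2 P
  sq : ∀ x ∈ Icc (0 : ℝ) 1, ∫ ω, Z x ω ^ 2 ∂P = v

theorem MeasureTheory.MemLp.integrable_mul_fun {α : Type*} {m : MeasurableSpace α} {μ : Measure α} {f g : α → ℝ}
    (hf : MemLp f 2 μ) (hg : MemLp g 2 μ) : Integrable (fun x => f x * g x) μ :=
  MemLp.integrable_mul (p := 2) (q := 2) hf hg

theorem ae_volIcc_mem : ∀ᵐ x ∂volIcc, x ∈ Icc (0 : ℝ) 1 := ae_restrict_mem measurableSet_Icc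

namespace IsL2Field

variable {P : Measure Ω} [IsProbabilityMeasure P] {Z : ℝ → Ω → ℝ} {v : ℝ} (hZ : IsL2Field P Z v)
  {ψ : ℝ → ℝ} (hψ : MemLp ψ 2 volIcc)

include hZ in
theorem integrable_sq_prod : Integrable (fun z : ℝ × Ω => Z z.1 z.2 ^ 2) (volIcc.prod P) := by
  rw [integrable_prod_iff (by
    have := hZ.measurable
    exact (this.pow_const 2).aestronglyMeasurable)]
  constructor
  · filter_upwards [ae_volIcc_mem] with x hx
    exact (hZ.memLp x hx).integrable_sq
  · refine (integrable_const v).congr ?_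
    filter_upwards [ae_volIcc_mem] with x hx
    simp only [Real.norm_eq_abs, abs_sq]
    exact (hZ.sq x hx).symm

include hZ in
theorem ae_memLp : ∀ᵐ ω ∂P, MemLp (fun x => Z x ω) 2 volIcc := by
  filter_upwards [hZ.integrable_sq_prod.prod_left_ae] with ω hω
  rw [memLp_two_iff_integrable_sq]
  · exact hω
  · exact (hZ.measurable.comp (measurable_id.prodMk measurable_const)).aestronglyMeasurable

include hZ in
theorem integral_integral_sq : ∫ ω, ∫ x, Z x ω ^ 2 ∂volIcc ∂P = v := by
  rw [← integral_integral_swap (f := fun x ω => Z x ω ^ 2) hZ.integrable_sq_prod]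
  rw [integral_congr_ae (g := fun _ => v) (by
    filter_upwards [ae_volIcc_mem] with x hx using hZ.sq x hx)]
  simp

include hZ hψ in
theorem integrable_mul_prod {A : Ω → ℝ} (hA : MemLp A 2 P) :
    Integrable (fun z : ℝ × Ω => A z.2 * (Z z.1 z.2 * ψ z.1)) (volIcc.prod P) := by
  have h1 : Integrable (fun z : ℝ × Ω => ψ z.1 ^ 2 * A z.2 ^ 2) (volIcc.prod P) :=
    hψ.integrable_sq.mul_prod hA.integrable_sq
  refine (h1.add hZ.integrable_sq_prod).mono' ?_ (Eventually.of_forall fun z => ?_)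
  · exact hA.1.comp_snd.mul (hZ.measurable.aestronglyMeasurable.mul hψ.1.comp_fst)
  · simp only [Real.norm_eq_abs, Pi.add_apply]
    rw [abs_le]
    constructor <;>
      nlinarith [sq_nonneg (ψ z.1 * A z.2 - Z z.1 z.2), sq_nonneg (ψ z.1 * A z.2 + Z z.1 z.2)]

include hZ hψ in
/-- Fubini for the product of a square integrable variable and a coefficient of the field. -/
theorem integral_mul_coeff {A : Ω → ℝ} (hA : MemLp A 2 P) :
    ∫ ω, A ω * (∫ x, Z x ω * ψ x ∂volIcc) ∂P = ∫ x, (∫ ω, A ω * Z x ω ∂P) * ψ x ∂volIcc := by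
  simp_rw [← integral_const_mul]
  rw [← integral_integral_swap (f := fun x ω => A ω * (Z x ω * ψ x))
    (hZ.integrable_mul_prod hψ hA)]
  refine integral_congr_ae (Eventually.of_forall fun x => ?_)
  simp only
  rw [← integral_mul_const]
  simp only [mul_assoc]

include hZ hψ in
theorem memLp_coeff : MemLp (fun ω => ∫ x, Z x ω * ψ x ∂volIcc) 2 P := by
  have h1 : AEStronglyMeasurable (fun ω => ∫ x, Z x ω * ψ x ∂volIcc) P := by
    have := (hZ.integrable_mul_prod hψ (memLp_const (1 : ℝ))).integral_prod_right
    simpa using this.aestronglyMeasurable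
  rw [memLp_two_iff_integrable_sq h1]
  refine (hZ.integrable_sq_prod.integral_prod_right.mul_const (∫ x, ψ x ^ 2 ∂volIcc)).mono'
    (h1.pow 2) ?_
  filter_upwards [hZ.ae_memLp] with ω hω
  have h2 : ∫ x, Z x ω * ψ x ∂volIcc = inner ℝ (hψ.toLp ψ) (hω.toLp _) := by
    rw [L2.inner_def]
    refine integral_congr_ae ?_
    filter_upwards [hψ.coeFn_toLp, hω.coeFn_toLp] with x hx hx'
    simp [hx, hx']
  rw [Real.norm_eq_abs, abs_sq, h2, integral_volIcc, integral_volIcc,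
    ← norm_toLp_sq hω, ← norm_toLp_sq hψ, ← mul_pow, mul_comm, ← sq_abs]
  gcongr
  exact abs_real_inner_le_norm _ _

include hZ hψ in
/-- The coefficients of a field are measurable with respect to the values of the field. -/
theorem condExp_coeff {τ : Type*} [MeasurableSpace τ] {T : Ω → τ} (hT : Measurable T)
    (hZm : ∀ x ∈ Icc (0 : ℝ) 1, Measurable[MeasurableSpace.comap T inferInstance] (Z x)) :
    P[fun ω => ∫ x, Z x ω * ψ x ∂volIcc | MeasurableSpace.comap T inferInstance] =ᵐ[P] fun ω => ∫ x, Z x ω * ψ x ∂volIcc := by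
  set A : Ω → ℝ := fun ω => ∫ x, Z x ω * ψ x ∂volIcc with hAdef
  have hA : MemLp A 2 P := hZ.memLp_coeff hψ
  have hA' : MemLp (P[A | MeasurableSpace.comap T inferInstance]) 2 P := hA.condExp one_le_two
  have horth : ∀ Y : Ω → ℝ, StronglyMeasurable[MeasurableSpace.comap T inferInstance] Y → MemLp Y 2 P →
      ∫ ω, (A ω - P[A | MeasurableSpace.comap T inferInstance] ω) * Y ω ∂P = 0 := fun Y hY hY2 => by
    have h1 := integral_congr_ae (condExp_mul_of_stronglyMeasurable_right (μ := P) hY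
      (hA.integrable_mul hY2) (hA.integrable one_le_two))
    rw [integral_condExp hT.comap_le] at h1
    simp only [sub_mul]
    rw [integral_sub (hA.integrable_mul_fun hY2) (hA'.integrable_mul_fun hY2), sub_eq_zero]
    exact h1
  have hB : MemLp (fun ω => A ω - P[A | MeasurableSpace.comap T inferInstance] ω) 2 P := hA.sub hA'
  -- By Fubini this is the integral over x of E[(A - E[A | T]) Z_x] ψ(x). Each Z_x is measurable
  -- with respect to T, so the inner mean vanishes although measurability of the whole integral A is
  -- not known. Since A - E[A | T] is also orthogonal to E[A | T], its second moment is zero.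
  have h1 : ∫ ω, (A ω - P[A | MeasurableSpace.comap T inferInstance] ω) * A ω ∂P = 0 := by
    rw [hAdef, hZ.integral_mul_coeff hψ hB]
    rw [integral_congr_ae (g := fun _ => 0), integral_zero]
    filter_upwards [ae_volIcc_mem] with x hx
    rw [horth _ (hZm x hx).stronglyMeasurable (hZ.memLp x hx), zero_mul]
  have h2 := horth _ stronglyMeasurable_condExp hA'
  have h3 : ∫ ω, (A ω - P[A | MeasurableSpace.comap T inferInstance] ω) ^ 2 ∂P = 0 := by
    have : ∀ ω, (A ω - P[A | MeasurableSpace.comap T inferInstance] ω) ^ 2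
        = (A ω - P[A | MeasurableSpace.comap T inferInstance] ω) * A ω - (A ω - P[A | MeasurableSpace.comap T inferInstance] ω) * P[A | MeasurableSpace.comap T inferInstance] ω := fun ω => by ring
    simp_rw [this]
    rw [integral_sub (hB.integrable_mul_fun hA) (hB.integrable_mul_fun hA'), h1, h2, sub_zero]
  rw [integral_eq_zero_iff_of_nonneg (fun ω => sq_nonneg _) hB.integrable_sq] at h3
  filter_upwards [h3] with ω hω
  have := pow_eq_zero_iff two_ne_zero |>.1 hω
  linarith

end IsL2Field

namespace IsEigenSystem

variable {G : ℝ → ℝ → ℝ} {lam : ℕ → ℝ} {ψ : ℕ → ℝ → ℝ} (h : IsEigenSystem G lam ψ)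

include h in
theorem memLp (k : ℕ) : MemLp (ψ k) 2 volIcc := by
  obtain ⟨b, hb⟩ := h.basis
  exact (memLp_congr_ae (hb k)).1 (Lp.memLp (b k))

include h in
theorem integral_sq (k : ℕ) : ∫ x, ψ k x ^ 2 ∂volIcc = 1 := by
  obtain ⟨b, hb⟩ := h.basis
  have h1 : ‖b k‖ ^ 2 = 1 := by rw [b.orthonormal.1 k, one_pow]
  rw [← h1, ← real_inner_self_eq_norm_sq, L2.inner_def]
  refine integral_congr_ae ?_
  filter_upwards [hb k] with x hx
  simp [hx, sq]

include h in
theorem hasSum_sq {f : ℝ → ℝ} (hf : MemLp f 2 volIcc) :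
    HasSum (fun k => (∫ x, f x * ψ k x ∂volIcc) ^ 2) (∫ x, f x ^ 2 ∂volIcc) := by
  obtain ⟨b, hb⟩ := h.basis
  have h1 := b.hasSum_inner_mul_inner (hf.toLp f) (hf.toLp f)
  have h2 : ∀ k, inner ℝ (b k) (hf.toLp f) = ∫ x, f x * ψ k x ∂volIcc := fun k => by
    rw [L2.inner_def]
    refine integral_congr_ae ?_
    filter_upwards [hb k, hf.coeFn_toLp] with x hx hx'
    simp [hx, hx']
  rw [real_inner_self_eq_norm_sq, norm_toLp_sq, ← integral_volIcc] at h1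
  have h3 : ∀ k, inner ℝ (hf.toLp f) (b k) * inner ℝ (b k) (hf.toLp f)
      = (∫ x, f x * ψ k x ∂volIcc) ^ 2 := fun k => by
    rw [real_inner_comm (b k) (hf.toLp f), h2, sq]
  simpa only [h3] using h1

variable {P : Measure Ω} [IsProbabilityMeasure P] {Z : ℝ → Ω → ℝ} {v : ℝ} (hZ : IsL2Field P Z v)
  (hG : ∀ x ∈ Icc (0 : ℝ) 1, ∀ x' ∈ Icc (0 : ℝ) 1, ∫ ω, Z x ω * Z x' ω ∂P = G x x')

include h hZ hG in
-- Fubini turns the mean into the covariance operator applied to ψ k. The eigenvalue equation is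
-- assumed at every x, so the identity holds pointwise and not just almost everywhere.
theorem integral_mul_coeff {x : ℝ} (hx : x ∈ Icc (0 : ℝ) 1) (k : ℕ) :
    ∫ ω, Z x ω * (∫ x', Z x' ω * ψ k x' ∂volIcc) ∂P = lam k * ψ k x := by
  rw [hZ.integral_mul_coeff (h.memLp k) (hZ.memLp x hx), ← h.eigen k x hx, ← integral_volIcc]
  refine integral_congr_ae ?_
  filter_upwards [ae_volIcc_mem] with x' hx'
  rw [hG x hx x' hx']

include h hZ hG in
theorem integral_coeff_sq (k : ℕ) : ∫ ω, (∫ x, Z x ω * ψ k x ∂volIcc) ^ 2 ∂P = lam k := by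
  simp_rw [sq]
  rw [hZ.integral_mul_coeff (h.memLp k) (hZ.memLp_coeff (h.memLp k))]
  rw [integral_congr_ae (g := fun x => lam k * ψ k x ^ 2) (by
    filter_upwards [ae_volIcc_mem] with x hx
    simp_rw [mul_comm _ (Z x _)]
    rw [h.integral_mul_coeff hZ hG hx]
    ring), integral_const_mul, h.integral_sq, mul_one]

include h hZ hG in
/-- The trace formula. -/
theorem hasSum_eigenvalues : HasSum lam v := by
  have h1 := hasSum_integral_of_summable_integral_norm (μ := P)
    (F := fun k ω => (∫ x, Z x ω * ψ k x ∂volIcc) ^ 2)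
    (fun k => (hZ.memLp_coeff (h.memLp k)).integrable_sq) (by
      simp only [Real.norm_eq_abs, abs_sq, h.integral_coeff_sq hZ hG]
      exact h.summable)
  simp only [h.integral_coeff_sq hZ hG] at h1
  rwa [integral_congr_ae (g := fun ω => ∫ x, Z x ω ^ 2 ∂volIcc) (by
    filter_upwards [hZ.ae_memLp] with ω hω
    exact (h.hasSum_sq hω).tsum_eq), hZ.integral_integral_sq] at h1

variable {ξ : ℕ → Ω → ℝ} (hξ2 : ∀ k, MemLp (ξ k) 2 P)
  (hξc : ∀ k k', ∫ ω, ξ k ω * ξ k' ω ∂P = if k = k' then 1 else 0)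
  (hξs : ∀ k, ∀ᵐ ω ∂P, ∫ x, Z x ω * fpc lam ψ k x ∂volIcc = lam k * ξ k ω)

omit [IsProbabilityMeasure P] in
include h hξs in
/-- The scores are normalized coefficients. -/
theorem score_eq_coeff {k : ℕ} (hk : lam k ≠ 0) :
    ξ k =ᵐ[P] fun ω => (√(lam k))⁻¹ * ∫ x, Z x ω * ψ k x ∂volIcc := by
  have hpos : 0 < lam k := lt_of_le_of_ne (h.nonneg k) hk.symm
  filter_upwards [hξs k] with ω hω
  have h1 : ∫ x, Z x ω * fpc lam ψ k x ∂volIcc = √(lam k) * ∫ x, Z x ω * ψ k x ∂volIcc := by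
    rw [← integral_const_mul]
    refine integral_congr_ae (Eventually.of_forall fun x => ?_)
    simp only [fpc]
    ring
  rw [h1] at hω
  have h2 : 0 < √(lam k) := Real.sqrt_pos.2 hpos
  have h3 : √(lam k) * √(lam k) = lam k := Real.mul_self_sqrt hpos.le
  rw [eq_inv_mul_iff_mul_eq₀ h2.ne']
  apply mul_left_cancel₀ h2.ne'
  rw [hω, ← mul_assoc, h3]

include h hZ hG hξs in
-- For a nonzero eigenvalue E[Z_x ξ_k] = φ_k(x). The factor φ_k(x) on both sides makes the identity
-- hold for null eigenvalues as well, where the score is not determined by Z.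
theorem integral_mul_score {x : ℝ} (hx : x ∈ Icc (0 : ℝ) 1) (k : ℕ) :
    (∫ ω, Z x ω * ξ k ω ∂P) * fpc lam ψ k x = fpc lam ψ k x ^ 2 := by
  by_cases hk : lam k = 0
  · simp [fpc, hk]
  · have h1 : ∫ ω, Z x ω * ξ k ω ∂P = (√(lam k))⁻¹ * (lam k * ψ k x) := by
      rw [← h.integral_mul_coeff hZ hG hx, ← integral_const_mul]
      refine integral_congr_ae ?_
      filter_upwards [h.score_eq_coeff hξs hk] with ω hω
      rw [hω]
      ring
    have hpos : 0 < lam k := lt_of_le_of_ne (h.nonneg k) (Ne.symm hk)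
    have h2 : 0 < √(lam k) := Real.sqrt_pos.2 hpos
    have h3 : √(lam k) * √(lam k) = lam k := Real.mul_self_sqrt hpos.le
    have h4 : (√(lam k))⁻¹ * (lam k * ψ k x) = fpc lam ψ k x := by
      rw [fpc, inv_mul_eq_iff_eq_mul₀ h2.ne', ← mul_assoc, h3]
    rw [h1, h4, sq]

include h hZ hG hξ2 hξc hξs in
/-- The mean squared error of the truncated Karhunen-Loève expansion at a point. -/
theorem integral_truncation_sq {x : ℝ} (hx : x ∈ Icc (0 : ℝ) 1) (K : ℕ) :
    ∫ ω, (Z x ω - ∑ k ∈ Finset.range K, ξ k ω * fpc lam ψ k x) ^ 2 ∂P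
      = v - ∑ k ∈ Finset.range K, fpc lam ψ k x ^ 2 := by
  have hZx := hZ.memLp x hx
  set S : Ω → ℝ := fun ω => ∑ k ∈ Finset.range K, ξ k ω * fpc lam ψ k x with hS
  have hS2 : MemLp S 2 P := memLp_finsetSum (Finset.range K)
    (f := fun k ω => ξ k ω * fpc lam ψ k x) fun k _ => (hξ2 k).mul_const _
  have h1 : ∫ ω, Z x ω * S ω ∂P = ∑ k ∈ Finset.range K, fpc lam ψ k x ^ 2 := by
    simp only [hS, Finset.mul_sum, ← mul_assoc]
    rw [integral_finsetSum _ fun k _ => (hZx.integrable_mul_fun (hξ2 k)).mul_const _]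
    refine Finset.sum_congr rfl fun k _ => ?_
    rw [integral_mul_const, h.integral_mul_score hZ hG hξs hx]
  have h2 : ∫ ω, S ω * S ω ∂P = ∑ k ∈ Finset.range K, fpc lam ψ k x ^ 2 := by
    have hi : ∀ k k', Integrable (fun ω => ξ k ω * fpc lam ψ k x * (ξ k' ω * fpc lam ψ k' x)) P :=
      fun k k' => ((hξ2 k).mul_const _).integrable_mul_fun ((hξ2 k').mul_const _)
    simp only [hS, Finset.sum_mul_sum]
    rw [integral_finsetSum _ fun k _ => integrable_finsetSum _ fun k' _ => hi k k']
    refine Finset.sum_congr rfl fun k hk => ?_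
    rw [integral_finsetSum _ fun k' _ => hi k k', Finset.sum_eq_single k]
    · have : ∀ ω, ξ k ω * fpc lam ψ k x * (ξ k ω * fpc lam ψ k x)
          = ξ k ω * ξ k ω * fpc lam ψ k x ^ 2 := fun ω => by ring
      simp_rw [this]
      rw [integral_mul_const, hξc, if_pos rfl, one_mul]
    · intro k' _ hne
      have : ∀ ω, ξ k ω * fpc lam ψ k x * (ξ k' ω * fpc lam ψ k' x)
          = ξ k ω * ξ k' ω * (fpc lam ψ k x * fpc lam ψ k' x) := fun ω => by ring
      simp_rw [this]
      rw [integral_mul_const, hξc, if_neg hne.symm, zero_mul]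
    · intro hk'; exact absurd hk hk'
  have h3 : ∀ ω, (Z x ω - S ω) ^ 2 = Z x ω ^ 2 - 2 * (Z x ω * S ω) + S ω * S ω := fun ω => by ring
  change ∫ ω, (Z x ω - S ω) ^ 2 ∂P = _
  simp_rw [h3]
  have h4 : Integrable (fun ω => Z x ω ^ 2 - 2 * (Z x ω * S ω)) P :=
    hZx.integrable_sq.sub ((hZx.integrable_mul_fun hS2).const_mul 2)
  rw [integral_add h4
    (hS2.integrable_mul_fun hS2), integral_sub hZx.integrable_sq ((hZx.integrable_mul_fun hS2).const_mul 2),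
    integral_const_mul, h1, h2, hZ.sq x hx]
  ring

include h hZ hG hξ2 hξc hξs in
/-- Mercer's formula on the diagonal. -/
theorem hasSum_fpc_sq {a : ℕ → ℝ} (ha : Summable a) (hc : ∀ k, ContinuousOn (fpc lam ψ k) (Icc 0 1))
    (hφa : ∀ k, ∀ x ∈ Icc (0 : ℝ) 1, |fpc lam ψ k x| ≤ a k) {x : ℝ} (hx : x ∈ Icc (0 : ℝ) 1) :
    HasSum (fun k => fpc lam ψ k x ^ 2) v := by
  have ha0 : ∀ k, 0 ≤ a k := fun k => (abs_nonneg _).trans (hφa k 0 (by simp))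
  have ha2 : Summable fun k => a k ^ 2 := by
    refine Summable.of_norm_bounded_eventually_nat ha ?_
    filter_upwards [ha.tendsto_atTop_zero.eventually_le_const one_pos] with k hk
    rw [Real.norm_eq_abs, abs_of_nonneg (sq_nonneg _), sq]
    exact mul_le_of_le_one_left (ha0 k) hk
  have hb : ∀ k, ∀ x ∈ Icc (0 : ℝ) 1, ‖fpc lam ψ k x ^ 2‖ ≤ a k ^ 2 := fun k x hx => by
    rw [Real.norm_eq_abs, abs_pow]
    exact pow_le_pow_left₀ (abs_nonneg _) (hφa k x hx) 2
  have hsum : ∀ x ∈ Icc (0 : ℝ) 1, Summable fun k => fpc lam ψ k x ^ 2 := fun x hx =>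
    Summable.of_norm_bounded ha2 fun k => hb k x hx
  -- Bessel's inequality: the truncation error at x is nonnegative.
  have hle : ∀ x ∈ Icc (0 : ℝ) 1, ∑' k, fpc lam ψ k x ^ 2 ≤ v := fun x hx => by
    refine (hsum x hx).tsum_le_of_sum_range_le fun K => ?_
    rw [← sub_nonneg, ← h.integral_truncation_sq hZ hG hξ2 hξc hξs hx K]
    exact integral_nonneg fun ω => sq_nonneg _
  have hcont : ContinuousOn (fun x => v - ∑' k, fpc lam ψ k x ^ 2) (Icc 0 1) :=
    continuousOn_const.sub (continuousOn_tsum (fun k => (hc k).pow 2) ha2 hb)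
  have hfsq : ∀ k, ∫ x, fpc lam ψ k x ^ 2 ∂volIcc = lam k := fun k => by
    simp only [fpc, mul_pow, Real.sq_sqrt (h.nonneg k)]
    rw [integral_const_mul, h.integral_sq, mul_one]
  have hint : ∫ x, (∑' k, fpc lam ψ k x ^ 2) ∂volIcc = v := by
    have h1 := hasSum_integral_of_summable_integral_norm (μ := volIcc)
      (F := fun k x => fpc lam ψ k x ^ 2)
      (fun k => ((h.memLp k).const_mul (√(lam k))).integrable_sq) (by
        simp only [Real.norm_eq_abs, abs_sq, hfsq]
        exact h.summable)
    simp only [hfsq] at h1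
    exact h1.unique (h.hasSum_eigenvalues hZ hG)
  -- The defect is nonnegative, continuous because v does not depend on x and the series converges
  -- uniformly, and has integral zero by the trace formula. Hence it vanishes at every point.
  have hv : v - ∑' k, fpc lam ψ k x ^ 2 = 0 := by
    by_contra hne
    have hpos : 0 < ∫ x in (0 : ℝ)..1, (v - ∑' k, fpc lam ψ k x ^ 2) :=
      intervalIntegral.integral_pos one_pos hcont
        (fun x hx => sub_nonneg.2 (hle x (Ioc_subset_Icc_self hx)))
        ⟨x, hx, lt_of_le_of_ne (sub_nonneg.2 (hle x hx)) (Ne.symm hne)⟩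
    have hi : Integrable (fun x => ∑' k, fpc lam ψ k x ^ 2) volIcc :=
      (continuousOn_tsum (fun k => (hc k).pow 2) ha2 hb).integrableOn_Icc
    rw [← integral_volIcc, integral_sub (integrable_const v) hi, hint] at hpos
    simp at hpos
  rw [sub_eq_zero] at hv
  rw [hv]
  exact (hsum x hx).hasSum

include h hZ hG hξ2 hξc hξs in
-- By Mercer's formula the error is the tail ∑_{k≥K} φ_k(x)², and a sum of squares of nonnegative
-- numbers is at most the square of their sum. This puts the error in the form controlled by the
-- tail of the supremum norms, at every x.
theorem integral_truncation_sq_le {a : ℕ → ℝ} (ha : Summable a)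
    (hc : ∀ k, ContinuousOn (fpc lam ψ k) (Icc 0 1))
    (hφa : ∀ k, ∀ x ∈ Icc (0 : ℝ) 1, |fpc lam ψ k x| ≤ a k) {x : ℝ} (hx : x ∈ Icc (0 : ℝ) 1)
    (K : ℕ) :
    ∫ ω, (Z x ω - ∑ k ∈ Finset.range K, ξ k ω * fpc lam ψ k x) ^ 2 ∂P ≤ (∑' k, a (K + k)) ^ 2 := by
  have h1 := h.hasSum_fpc_sq hZ hG hξ2 hξc hξs ha hc hφa hx
  have ha0 : ∀ k, 0 ≤ a k := fun k => (abs_nonneg _).trans (hφa k 0 (by simp))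
  have ha' : Summable fun k => a (K + k) := by
    simpa only [add_comm K] using (summable_nat_add_iff K).2 ha
  have h2 : ∑' k, fpc lam ψ (K + k) x ^ 2 = v - ∑ k ∈ Finset.range K, fpc lam ψ k x ^ 2 := by
    have := h1.summable.sum_add_tsum_nat_add K
    rw [h1.tsum_eq] at this
    rw [← this]
    simp only [add_comm K]
    ring
  rw [h.integral_truncation_sq hZ hG hξ2 hξc hξs hx K, ← h2]
  have h3 : Summable fun k => fpc lam ψ (K + k) x ^ 2 := by
    simpa only [add_comm K] using (summable_nat_add_iff K).2 h1.summable
  rw [sq, ← tsum_mul_left]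
  refine h3.tsum_le_tsum (fun k => ?_) (ha'.mul_left _)
  rw [← sq_abs, sq]
  have h4 : a (K + k) ≤ ∑' k, a (K + k) := ha'.le_tsum k fun _ _ => ha0 _
  have h5 := hφa (K + k) x hx
  exact mul_le_mul (h5.trans h4) h5 (abs_nonneg _) (tsum_nonneg fun _ => ha0 _)

end IsEigenSystem

end Fields

/-! ### Calculus of bounds in mean. -/

/-- `X` is integrable with mean at most `c`. -/
def HasMeanLE {Ω : Type*} [MeasurableSpace Ω] (P : Measure Ω) (X : Ω → ℝ) (c : ℝ) : Prop :=
  Integrable X P ∧ ∫ ω, X ω ∂P ≤ c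

namespace HasMeanLE

variable {Ω : Type*} [MeasurableSpace Ω] {P : Measure Ω} {X Y : Ω → ℝ} {c d : ℝ}

theorem add (hX : HasMeanLE P X c) (hY : HasMeanLE P Y d) :
    HasMeanLE P (fun ω => X ω + Y ω) (c + d) :=
  ⟨hX.1.add hY.1, by rw [integral_add hX.1 hY.1]; exact add_le_add hX.2 hY.2⟩

theorem const_mul (hX : HasMeanLE P X c) {t : ℝ} (ht : 0 ≤ t) :
    HasMeanLE P (fun ω => t * X ω) (t * c) :=
  ⟨hX.1.const_mul t, by rw [integral_const_mul]; exact mul_le_mul_of_nonneg_left hX.2 ht⟩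

theorem div_const (hX : HasMeanLE P X c) {t : ℝ} (ht : 0 ≤ t) :
    HasMeanLE P (fun ω => X ω / t) (c / t) := by
  simpa [div_eq_inv_mul] using hX.const_mul (inv_nonneg.2 ht)

theorem const [IsProbabilityMeasure P] (c : ℝ) : HasMeanLE P (fun _ => c) c :=
  ⟨integrable_const c, by simp⟩

theorem sum {ι : Type*} (s : Finset ι) {X : ι → Ω → ℝ} {c : ι → ℝ}
    (hX : ∀ i ∈ s, HasMeanLE P (X i) (c i)) :
    HasMeanLE P (fun ω => ∑ i ∈ s, X i ω) (∑ i ∈ s, c i) :=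
  ⟨integrable_finsetSum _ fun i hi => (hX i hi).1, by
    rw [integral_finsetSum _ fun i hi => (hX i hi).1]
    exact Finset.sum_le_sum fun i hi => (hX i hi).2⟩

theorem sum_range (n : ℕ) {X : ℕ → Ω → ℝ} (hX : ∀ i < n, HasMeanLE P (X i) c) :
    HasMeanLE P (fun ω => ∑ i ∈ Finset.range n, X i ω) (n * c) := by
  simpa using sum (Finset.range n) (c := fun _ => c) fun i hi => hX i (Finset.mem_range.1 hi)

theorem mono (hX : HasMeanLE P X c) (h : c ≤ d) : HasMeanLE P X d := ⟨hX.1, hX.2.trans h⟩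

theorem of_le (hX : HasMeanLE P X c) (hY : AEStronglyMeasurable Y P) (h0 : ∀ ω, 0 ≤ Y ω)
    (h : ∀ ω, Y ω ≤ X ω) : HasMeanLE P Y c := by
  have hi : Integrable Y P := hX.1.mono' hY (Eventually.of_forall fun ω => by
    rw [Real.norm_eq_abs, abs_of_nonneg (h0 ω)]; exact h ω)
  exact ⟨hi, (integral_mono hi hX.1 h).trans hX.2⟩

end HasMeanLE

/-! ### Second moments of errors, scores and their products. -/

section Errors

variable {Ω : Type*} [MeasurableSpace Ω] {P : Measure Ω}

theorem integral_sum_mul_sum {ι κ : Type*} (s : Finset ι) (t : Finset κ) {X : ι → Ω → ℝ}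
    {Y : κ → Ω → ℝ} (hX : ∀ i ∈ s, MemLp (X i) 2 P) (hY : ∀ j ∈ t, MemLp (Y j) 2 P) :
    ∫ ω, (∑ i ∈ s, X i ω) * (∑ j ∈ t, Y j ω) ∂P = ∑ i ∈ s, ∑ j ∈ t, ∫ ω, X i ω * Y j ω ∂P := by
  simp only [Finset.sum_mul_sum]
  rw [integral_finsetSum _ fun i hi => integrable_finsetSum _ fun j hj =>
    (hX i hi).integrable_mul_fun (hY j hj)]
  refine Finset.sum_congr rfl fun i hi => ?_
  rw [integral_finsetSum _ fun j hj => (hX i hi).integrable_mul_fun (hY j hj)]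

/-- The mean squared norm of the projection of a vector of uncorrelated errors. -/
theorem hasMeanLE_norm_starProjection_sq {N : ℕ} (V : Submodule ℝ (EuclideanSpace ℝ (Fin N)))
    {u : ℕ → Ω → ℝ} (hu : ∀ j < N, MemLp (u j) 2 P) {s : ℝ} (hs : 0 ≤ s)
    (huc : ∀ j < N, ∀ j' < N, ∫ ω, u j ω * u j' ω ∂P = if j = j' then s else 0)
    {c : ℕ → ℝ} {M : ℝ} (hc : ∀ j < N, |c j| ≤ M) :
    HasMeanLE P (fun ω => ‖V.starProjection (WithLp.toLp 2 fun j : Fin N => c j * u j ω)‖ ^ 2)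
      (M ^ 2 * s * Module.finrank ℝ V) := by
  -- In an orthonormal basis of V the squared norm is a sum of dim V squared coordinates. Each is a
  -- unit combination of uncorrelated variables of variance at most M² s.
  set b := stdOrthonormalBasis ℝ V
  have h1 : ∀ y : EuclideanSpace ℝ (Fin N),
      ‖V.starProjection y‖ ^ 2 = ∑ i, (∑ j : Fin N, (b i : EuclideanSpace ℝ (Fin N)) j * y j) ^ 2 :=
    fun y => by
      rw [Submodule.starProjection_apply, ← Submodule.coe_norm, ← b.sum_sq_norm_inner_right]
      refine Finset.sum_congr rfl fun i _ => ?_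
      rw [Submodule.inner_orthogonalProjectionOnto_eq_of_mem_left, PiLp.inner_apply,
        Real.norm_eq_abs, sq_abs]
      congr 1
      refine Finset.sum_congr rfl fun j _ => ?_
      simp [mul_comm]
  simp only [h1]
  have h2 : ∀ i, HasMeanLE P (fun ω => (∑ j : Fin N,
      (b i : EuclideanSpace ℝ (Fin N)) j * (c j * u j ω)) ^ 2) (M ^ 2 * s) := fun i => by
    set v : EuclideanSpace ℝ (Fin N) := (b i : EuclideanSpace ℝ (Fin N))
    have hm : ∀ j ∈ Finset.univ, MemLp (fun ω => v j * (c j * u j ω)) 2 P := fun j _ =>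
      ((hu j j.2).const_mul _).const_mul _
    refine ⟨(memLp_finsetSum Finset.univ hm).integrable_sq, ?_⟩
    simp only [sq (∑ j, _)]
    rw [integral_sum_mul_sum _ _ hm hm]
    have h3 : ∀ j j' : Fin N, ∫ ω, v j * (c j * u j ω) * (v j' * (c j' * u j' ω)) ∂P
        = if j = j' then v j ^ 2 * c j ^ 2 * s else 0 := fun j j' => by
      have : ∀ ω, v j * (c j * u j ω) * (v j' * (c j' * u j' ω))
          = (v j * c j * (v j' * c j')) * (u j ω * u j' ω) := fun ω => by ring
      simp_rw [this]
      rw [integral_const_mul, huc j j.2 j' j'.2]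
      by_cases hjj : j = j'
      · subst hjj; rw [if_pos rfl, if_pos rfl]; ring
      · rw [if_neg hjj, if_neg (fun h => hjj (Fin.ext h)), mul_zero]
    simp only [h3, Finset.sum_ite_eq, Finset.mem_univ, if_true]
    have h4 : ∑ j, v j ^ 2 = 1 := by
      have : ‖v‖ = 1 := by
        have := b.orthonormal.1 i
        rwa [Submodule.coe_norm] at this
      have h5 := EuclideanSpace.norm_sq_eq v
      rw [this] at h5
      simpa using h5.symm
    calc ∑ j, v j ^ 2 * c j ^ 2 * s ≤ ∑ j, v j ^ 2 * M ^ 2 * s := by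
          refine Finset.sum_le_sum fun j _ => ?_
          have : c j ^ 2 ≤ M ^ 2 := by
            rw [← sq_abs]; exact pow_le_pow_left₀ (abs_nonneg _) (hc j j.2) 2
          gcongr
      _ = M ^ 2 * s := by rw [← Finset.sum_mul, ← Finset.sum_mul, h4, one_mul]
  have h3 := HasMeanLE.sum Finset.univ fun i _ => h2 i
  refine h3.mono ?_
  simp [mul_comm]

section Sample

variable [IsProbabilityMeasure P] {η : ℕ → ℝ → Ω → ℝ} {C : ℝ → ℝ} (hη : IsStationarySample P η C)

/-- The processes minus their means. -/
noncomputable def centeredField (P : Measure Ω) (η : ℕ → ℝ → Ω → ℝ) (i : ℕ) (x : ℝ) (ω : Ω) : ℝ :=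
  η i x ω - meanFun P (η i) x

omit [IsProbabilityMeasure P] in
include hη in
theorem IsStationarySample.meanFun_eq (i : ℕ) {x : ℝ} (hx : x ∈ Icc (0 : ℝ) 1) :
    meanFun P (η i) x = meanFun P (η 0) x :=
  ((hη.identDistrib i).comp (u := fun f : Icc (0 : ℝ) 1 → ℝ => f ⟨x, hx⟩)
    (measurable_pi_apply _)).integral_eq

omit [IsProbabilityMeasure P] in
include hη in
theorem IsStationarySample.integral_centeredField_mul (i : ℕ) {x x' : ℝ} (hx : x ∈ Icc (0 : ℝ) 1)
    (hx' : x' ∈ Icc (0 : ℝ) 1) :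
    ∫ ω, centeredField P η i x ω * centeredField P η i x' ω ∂P = covFun P (η 0) x x' := by
  have h1 := ((hη.identDistrib i).comp
    (u := fun f => (f ⟨x, hx⟩ - meanFun P (η 0) x) * (f ⟨x', hx'⟩ - meanFun P (η 0) x')) (by
      fun_prop)).integral_eq
  simp only [centeredField, hη.meanFun_eq i hx, hη.meanFun_eq i hx']
  exact h1

include hη in
-- Stationarity enters through the variance, which is C(0) at every x.
theorem IsStationarySample.isL2Field (i : ℕ) : IsL2Field P (centeredField P η i) (C 0) where
  measurable := by
    have h1 : Measurable (fun x => meanFun P (η i) x) :=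
      ((hη.measurable i).stronglyMeasurable.integral_prod_right (ν := P)).measurable
    exact (hη.measurable i).sub (h1.comp measurable_fst)
  memLp x hx := (hη.memLp i x hx).sub (memLp_const _)
  sq x hx := by
    simp only [sq]
    rw [hη.integral_centeredField_mul i hx hx, hη.stationary x hx x hx, sub_self, abs_zero]

variable {lam : ℕ → ℝ} {ψ : ℕ → ℝ → ℝ} (heig : IsEigenSystem (covFun P (η 0)) lam ψ)
  {ξ : ℕ → ℕ → Ω → ℝ} (hξ : IsFPCScores P η lam ψ ξ) {ε : ℕ → ℕ → Ω → ℝ} (hε : IsErrorArray P η ε)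

omit [IsProbabilityMeasure P] in
include hξ in
theorem IsFPCScores.score_centeredField (i k : ℕ) : ∀ᵐ ω ∂P,
    ∫ x, centeredField P η i x ω * fpc lam ψ k x ∂volIcc = lam k * ξ i k ω := by
  filter_upwards [hξ.score i k] with ω hω
  rw [integral_volIcc]
  exact hω

include hη heig hξ hε in
/-- The scores are independent of the errors. -/
theorem indepFun_scores_errors {k : ℕ} (hk : lam k ≠ 0) :
    IndepFun (fun ω i => ξ i k ω) (fun ω (a : ℕ × ℕ) => ε a.1 a.2 ω) P := by
  set T : Ω → ℕ → Icc (0 : ℝ) 1 → ℝ := fun ω i => trajectory (η i) ω with hTdef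
  have hTx : ∀ i x, x ∈ Icc (0 : ℝ) 1 → Measurable (η i x) := fun i x _ =>
    (hη.measurable i).comp (measurable_const.prodMk measurable_id)
  have hT : Measurable T := by
    rw [measurable_pi_iff]
    intro i
    rw [measurable_pi_iff]
    intro x
    exact hTx i x x.2
  have hZT : ∀ i, ∀ x ∈ Icc (0 : ℝ) 1,
      Measurable[MeasurableSpace.comap T inferInstance] (centeredField P η i x) := fun i x hx => by
    have h1 : Measurable (fun f : ℕ → Icc (0 : ℝ) 1 → ℝ => f i ⟨x, hx⟩ - meanFun P (η i) x) := by
      fun_prop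
    exact h1.comp (comap_measurable T)
  -- The conditional expectations are versions of the coefficients that are measurable with respect
  -- to the trajectories everywhere, so independence from the errors applies to them. It transfers
  -- to the scores by almost sure equality.
  set A : ℕ → Ω → ℝ := fun i => P[fun ω => ∫ x, centeredField P η i x ω * ψ k x ∂volIcc |
    MeasurableSpace.comap T inferInstance] with hA
  have hξA : ∀ i, (fun ω => (√(lam k))⁻¹ * A i ω) =ᵐ[P] ξ i k := fun i => by
    filter_upwards [heig.score_eq_coeff (hξ.score_centeredField i) hk,
      (hη.isL2Field i).condExp_coeff (heig.memLp k) hT (hZT i)] with ω h1 h2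
    rw [h1]
    exact congrArg _ h2
  have hAm : Measurable[MeasurableSpace.comap T inferInstance]
      (fun ω i => (√(lam k))⁻¹ * A i ω) := by
    refine @measurable_pi_lambda _ _ _ (MeasurableSpace.comap T inferInstance) _ _ fun i => ?_
    exact (stronglyMeasurable_condExp.measurable).const_mul _
  have h1 : IndepFun (fun ω i => (√(lam k))⁻¹ * A i ω) (fun ω (a : ℕ × ℕ) => ε a.1 a.2 ω) P := by
    rw [IndepFun_iff_Indep]
    have h2 := hε.indep_process
    rw [IndepFun_iff_Indep] at h2
    exact indep_of_indep_of_le_left h2 hAm.comap_le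
  refine h1.congr ?_ ae_eq_rfl
  filter_upwards [ae_all_iff.2 hξA] with ω hω
  funext i
  exact hω i

omit [IsProbabilityMeasure P] in
include hξ in
theorem IsFPCScores.integral_mul (i i' k : ℕ) :
    ∫ ω, ξ i k ω * ξ i' k ω ∂P = if i = i' then 1 else 0 := by
  split_ifs with h
  · subst h
    simpa using hξ.uncorrelated i k k
  · have h1 := ((hξ.indep.indepFun h).comp (measurable_pi_apply k)
      (measurable_pi_apply k)).integral_mul_eq_mul_integral (hξ.memLp i k).1 (hξ.memLp i' k).1
    have h2 : ∫ ω, ξ i k ω * ξ i' k ω ∂P = (∫ ω, ξ i k ω ∂P) * ∫ ω, ξ i' k ω ∂P := h1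
    rw [h2, hξ.mean, zero_mul]

omit [IsProbabilityMeasure P] in
include hε in
theorem IsErrorArray.integral_mul (i j i' j' : ℕ) :
    ∫ ω, ε i j ω * ε i' j' ω ∂P = if (i, j) = (i', j') then 1 else 0 := by
  split_ifs with h
  · obtain ⟨rfl, rfl⟩ := Prod.mk.inj h
    simpa [sq] using hε.variance i j
  · have h1 := (hε.indep.indepFun h).integral_mul_eq_mul_integral (hε.memLp i j).1
      (hε.memLp i' j').1
    have h2 : ∫ ω, ε i j ω * ε i' j' ω ∂P = (∫ ω, ε i j ω ∂P) * ∫ ω, ε i' j' ω ∂P := h1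
    rw [h2, hε.mean, zero_mul]

include hη heig hξ hε in
-- Scores and errors are independent, so the moments of the products factor. In particular the
-- products are square integrable without fourth moments, and for fixed k they are orthonormal in
-- (i, j).
theorem integral_score_mul_error {k : ℕ} (hk : lam k ≠ 0) (i j i' j' : ℕ) :
    MemLp (fun ω => ξ i k ω * ε i j ω) 2 P ∧
    ∫ ω, ξ i k ω * ε i j ω * (ξ i' k ω * ε i' j' ω) ∂P = if (i, j) = (i', j') then 1 else 0 := by
  have hind := indepFun_scores_errors hη heig hξ hε hk
  constructor
  · refine (memLp_two_iff_integrable_sq ((hξ.memLp i k).1.mul (hε.memLp i j).1)).2 ?_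
    have h1 : IndepFun (fun ω => ξ i k ω ^ 2) (fun ω => ε i j ω ^ 2) P :=
      hind.comp (φ := fun f : ℕ → ℝ => f i ^ 2) (ψ := fun g : ℕ × ℕ → ℝ => g (i, j) ^ 2)
        (by fun_prop) (by fun_prop)
    have h2 := h1.integrable_mul (hξ.memLp i k).integrable_sq (hε.memLp i j).integrable_sq
    refine h2.congr (Eventually.of_forall fun ω => ?_)
    simp only [Pi.mul_apply]
    ring
  · have h1 : IndepFun (fun ω => ξ i k ω * ξ i' k ω) (fun ω => ε i j ω * ε i' j' ω) P :=
      hind.comp (φ := fun f : ℕ → ℝ => f i * f i')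
        (ψ := fun g : ℕ × ℕ → ℝ => g (i, j) * g (i', j')) (by fun_prop) (by fun_prop)
    have h2 := h1.integral_mul_eq_mul_integral ((hξ.memLp i k).1.mul (hξ.memLp i' k).1)
      ((hε.memLp i j).1.mul (hε.memLp i' j').1)
    have h3 : ∀ ω, ξ i k ω * ε i j ω * (ξ i' k ω * ε i' j' ω)
        = (ξ i k ω * ξ i' k ω) * (ε i j ω * ε i' j' ω) := fun ω => by ring
    simp_rw [h3]
    refine h2.trans ?_
    rw [hξ.integral_mul, hε.integral_mul]
    by_cases hi : i = i'
    · simp [hi]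
    · simp [hi]

include hη heig hξ hε in
-- For fixed k the sums over i form, in j, uncorrelated noise of variance n instead of n². This is
-- the gain that makes the pairing of signal and noise negligible.
theorem integral_sum_score_mul_error {k : ℕ} (hk : lam k ≠ 0) (n j j' : ℕ) :
    ∫ ω, (∑ i ∈ Finset.range n, ξ i k ω * ε i j ω) * (∑ i ∈ Finset.range n, ξ i k ω * ε i j' ω) ∂P
      = if j = j' then (n : ℝ) else 0 := by
  have hm : ∀ i j, MemLp (fun ω => ξ i k ω * ε i j ω) 2 P := fun i j =>
    (integral_score_mul_error hη heig hξ hε hk i j i j).1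
  rw [integral_sum_mul_sum _ _ (fun i _ => hm i j) fun i _ => hm i j']
  have h1 : ∀ i i', ∫ ω, ξ i k ω * ε i j ω * (ξ i' k ω * ε i' j' ω) ∂P
      = if i = i' then (if j = j' then 1 else 0) else 0 := fun i i' => by
    rw [(integral_score_mul_error hη heig hξ hε hk i j i' j').2]
    by_cases hi : i = i' <;> simp [hi]
  simp only [h1, Finset.sum_ite_eq, Finset.mem_range]
  rw [Finset.sum_congr rfl (g := fun _ => if j = j' then (1 : ℝ) else 0)
    fun i hi => if_pos (Finset.mem_range.1 hi)]
  by_cases hj : j = j' <;> simp [hj]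

end Sample

end Errors

/-! ### The random bound, uniform in the lag, and its mean. -/

section KeyBound

variable {Ω : Type*} [MeasurableSpace Ω] {P : Measure Ω} [IsProbabilityMeasure P]
  {η : ℕ → ℝ → Ω → ℝ} {C : ℝ → ℝ} (hη : IsStationarySample P η C)
  {lam : ℕ → ℝ} {ψ : ℕ → ℝ → ℝ} (heig : IsEigenSystem (covFun P (η 0)) lam ψ)
  {ξ : ℕ → ℕ → Ω → ℝ} (hξ : IsFPCScores P η lam ψ ξ) {ε : ℕ → ℕ → Ω → ℝ} (hε : IsErrorArray P η ε)
  {a : ℕ → ℝ} (ha : Summable a) (hc : ∀ k, ContinuousOn (fpc lam ψ k) (Icc 0 1))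
  (hφa : ∀ k, ∀ x ∈ Icc (0 : ℝ) 1, |fpc lam ψ k x| ≤ a k)
  {K : ℕ} {s : ℕ → ℝ → ℝ} {b : ℕ → ℝ}
  (hb : ∀ k < K, ∀ x ∈ Icc (0 : ℝ) 1, |fpc lam ψ k x - s k x| ≤ b k)
  {Δ : ℝ} (hΔ : (∑ k ∈ Finset.range K, b k) + ∑' k, a (K + k) ≤ Δ)

/-- The difference between a centered process and a random combination of the functions `s k`. -/
noncomputable def scoreRemainder (P : Measure Ω) (η : ℕ → ℝ → Ω → ℝ) (ξ : ℕ → ℕ → Ω → ℝ) (K : ℕ)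
    (s : ℕ → ℝ → ℝ) (i : ℕ) (x : ℝ) (ω : Ω) : ℝ :=
  centeredField P η i x ω - ∑ k ∈ Finset.range K, ξ i k ω * s k x

include hη heig hξ ha hc hφa hb hΔ in
-- The remainder is the truncation error of the expansion plus ∑ ξ_ik (φ_k - s_k). The first has
-- mean square at most the squared tail, and the second at most (∑ b_k)² by weighted Cauchy-Schwarz
-- with weights b_k.
theorem hasMeanLE_scoreRemainder_sq (i : ℕ) {x : ℝ} (hx : x ∈ Icc (0 : ℝ) 1) :
    HasMeanLE P (fun ω => scoreRemainder P η ξ K s i x ω ^ 2) (2 * Δ ^ 2) := by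
  have hZ := hη.isL2Field i
  have ha0 : ∀ k, 0 ≤ a k := fun k => (abs_nonneg _).trans (hφa k 0 (by simp))
  -- The bounds b k are known to be nonnegative only for k < K, while the weighted inequality asks
  -- for nonnegative weights at every index.
  set β : ℕ → ℝ := fun k => if k < K then b k else 0 with hβ
  have hβ0 : ∀ k, 0 ≤ β k := fun k => by
    simp only [hβ]
    split_ifs with hk
    · exact (abs_nonneg _).trans (hb k hk x hx)
    · exact le_rfl
  have hβs : ∑ k ∈ Finset.range K, β k = ∑ k ∈ Finset.range K, b k :=
    Finset.sum_congr rfl fun k hk => if_pos (Finset.mem_range.1 hk)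
  set B := ∑ k ∈ Finset.range K, b k with hB
  set t := ∑' k, a (K + k) with ht
  have ht0 : 0 ≤ t := tsum_nonneg fun _ => ha0 _
  have hB0 : 0 ≤ B := by rw [← hβs]; exact Finset.sum_nonneg fun k _ => hβ0 k
  have h1 : HasMeanLE P (fun ω => (centeredField P η i x ω
      - ∑ k ∈ Finset.range K, ξ i k ω * fpc lam ψ k x) ^ 2) (t ^ 2) := by
    refine ⟨MemLp.integrable_sq ((hZ.memLp x hx).sub (memLp_finsetSum (Finset.range K)
      (f := fun k ω => ξ i k ω * fpc lam ψ k x) fun k _ => (hξ.memLp i k).mul_const _)), ?_⟩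
    exact heig.integral_truncation_sq_le hZ (fun x hx x' hx' =>
      hη.integral_centeredField_mul i hx hx') (hξ.memLp i) (hξ.uncorrelated i)
      (hξ.score_centeredField i) ha hc hφa hx K
  have h2 : HasMeanLE P (fun ω => B * ∑ k ∈ Finset.range K, β k * ξ i k ω ^ 2) (B * B) := by
    refine HasMeanLE.const_mul ?_ hB0
    have h3 : ∀ k ∈ Finset.range K, HasMeanLE P (fun ω => β k * ξ i k ω ^ 2) (β k * 1) :=
      fun k _ => HasMeanLE.const_mul ⟨(hξ.memLp i k).integrable_sq, by
        have := hξ.uncorrelated i k k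
        simp only [if_true, ← sq] at this
        exact this.le⟩ (hβ0 k)
    have h4 := HasMeanLE.sum _ h3
    simp only [mul_one, hβs] at h4
    exact h4
  have h5 := (h1.const_mul zero_le_two).add (h2.const_mul zero_le_two)
  refine (h5.of_le ?_ (fun ω => sq_nonneg _) fun ω => ?_).mono ?_
  · exact (((hZ.memLp x hx).sub (memLp_finsetSum (Finset.range K)
      (f := fun k ω => ξ i k ω * s k x) fun k _ => (hξ.memLp i k).mul_const _))).1.pow 2
  · set r := centeredField P η i x ω - ∑ k ∈ Finset.range K, ξ i k ω * fpc lam ψ k x with hr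
    set d := ∑ k ∈ Finset.range K, ξ i k ω * (fpc lam ψ k x - s k x) with hd
    have h6 : scoreRemainder P η ξ K s i x ω = r + d := by
      rw [scoreRemainder, hr, hd]
      simp only [mul_sub, Finset.sum_sub_distrib]
      ring
    have h7 : d ^ 2 ≤ B * ∑ k ∈ Finset.range K, β k * ξ i k ω ^ 2 := by
      rw [← hβs]
      refine le_trans ?_ (sum_mul_sq_le_weighted K β (fun k => ξ i k ω) hβ0)
      rw [← sq_abs d]
      refine pow_le_pow_left₀ (abs_nonneg _) ?_ 2
      refine (Finset.abs_sum_le_sum_abs _ _).trans (Finset.sum_le_sum fun k hk => ?_)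
      rw [abs_mul, mul_comm]
      refine mul_le_mul_of_nonneg_right ?_ (abs_nonneg _)
      simp only [hβ, if_pos (Finset.mem_range.1 hk)]
      exact hb k (Finset.mem_range.1 hk) x hx
    rw [h6]
    nlinarith [sq_nonneg (r - d)]
  · have h8 : (B + t) ^ 2 ≤ Δ ^ 2 := pow_le_pow_left₀ (by positivity) hΔ 2
    nlinarith [mul_nonneg hB0 ht0]

include hη heig hξ ha hc hφa hb hΔ in
-- The pointwise bound is integrated over [0,1] by Fubini. Both versions are needed: the grid values
-- enter through the fit, the integral through the true process.
theorem hasMeanLE_integral_scoreRemainder_sq (hs : ∀ k, MemLp (s k) 2 volIcc) (i : ℕ) :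
    HasMeanLE P (fun ω => ∫ x, scoreRemainder P η ξ K s i x ω ^ 2 ∂volIcc) (2 * Δ ^ 2) := by
  have hZ := hη.isL2Field i
  have h1 : MemLp (fun z : ℝ × Ω => scoreRemainder P η ξ K s i z.1 z.2) 2 (volIcc.prod P) := by
    refine MemLp.sub ?_ (memLp_finsetSum (Finset.range K)
      (f := fun k (z : ℝ × Ω) => ξ i k z.2 * s k z.1) fun k _ => ?_)
    · exact (memLp_two_iff_integrable_sq hZ.measurable.aestronglyMeasurable).2
        hZ.integrable_sq_prod
    · have hm : AEStronglyMeasurable (fun z : ℝ × Ω => ξ i k z.2 * s k z.1) (volIcc.prod P) :=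
        (hξ.memLp i k).1.comp_snd.mul (hs k).1.comp_fst
      refine (memLp_two_iff_integrable_sq hm).2 ?_
      refine ((hs k).integrable_sq.mul_prod (hξ.memLp i k).integrable_sq).congr
        (Eventually.of_forall fun z => ?_)
      simp only
      ring
  have h2 := h1.integrable_sq
  refine ⟨h2.integral_prod_right, ?_⟩
  rw [← integral_integral_swap (f := fun x ω => scoreRemainder P η ξ K s i x ω ^ 2) h2]
  have h3 : ∫ _, 2 * Δ ^ 2 ∂volIcc = 2 * Δ ^ 2 := by simp
  rw [← h3]
  refine integral_mono_ae h2.integral_prod_left (integrable_const _) ?_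
  filter_upwards [ae_volIcc_mem] with x hx
  exact (hasMeanLE_scoreRemainder_sq hη heig hξ ha hc hφa hb hΔ i hx).2

variable {p J N n : ℕ} {V : Submodule ℝ (EuclideanSpace ℝ (Fin N))}
  {fit : EuclideanSpace ℝ (Fin N) →ₗ[ℝ] Lp ℝ 2 volIcc}
  (hfitn : ∀ y, ‖fit y‖ ^ 2 ≤ 2 / N * ‖V.starProjection y‖ ^ 2)
  (hfits : ∀ (g : ℝ → ℝ) (hg : g ∈ splineSpace p J),
    fit (WithLp.toLp 2 fun j : Fin N => g (gridPoint N j)) = (memLp_of_mem_splineSpace hg).toLp g)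
  (hfitl : ∀ (y : ℕ → ℝ) (g : ℝ → ℝ) (hg : IsLeastSquaresSpline p J N y g),
    fit (WithLp.toLp 2 fun j : Fin N => y j) = (memLp_of_mem_splineSpace hg.1).toLp g)
  (hs : ∀ k, s k ∈ splineSpace p J) {σ : ℝ → ℝ}

/-- The random bound for the distance of the two covariance estimators. -/
noncomputable def covErrorBound (P : Measure Ω) (η : ℕ → ℝ → Ω → ℝ) (ξ : ℕ → ℕ → Ω → ℝ)
    (ε : ℕ → ℕ → Ω → ℝ) (σ : ℝ → ℝ) (K : ℕ) (s : ℕ → ℝ → ℝ) (L : ℕ → ℝ) (n N : ℕ)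
    (V : Submodule ℝ (EuclideanSpace ℝ (Fin N))) (κ₁ κ₂ : ℝ) (ω : Ω) : ℝ :=
  1 / n * ((∑ k ∈ Finset.range K, L k * (κ₂ + 2 / N * ‖V.starProjection (WithLp.toLp 2
        fun j : Fin N => σ (gridPoint N j) * ∑ i ∈ Finset.range n, ξ i k ω * ε i j ω)‖ ^ 2 / κ₂))
    + (∑ i ∈ Finset.range n,
        (2 * κ₁ * ((∑ k ∈ Finset.range K, L k) * ∑ k ∈ Finset.range K, L k * ξ i k ω ^ 2)
          + (2 / N * (∑ j ∈ Finset.range N, scoreRemainder P η ξ K s i (gridPoint N j) ω ^ 2)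
            + ∫ x, scoreRemainder P η ξ K s i x ω ^ 2 ∂volIcc) / κ₁
          + 5 * (2 / N * ∑ j ∈ Finset.range N, scoreRemainder P η ξ K s i (gridPoint N j) ω ^ 2)
          + 5 * (2 / N * ‖V.starProjection (WithLp.toLp 2
            fun j : Fin N => σ (gridPoint N j) * ε i j ω)‖ ^ 2)
          + ∫ x, scoreRemainder P η ξ K s i x ω ^ 2 ∂volIcc))
    + 3 / n * ((∑ k ∈ Finset.range K, L k)
        * ∑ k ∈ Finset.range K, L k * (∑ i ∈ Finset.range n, ξ i k ω) ^ 2))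

include hη heig hξ hε ha hc hφa hb hΔ in
-- Each summand has an explicit second moment. The coefficient 6 is 4 + 2 and 22 is 5·4 + 2, where
-- 4Δ² bounds the doubled grid average of the squared remainder and 2Δ² bounds its integral.
theorem hasMeanLE_covErrorBound (hs : ∀ k, MemLp (s k) 2 volIcc) (hn : 0 < n) (hN : 0 < N)
    {L : ℕ → ℝ} (hL : ∀ k, 0 ≤ L k) (hL0 : ∀ k, lam k = 0 → L k = 0) {Mσ : ℝ}
    (hσ : ∀ x ∈ Icc (0 : ℝ) 1, |σ x| ≤ Mσ) {H : ℝ}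
    (hH : 2 / N * (Mσ ^ 2 * Module.finrank ℝ V) ≤ H) {κ₁ κ₂ S : ℝ} (hκ₁ : 0 < κ₁) (hκ₂ : 0 < κ₂)
    (hS : ∑ k ∈ Finset.range K, L k ≤ S) :
    HasMeanLE P (covErrorBound P η ξ ε σ K s L n N V κ₁ κ₂)
      (S * (κ₂ / n + H / κ₂) + 2 * κ₁ * S ^ 2 + 6 * Δ ^ 2 / κ₁ + 22 * Δ ^ 2 + 5 * H
        + 3 * S ^ 2 / n) := by
  have hn' : (0 : ℝ) < n := by exact_mod_cast hn
  have hN' : (0 : ℝ) < N := by exact_mod_cast hN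
  have hσ' : ∀ j < N, |σ (gridPoint N j)| ≤ Mσ := fun j hj => hσ _ (gridPoint_mem hj)
  have hH0 : 0 ≤ H := le_trans (by positivity) hH
  set S₀ := ∑ k ∈ Finset.range K, L k with hS₀
  have hS0 : 0 ≤ S₀ := Finset.sum_nonneg fun k _ => hL k
  -- Scores with null eigenvalue are arbitrary and may depend on the errors, so their weight L k has
  -- to vanish.
  have m1 : ∀ k, HasMeanLE P (fun ω => L k * (κ₂ + 2 / N * ‖V.starProjection (WithLp.toLp 2
        fun j : Fin N => σ (gridPoint N j) * ∑ i ∈ Finset.range n, ξ i k ω * ε i j ω)‖ ^ 2 / κ₂))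
      (L k * (κ₂ + n * H / κ₂)) := fun k => by
    by_cases hk : lam k = 0
    · simp only [hL0 k hk, zero_mul]
      exact HasMeanLE.const 0
    · refine ((HasMeanLE.const κ₂).add (HasMeanLE.div_const ?_ hκ₂.le)).const_mul (hL k)
      have h1 := hasMeanLE_norm_starProjection_sq V
        (u := fun j ω => ∑ i ∈ Finset.range n, ξ i k ω * ε i j ω)
        (fun j _ => memLp_finsetSum _ fun i _ =>
          (integral_score_mul_error hη heig hξ hε hk i j i j).1) hn'.le
        (fun j _ j' _ => integral_sum_score_mul_error hη heig hξ hε hk n j j') hσ'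
      refine (h1.const_mul (by positivity : (0 : ℝ) ≤ 2 / N)).mono ?_
      calc 2 / (N : ℝ) * (Mσ ^ 2 * n * Module.finrank ℝ V)
          = n * (2 / N * (Mσ ^ 2 * Module.finrank ℝ V)) := by ring
        _ ≤ n * H := by gcongr
  have msq : ∀ i k, HasMeanLE P (fun ω => ξ i k ω ^ 2) 1 := fun i k =>
    ⟨(hξ.memLp i k).integrable_sq, by
      have := hξ.uncorrelated i k k
      simp only [if_true, ← sq] at this
      exact this.le⟩
  have m2 : ∀ i, HasMeanLE P (fun ω => S₀ * ∑ k ∈ Finset.range K, L k * ξ i k ω ^ 2)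
      (S₀ * S₀) := fun i => by
    have h1 := HasMeanLE.sum (Finset.range K) fun k _ => (msq i k).const_mul (hL k)
    simp only [mul_one] at h1
    exact h1.const_mul hS0
  have m3 : ∀ i, HasMeanLE P (fun ω => 2 / N * ∑ j ∈ Finset.range N,
      scoreRemainder P η ξ K s i (gridPoint N j) ω ^ 2) (4 * Δ ^ 2) := fun i => by
    have h1 := (HasMeanLE.sum_range N fun j hj => hasMeanLE_scoreRemainder_sq hη heig hξ ha hc hφa
      hb hΔ i (gridPoint_mem hj)).const_mul (by positivity : (0 : ℝ) ≤ 2 / N)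
    refine h1.mono (le_of_eq ?_)
    field_simp
    ring
  have m4 := fun i => hasMeanLE_integral_scoreRemainder_sq hη heig hξ ha hc hφa hb hΔ hs i
  have m5 : ∀ i, HasMeanLE P (fun ω => 2 / N * ‖V.starProjection (WithLp.toLp 2
            fun j : Fin N => σ (gridPoint N j) * ε i j ω)‖ ^ 2) H := fun i => by
    have h1 := hasMeanLE_norm_starProjection_sq V (u := fun j ω => ε i j ω)
      (fun j _ => hε.memLp i j) zero_le_one (fun j _ j' _ => by
        rw [hε.integral_mul]
        simp) hσ'
    refine (h1.const_mul (by positivity : (0 : ℝ) ≤ 2 / N)).mono ?_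
    rwa [mul_one]
  have m6 : HasMeanLE P (fun ω => S₀ * ∑ k ∈ Finset.range K, L k *
      (∑ i ∈ Finset.range n, ξ i k ω) ^ 2) (S₀ * (S₀ * n)) := by
    have h0 : ∀ k, HasMeanLE P (fun ω => (∑ i ∈ Finset.range n, ξ i k ω) ^ 2) n := fun k => by
      refine ⟨(memLp_finsetSum _ fun i _ => hξ.memLp i k).integrable_sq, ?_⟩
      simp only [sq]
      rw [integral_sum_mul_sum _ _ (fun i _ => hξ.memLp i k) fun i _ => hξ.memLp i k]
      simp only [hξ.integral_mul, Finset.sum_ite_eq, Finset.mem_range]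
      rw [Finset.sum_congr rfl (g := fun _ => (1 : ℝ)) fun i hi => if_pos (Finset.mem_range.1 hi)]
      simp
    have h1 := HasMeanLE.sum (Finset.range K) fun k _ => (h0 k).const_mul (hL k)
    rw [← Finset.sum_mul] at h1
    exact h1.const_mul hS0
  have m7 := fun i => (((((m2 i).const_mul (by positivity : 0 ≤ 2 * κ₁)).add
    (((m3 i).add (m4 i)).div_const hκ₁.le)).add ((m3 i).const_mul (by norm_num : (0 : ℝ) ≤ 5))).add
    ((m5 i).const_mul (by norm_num : (0 : ℝ) ≤ 5))).add (m4 i)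
  have m8 := (((HasMeanLE.sum (Finset.range K) fun k _ => m1 k).add
    (HasMeanLE.sum_range n fun i _ => m7 i)).add
    (m6.const_mul (by positivity : (0 : ℝ) ≤ 3 / n))).const_mul (by positivity : (0 : ℝ) ≤ 1 / n)
  refine HasMeanLE.mono m8 ?_
  rw [← Finset.sum_mul, ← hS₀]
  have e1 : 1 / (n : ℝ) * (S₀ * (κ₂ + n * H / κ₂)
      + n * (2 * κ₁ * (S₀ * S₀) + (4 * Δ ^ 2 + 2 * Δ ^ 2) / κ₁ + 5 * (4 * Δ ^ 2) + 5 * H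
        + 2 * Δ ^ 2) + 3 / n * (S₀ * (S₀ * n)))
      = S₀ * (κ₂ / n + H / κ₂) + 2 * κ₁ * S₀ ^ 2 + 6 * Δ ^ 2 / κ₁ + 22 * Δ ^ 2 + 5 * H
        + 3 * S₀ ^ 2 / n := by
    field_simp
    ring
  rw [e1]
  gcongr

omit [IsProbabilityMeasure P] in
include hη hfitn hfits hfitl in
-- The deterministic comparison is applied to the fits minus the fit of the common mean. Each norm
-- is then replaced by a quantity independent of h whose mean is computable. The constant 1/(1 - h₀)
-- dominates the normalization at every admissible lag.
theorem abs_Chat_sub_Ctilde_le {ω : Ω}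
    (hω : ∀ i, MemLp (fun x => centeredField P η i x ω) 2 volIcc) (hn : 0 < n) (hN : 0 < N)
    {etaHat : ℕ → Ω → ℝ → ℝ}
    (hhat : ∀ i < n, IsLeastSquaresSpline p J N (observation η σ ε N i ω) (etaHat i ω))
    {κ₁ κ₂ : ℝ} (hκ₁ : 0 < κ₁) (hκ₂ : 0 < κ₂) {h₀ h : ℝ} (hh₀ : h₀ < 1) (hh : h ∈ Icc (0 : ℝ) h₀) :
    |Chat n etaHat ω h - Ctilde P η n ω h| ≤ 1 / (1 - h₀) *
      covErrorBound P η ξ ε σ K s (fun k => ‖(memLp_of_mem_splineSpace (hs k)).toLp (s k)‖)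
        n N V κ₁ κ₂ ω := by
  have hn' : (0 : ℝ) < n := by exact_mod_cast hn
  have hN' : (0 : ℝ) < N := by exact_mod_cast hN
  have hh1 : h ∈ Icc (0 : ℝ) 1 := ⟨hh.1, hh.2.trans hh₀.le⟩
  set L : ℕ → Lp ℝ 2 volIcc := fun k => (memLp_of_mem_splineSpace (hs k)).toLp (s k) with hL
  set G : ℕ → splineSubmodule p J := fun i => ∑ k ∈ Finset.range K, ξ i k ω • ⟨s k, hs k⟩ with hG
  have hGx : ∀ i x, (G i : ℝ → ℝ) x = ∑ k ∈ Finset.range K, ξ i k ω * s k x := fun i x => by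
    simp [hG, Finset.sum_apply]
  set T : ℕ → Lp ℝ 2 volIcc := fun i => splineToLp p J (G i) with hTdef
  have hT : ∀ i, T i = ∑ k ∈ Finset.range K, ξ i k ω • L k := fun i => by
    simp only [hTdef, hG, map_sum, map_smul]
    rfl
  set mv : EuclideanSpace ℝ (Fin N) :=
    WithLp.toLp 2 fun j : Fin N => meanFun P (η 0) (gridPoint N j)
  set yv : ℕ → EuclideanSpace ℝ (Fin N) := fun i =>
    WithLp.toLp 2 fun j : Fin N => observation η σ ε N i ω j
  set rv : ℕ → EuclideanSpace ℝ (Fin N) := fun i =>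
    WithLp.toLp 2 fun j : Fin N => scoreRemainder P η ξ K s i (gridPoint N j) ω
  set ev : ℕ → EuclideanSpace ℝ (Fin N) := fun i =>
    WithLp.toLp 2 fun j : Fin N => σ (gridPoint N j) * ε i j ω with hev
  set z : ℕ → Lp ℝ 2 volIcc := fun i => (hω i).toLp _ with hz
  -- Data minus mean splits into the grid values of a spline, the remainder, and the noise; the fit
  -- sends the first to T i exactly.
  have hyv : ∀ i, yv i - mv = splineValues p J N (G i) + rv i + ev i := fun i => by
    ext j
    have h1 := hη.meanFun_eq i (gridPoint_mem j.2)
    change observation η σ ε N i ω j - meanFun P (η 0) (gridPoint N j)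
      = (G i : ℝ → ℝ) (gridPoint N j) + scoreRemainder P η ξ K s i (gridPoint N j) ω
        + σ (gridPoint N j) * ε i j ω
    rw [hGx, scoreRemainder, observation, centeredField, h1]
    ring
  set A : ℕ → Lp ℝ 2 volIcc := fun i => fit (yv i) - fit mv with hA
  have hAi : ∀ i, A i = T i + fit (rv i) + fit (ev i) := fun i => by
    rw [hA]
    simp only
    rw [← map_sub, hyv, map_add, map_add]
    congr 2
    exact hfits _ (G i).2
  have hzT : ∀ i, z i = T i + (z i - T i) := fun i => by abel
  have key := abs_centered_sub_le (B := lagForm hh1) (abs_lagForm_le hh1) hn K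
    (fun i k => ξ i k ω) L T (fun i => fit (rv i)) (fun i => fit (ev i)) (fun i => z i - T i) A z
    hT hAi hzT hκ₁ hκ₂
  have hrn : ∀ i, ‖fit (rv i)‖ ^ 2 ≤ 2 / N * ∑ j ∈ Finset.range N,
      scoreRemainder P η ξ K s i (gridPoint N j) ω ^ 2 := fun i => by
    refine (hfitn _).trans ?_
    rw [← norm_sq_eq_sum_range]
    gcongr
    exact Submodule.norm_starProjection_apply_le _ _
  have hρn : ∀ i, ‖z i - T i‖ ^ 2 = ∫ x, scoreRemainder P η ξ K s i x ω ^ 2 ∂volIcc := fun i => by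
    rw [hz, hTdef]
    simp only
    rw [splineToLp_eq, ← MemLp.toLp_sub, norm_toLp_sq, ← integral_volIcc]
    refine integral_congr_ae (Eventually.of_forall fun x => ?_)
    simp only [Pi.sub_apply, hGx, scoreRemainder]
  have hTn : ∀ i, ‖T i‖ ^ 2 ≤ (∑ k ∈ Finset.range K, ‖L k‖)
      * ∑ k ∈ Finset.range K, ‖L k‖ * ξ i k ω ^ 2 := fun i => by
    rw [hT]
    exact norm_sum_smul_sq_le K (fun k => ξ i k ω) L
  have hTs : ‖∑ i ∈ Finset.range n, T i‖ ^ 2 ≤ (∑ k ∈ Finset.range K, ‖L k‖)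
      * ∑ k ∈ Finset.range K, ‖L k‖ * (∑ i ∈ Finset.range n, ξ i k ω) ^ 2 := by
    have h1 : ∑ i ∈ Finset.range n, T i
        = ∑ k ∈ Finset.range K, (∑ i ∈ Finset.range n, ξ i k ω) • L k := by
      simp only [hT, Finset.sum_smul]
      rw [Finset.sum_comm]
    rw [h1]
    exact norm_sum_smul_sq_le K (fun k => ∑ i ∈ Finset.range n, ξ i k ω) L
  have hcr : ∀ k, ‖∑ i ∈ Finset.range n, ξ i k ω • fit (ev i)‖ ^ 2 ≤ 2 / N * ‖V.starProjection
      (WithLp.toLp 2 fun j : Fin N => σ (gridPoint N j) *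
        ∑ i ∈ Finset.range n, ξ i k ω * ε i j ω)‖ ^ 2 := fun k => by
    -- By linearity the weighted sum of fits is the fit of one noise vector, so the projection bound
    -- is used once on the sum.
    have h1 : ∑ i ∈ Finset.range n, ξ i k ω • fit (ev i) = fit (WithLp.toLp 2 fun j : Fin N =>
        σ (gridPoint N j) * ∑ i ∈ Finset.range n, ξ i k ω * ε i j ω) := by
      rw [← Finset.sum_congr rfl fun i _ => map_smul fit (ξ i k ω) (ev i), ← map_sum]
      congr 1
      ext j
      simp only [WithLp.ofLp_sum, WithLp.ofLp_smul, Finset.sum_apply, Pi.smul_apply, smul_eq_mul,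
        hev, Finset.mul_sum]
      exact Finset.sum_congr rfl fun i _ => by ring
    rw [h1]
    exact hfitn _
  have hChat : Chat n etaHat ω h = 1 / (1 - h) * (1 / n * ∑ i ∈ Finset.range n,
      lagForm hh1 (A i - (1 / n : ℝ) • ∑ j ∈ Finset.range n, A j)
        (A i - (1 / n : ℝ) • ∑ j ∈ Finset.range n, A j)) := by
    refine lagCov_eq hh1 n fun i hi => ?_
    -- Only the first n fitted curves are known to be splines; the default 0 is never evaluated.
    set u : ℕ → splineSubmodule p J := fun j => if hj : j < n then ⟨etaHat j ω, (hhat j hj).1⟩ else 0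
      with hu
    have hux : ∀ j < n, (u j : ℝ → ℝ) = etaHat j ω := fun j hj => by
      simp only [hu, dif_pos hj]
    have hufit : ∀ j < n, splineToLp p J (u j) = fit (yv j) := fun j hj => by
      simp only [hu, dif_pos hj]
      exact (hfitl _ _ (hhat j hj)).symm
    set c : splineSubmodule p J := u i - (1 / n : ℝ) • ∑ j ∈ Finset.range n, u j with hcdef
    have hcx : (c : ℝ → ℝ) = centered n (fun i => etaHat i ω) i := by
      funext x
      rw [centered, hcdef]
      simp only [Submodule.coe_sub, Submodule.coe_smul, Submodule.coe_sum, Pi.sub_apply,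
        Pi.smul_apply, Finset.sum_apply, smul_eq_mul]
      rw [hux i hi, Finset.sum_congr rfl fun j hj => by rw [hux j (Finset.mem_range.1 hj)]]
    refine ⟨hcx ▸ memLp_of_mem_splineSpace c.2, ?_⟩
    have h1 : splineToLp p J c = A i - (1 / n : ℝ) • ∑ j ∈ Finset.range n, A j := by
      rw [hcdef, map_sub, map_smul, map_sum, hufit i hi,
        Finset.sum_congr rfl fun j hj => hufit j (Finset.mem_range.1 hj)]
      simp only [hA, Finset.sum_sub_distrib, Finset.sum_const, Finset.card_range, smul_sub]
      rw [← Nat.cast_smul_eq_nsmul ℝ, smul_smul, one_div_mul_cancel hn'.ne', one_smul]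
      abel
    rw [← h1, splineToLp_eq]
    congr 1
  have hCt : Ctilde P η n ω h = 1 / (1 - h) * (1 / n * ∑ i ∈ Finset.range n,
      lagForm hh1 (z i) (z i)) :=
    lagCov_eq hh1 n fun i _ => ⟨hω i, rfl⟩
  have h1h : 0 < 1 - h := by linarith [hh.2]
  rw [hChat, hCt, ← mul_sub, ← mul_sub, abs_mul, abs_mul, abs_of_pos (by positivity),
    abs_of_pos (by positivity : (0 : ℝ) < 1 / n), covErrorBound]
  have h1h₀ : 0 < 1 - h₀ := by linarith
  gcongr
  · exact hh.2
  · refine key.trans ?_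
    gcongr with k _ i _ i _ i _
    · exact hcr k
    · exact hTn i
    · exact hrn i
    · exact (hρn i).le
    · exact hrn i
    · exact hfitn _
    · exact (hρn i).le

end KeyBound

/-! ### Asymptotic rates and Markov's inequality. -/

theorem isBigO_natCast_log_rpow (τ : ℝ) {e : ℝ} (he : 0 < e) :
    (fun N : ℕ => Real.log N ^ τ) =O[atTop] fun N : ℕ => (N : ℝ) ^ e :=
  ((isLittleO_log_rpow_rpow_atTop τ he).comp_tendsto tendsto_natCast_atTop_atTop).isBigO

theorem tendsto_zero_of_isBigO_rpow_neg {f : ℕ → ℝ} {e : ℝ} (he : e < 0)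
    (hf : f =O[atTop] fun N : ℕ => (N : ℝ) ^ e) : Tendsto f atTop (𝓝 0) := by
  refine hf.trans_tendsto ?_
  have := (tendsto_rpow_neg_atTop (neg_pos.2 he)).comp tendsto_natCast_atTop_atTop
  simpa [Function.comp_def] using this

/-- The rates of the number of knots against the sample size. -/
theorem tendsto_knot_rates {n J : ℕ → ℕ} {d : ℕ → ℝ} {θ γ τ r : ℝ} (hθ : 0 < θ) (hr : 0 < r)
    (hnθ : (fun N => (n N : ℝ)) =O[atTop] fun N => (N : ℝ) ^ θ)
    (hd_pos : ∀ᶠ N in atTop, 0 < d N)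
    (hd : (fun N => d N + (d N)⁻¹) =O[atTop] fun N : ℕ => Real.log N ^ τ)
    (hJ : (fun N => (J N : ℝ)) =Θ[atTop] fun N : ℕ => (N : ℝ) ^ γ * d N)
    (hγ1 : θ / (2 * r) < γ) (hγ2 : γ < 1 - θ / 2) :
    Tendsto (fun N => (n N : ℝ) ^ (1 / 2 : ℝ) * (((J N : ℝ) + 1) / N)) atTop (𝓝 0) ∧
    Tendsto (fun N => (n N : ℝ) ^ (1 / 2 : ℝ) * (1 / ((J N : ℝ) + 1)) ^ r) atTop (𝓝 0) := by
  -- Powers of the logarithm are absorbed in N^e, with e below both margins left by the conditions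
  -- on γ.
  obtain ⟨e, he0, he⟩ : ∃ e : ℝ, 0 < e ∧ e < min (1 - θ / 2 - γ) (γ - θ / (2 * r)) :=
    exists_between (lt_min (by linarith) (by linarith))
  have he1 := he.trans_le (min_le_left _ _)
  have he2 := he.trans_le (min_le_right _ _)
  have hγ0 : 0 < γ := lt_trans (by positivity) hγ1
  have hNpos : ∀ᶠ N : ℕ in atTop, (0 : ℝ) < N := by
    filter_upwards [eventually_gt_atTop 0] with N hN
    exact_mod_cast hN
  have hdd := hd.trans (isBigO_natCast_log_rpow τ he0)
  have hd1 : d =O[atTop] fun N : ℕ => (N : ℝ) ^ e := by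
    refine IsBigO.trans (IsBigO.of_bound 1 ?_) hdd
    filter_upwards [hd_pos] with N hN
    have : 0 < (d N)⁻¹ := inv_pos.2 hN
    rw [one_mul, Real.norm_eq_abs, Real.norm_eq_abs, abs_of_pos hN, abs_of_pos (by positivity)]
    linarith
  have hd2 : (fun N => (d N)⁻¹) =O[atTop] fun N : ℕ => (N : ℝ) ^ e := by
    refine IsBigO.trans (IsBigO.of_bound 1 ?_) hdd
    filter_upwards [hd_pos] with N hN
    have : 0 < (d N)⁻¹ := inv_pos.2 hN
    rw [one_mul, Real.norm_eq_abs, Real.norm_eq_abs, abs_of_pos this, abs_of_pos (by positivity)]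
    linarith
  have hn2 : (fun N => (n N : ℝ) ^ (1 / 2 : ℝ)) =O[atTop] fun N : ℕ => (N : ℝ) ^ (θ / 2) := by
    have h1 := hnθ.rpow (r := 1 / 2) (by norm_num)
      (Eventually.of_forall fun N => by positivity)
    refine h1.congr_right fun N => ?_
    rw [← Real.rpow_mul (Nat.cast_nonneg N)]
    ring_nf
  have hJ1 : (fun N => (J N : ℝ) + 1) =O[atTop] fun N : ℕ => (N : ℝ) ^ (γ + e) := by
    refine IsBigO.add ?_ ?_
    · refine hJ.1.trans (((isBigO_refl (fun N : ℕ => (N : ℝ) ^ γ) atTop).mul hd1).congr' ?_ ?_)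
      · exact EventuallyEq.rfl
      · filter_upwards [hNpos] with N hN
        rw [Real.rpow_add hN]
    · refine IsBigO.of_bound 1 ?_
      filter_upwards [eventually_ge_atTop 1] with N hN
      rw [norm_one, one_mul, Real.norm_eq_abs, abs_of_nonneg (by positivity)]
      exact Real.one_le_rpow (by exact_mod_cast hN) (by linarith)
  have hJpos : ∀ᶠ N in atTop, (0 : ℝ) < J N := by
    obtain ⟨c, hc⟩ := hJ.2.bound
    filter_upwards [hc, hNpos, hd_pos] with N h1 h2 h3
    have h4 : 0 < (N : ℝ) ^ γ * d N := mul_pos (Real.rpow_pos_of_pos h2 _) h3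
    rcases (Nat.cast_nonneg (α := ℝ) (J N)).eq_or_lt with h5 | h5
    · rw [← h5, norm_zero, mul_zero] at h1
      exact absurd (norm_le_zero_iff.1 h1) h4.ne'
    · exact h5
  have hJ2 : (fun N => 1 / ((J N : ℝ) + 1)) =O[atTop] fun N : ℕ => (N : ℝ) ^ (e - γ) := by
    have h1 : (fun N => ((J N : ℝ))⁻¹) =O[atTop] fun N : ℕ => ((N : ℝ) ^ γ * d N)⁻¹ := by
      refine hJ.2.inv_rev ?_
      filter_upwards [hNpos, hd_pos] with N h2 h3 h4
      exact absurd h4 (mul_pos (Real.rpow_pos_of_pos h2 _) h3).ne'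
    have h2 : (fun N => 1 / ((J N : ℝ) + 1)) =O[atTop] fun N => ((J N : ℝ))⁻¹ := by
      refine IsBigO.of_bound 1 ?_
      filter_upwards [hJpos] with N hN
      rw [one_mul, Real.norm_eq_abs, Real.norm_eq_abs, abs_of_pos (by positivity),
        abs_of_pos (inv_pos.2 hN), one_div]
      gcongr
      linarith
    refine (h2.trans h1).trans ((((isBigO_refl (fun N : ℕ => (N : ℝ) ^ (-γ)) atTop).mul
      hd2)).congr' ?_ ?_)
    · filter_upwards with N
      rw [mul_inv, Real.rpow_neg (Nat.cast_nonneg N)]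
    · filter_upwards [hNpos] with N hN
      rw [← Real.rpow_add hN]
      ring_nf
  constructor
  · refine tendsto_zero_of_isBigO_rpow_neg (e := θ / 2 + (γ + e) - 1) (by linarith) ?_
    refine (hn2.mul (hJ1.mul (isBigO_refl (fun N : ℕ => ((N : ℝ))⁻¹) atTop))).congr' ?_ ?_
    · filter_upwards with N
      rw [div_eq_mul_inv ((J N : ℝ) + 1)]
    · filter_upwards [hNpos] with N hN
      rw [Real.rpow_sub_one hN.ne', Real.rpow_add hN (θ / 2) (γ + e)]
      ring
  · refine tendsto_zero_of_isBigO_rpow_neg (e := θ / 2 + (e - γ) * r) ?_ ?_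
    · have h1 : e * r < (γ - θ / (2 * r)) * r := mul_lt_mul_of_pos_right he2 hr
      have h2 : (γ - θ / (2 * r)) * r = γ * r - θ / 2 := by field_simp
      linarith
    · have h1 := hJ2.rpow hr.le (Eventually.of_forall fun N => by positivity)
      refine (hn2.mul h1).congr' EventuallyEq.rfl ?_
      filter_upwards [hNpos] with N hN
      rw [Real.rpow_add hN, Real.rpow_mul hN.le]

/-- Markov's inequality for a supremum with a common random bound. -/
theorem measure_lt_iSup_le {Ω : Type*} [MeasurableSpace Ω] {P : Measure Ω} [IsProbabilityMeasure P]
    {S : Set ℝ} (hS : S.Nonempty) {f : Ω → ℝ → ℝ} {W : Ω → ℝ} {c E t : ℝ} (hc : 0 < c) (ht : 0 < t)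
    (hW : HasMeanLE P W E) (h : ∀ᵐ ω ∂P, ∀ x ∈ S, |f ω x| ≤ c * W ω) :
    P {ω | ENNReal.ofReal t < ⨆ x ∈ S, ‖f ω x‖ₑ} ≤ ENNReal.ofReal (c * E / t) := by
  obtain ⟨x₀, hx₀⟩ := hS
  have h0 : 0 ≤ᵐ[P] fun ω => c * W ω := by
    filter_upwards [h] with ω hω
    exact (abs_nonneg _).trans (hω x₀ hx₀)
  have h1 : P {ω | ENNReal.ofReal t < ⨆ x ∈ S, ‖f ω x‖ₑ} ≤ P {ω | t ≤ c * W ω} := by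
    refine measure_mono_ae ?_
    filter_upwards [h] with ω hω hlt
    have h2 : ⨆ x ∈ S, ‖f ω x‖ₑ ≤ ENNReal.ofReal (c * W ω) := iSup₂_le fun x hx => by
      rw [← ofReal_norm, Real.norm_eq_abs]
      exact ENNReal.ofReal_le_ofReal (hω x hx)
    have h3 : ENNReal.ofReal t < ENNReal.ofReal (c * W ω) := lt_of_lt_of_le hlt h2
    exact ((ENNReal.ofReal_lt_ofReal_iff_of_nonneg ht.le).1 h3).le
  refine h1.trans ?_
  have hcW := hW.const_mul hc.le
  have h2 := mul_meas_ge_le_integral_of_nonneg h0 hcW.1 t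
  rw [ENNReal.le_ofReal_iff_toReal_le (measure_ne_top _ _)]
  · rw [le_div_iff₀ ht, mul_comm]
    exact h2.trans hcW.2
  · exact div_nonneg ((integral_nonneg_of_ae h0).trans hcW.2) ht.le

theorem norm_toLp_le_of_abs_le {f : ℝ → ℝ} (hf : MemLp f 2 volIcc) {c : ℝ} (hc : 0 ≤ c)
    (h : ∀ x ∈ Icc (0 : ℝ) 1, |f x| ≤ c) : ‖hf.toLp f‖ ≤ c := by
  refine (sq_le_sq₀ (norm_nonneg _) hc).1 ?_
  rw [norm_toLp_sq, ← integral_volIcc]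
  have h1 : ∫ _, c ^ 2 ∂volIcc = c ^ 2 := by simp
  rw [← h1]
  refine integral_mono_ae hf.integrable_sq (integrable_const _) ?_
  filter_upwards [ae_volIcc_mem] with x hx
  rw [← sq_abs]
  exact pow_le_pow_left₀ (abs_nonneg _) (h x hx) 2

theorem supNorm01_spec {f : ℝ → ℝ} (hf : supNorm01 f ≠ ⊤) {x : ℝ} (hx : x ∈ Icc (0 : ℝ) 1) :
    |f x| ≤ (supNorm01 f).toReal := by
  have h1 : ‖f x‖ₑ ≤ supNorm01 f := le_iSup₂ (f := fun x (_ : x ∈ Icc (0 : ℝ) 1) => ‖f x‖ₑ) x hx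
  have h2 := ENNReal.toReal_mono hf h1
  rwa [toReal_enorm, Real.norm_eq_abs] at h2

/-! ### Assembly of the bound with the rates. -/

theorem proposition2
    {Ω : Type*} [MeasurableSpace Ω] (P : Measure Ω) [IsProbabilityMeasure P]
    -- the processes, their eigenvalues, eigenfunctions and scores, and the errors
    (η : ℕ → ℝ → Ω → ℝ) (C : ℝ → ℝ) (hη : IsStationarySample P η C)
    (lam : ℕ → ℝ) (ψ : ℕ → ℝ → ℝ) (heig : IsEigenSystem (covFun P (η 0)) lam ψ)
    (ξ : ℕ → ℕ → Ω → ℝ) (hξ : IsFPCScores P η lam ψ ξ)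
    (σ : ℝ → ℝ) (ε : ℕ → ℕ → Ω → ℝ) (hε : IsErrorArray P η ε)
    (h₀ : ℝ) (hh₀ : h₀ ∈ Ioo (0 : ℝ) 1)
    -- smoothness of the mean function
    (q : ℕ) (hq : 0 < q) (μ : ℝ≥0) (hμ : μ ∈ Ioc (0 : ℝ≥0) 1)
    (hm : meanFun P (η 0) ∈ holderSpace q μ)
    (pstar : ℝ) (hpstar : pstar = q + μ)
    -- standard deviation function of the errors, bounded covariance
    (ν : ℝ≥0) (hν : ν ∈ Ioc (0 : ℝ≥0) 1) (hσ : σ ∈ holderSpace 0 ν)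
    (Mσ M₀ : ℝ) (hMσ : 0 < Mσ) (hM₀ : 0 < M₀)
    (hσ_nonneg : ∀ x ∈ Icc (0 : ℝ) 1, 0 ≤ σ x) (hσ_le : ∀ x ∈ Icc (0 : ℝ) 1, σ x ≤ Mσ)
    (hC_le : ∀ h ∈ Icc (0 : ℝ) h₀, |C h| ≤ M₀)
    -- growth of the sample size
    (θ : ℝ) (hθ : 0 < θ) (n : ℕ → ℕ) (hn : Tendsto n atTop atTop)
    (hnθ : (fun N => (n N : ℝ)) =O[atTop] fun N => (N : ℝ) ^ θ)
    -- smoothness and decay of the principal components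
    (hφ : ∀ k, fpc lam ψ k ∈ holderSpace q μ)
    (hφ_holder : ∑' k, holderSeminorm q μ (fpc lam ψ k) < ⊤)
    (hφ_sup : ∑' k, supNorm01 (fpc lam ψ k) < ⊤)
    (kn : ℕ → ℕ) (hkn_pos : ∀ r, 0 < kn r) (hkn_mono : Monotone kn)
    (hkn_tail : (fun r : ℕ => (∑' k, supNorm01 (fpc lam ψ (kn r + k))).toReal)
      =o[atTop] fun r : ℕ => (r : ℝ) ^ (-(1 / 2) : ℝ))
    (ω₀ : ℝ) (hω₀ : 0 < ω₀)
    (hkn_rate : (fun r : ℕ => (kn r : ℝ)) =O[atTop] fun r : ℕ => (r : ℝ) ^ ω₀)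
    -- strong Gaussian approximation
    (c₁ c₂ γ₁ γ₂ β₁ β₂ : ℝ) (hc₁ : 0 < c₁) (hc₂ : 0 < c₂) (hγ₁ : 1 < γ₁) (hγ₂ : 1 < γ₂)
    (hβ₁ : β₁ ∈ Ioo (0 : ℝ) (1 / 2)) (hβ₂ : β₂ ∈ Ioo (0 : ℝ) (1 / 2))
    (hθ_lt : θ < min (2 * (1 - β₂) * pstar / (3 + (1 + β₁) * pstar))
      (2 * ((ν : ℝ) - β₂) / (1 + β₁)))
    (Uξ Uε : ℕ → ℕ → ℕ → Ω → ℝ)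
    (hUξ : ∀ᶠ N in atTop, IsStdNormalArray P (n N) (kn (n N)) (Uξ N))
    (hUε : ∀ᶠ N in atTop, IsStdNormalArray P (n N) N (Uε N))
    (hξ_approx : ∀ᶠ N in atTop,
      P.real {ω | ∃ k < kn (n N), ∃ t ∈ Finset.Icc 1 (n N), (n N : ℝ) ^ β₁ <
        |∑ i ∈ Finset.range t, ξ i k ω - ∑ i ∈ Finset.range t, Uξ N i k ω|}
        < c₁ * (n N : ℝ) ^ (-γ₁))
    (hε_approx : ∀ᶠ N in atTop,
      P.real {ω | ∃ i < n N, ∃ t ∈ Finset.Icc 1 N, (N : ℝ) ^ β₂ <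
        |∑ j ∈ Finset.range t, ε i j ω - ∑ j ∈ Finset.range t, Uε N i j ω|}
        < c₂ * (N : ℝ) ^ (-γ₂))
    -- spline order and number of interior knots
    (p : ℕ) (hp : pstar ≤ p) (J : ℕ → ℕ) (γ τ : ℝ) (hτ : 0 < τ)
    (d : ℕ → ℝ) (hd_pos : ∀ᶠ N in atTop, 0 < d N)
    (hd : (fun N => d N + (d N)⁻¹) =O[atTop] fun N : ℕ => Real.log N ^ τ)
    (hJ : (fun N => (J N : ℝ)) =Θ[atTop] fun N : ℕ => (N : ℝ) ^ γ * d N)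
    (hγ_gt : max (max (5 * θ / (4 * pstar))
      ((θ + (γ₁ + 1 + ω₀)⁻¹ * (8 * θ * β₁)) / (2 * pstar))) (1 - (ν : ℝ)) < γ)
    (hγ_lt : γ < 1 - θ / 2 - β₂ - θ / 2 * β₁)
    -- the fitted trajectories
    (etaHat : ℕ → ℕ → Ω → ℝ → ℝ)
    (hetaHat : ∀ N, ∀ i < n N, ∀ ω,
      IsLeastSquaresSpline p (J N) N (observation η σ ε N i ω) (etaHat N i ω)) :
    IsLittleOp P
      (fun N ω => ⨆ h ∈ Icc (0 : ℝ) h₀, ‖Chat (n N) (etaHat N) ω h - Ctilde P η (n N) ω h‖ₑ)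
      (fun N => (n N : ℝ) ^ (-(1 / 2) : ℝ)) := by

  set a : ℕ → ℝ := fun k => (supNorm01 (fpc lam ψ k)).toReal with ha_def
  set w : ℕ → ℝ := fun k => (holderSeminorm q μ (fpc lam ψ k)).toReal with hw_def
  have hsup : ∀ k, supNorm01 (fpc lam ψ k) ≠ ⊤ := ENNReal.ne_top_of_tsum_ne_top hφ_sup.ne
  have ha : Summable a := ENNReal.summable_toReal hφ_sup.ne
  have hw : Summable w := ENNReal.summable_toReal hφ_holder.ne
  have ha0 : ∀ k, 0 ≤ a k := fun k => ENNReal.toReal_nonneg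
  have hw0 : ∀ k, 0 ≤ w k := fun k => ENNReal.toReal_nonneg
  have hφa : ∀ k, ∀ x ∈ Icc (0 : ℝ) 1, |fpc lam ψ k x| ≤ a k := fun k x hx =>
    supNorm01_spec (hsup k) hx
  have hc : ∀ k, ContinuousOn (fpc lam ψ k) (Icc 0 1) := fun k => (hφ k).1.continuousOn
  have hμ0 : (0 : ℝ) < μ := by exact_mod_cast hμ.1
  have hps0 : 0 < pstar := by rw [hpstar]; positivity
  have hqp : q + 1 ≤ p := by
    have : (q : ℝ) < p := by linarith
    exact_mod_cast this
  have hσM : ∀ x ∈ Icc (0 : ℝ) 1, |σ x| ≤ Mσ := fun x hx => by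
    rw [abs_of_nonneg (hσ_nonneg x hx)]; exact hσ_le x hx
  obtain ⟨M, hM, hfit⟩ := exists_linear_fit p
  set r : ℕ → ℝ := fun N => (n N : ℝ) ^ (1 / 2 : ℝ) with hr_def
  -- Weaker than the assumed lower bound, since 1/2 ≤ 5/4.
  have hγ1 : θ / (2 * pstar) < γ := by
    refine lt_of_le_of_lt ?_ (lt_of_le_of_lt ((le_max_left _ _).trans (le_max_left _ _)) hγ_gt)
    rw [div_le_div_iff₀ (by positivity) (by positivity)]
    nlinarith [mul_pos hθ hps0]
  have hγ2 : γ < 1 - θ / 2 := by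
    have h1 : 0 < θ / 2 * β₁ := mul_pos (by positivity) hβ₁.1
    linarith [hβ₂.1]
  obtain ⟨hR1, hR2⟩ := tendsto_knot_rates hθ hps0 hnθ hd_pos hd hJ hγ1 hγ2
  have hn1 : ∀ᶠ N in atTop, 1 ≤ n N := hn.eventually_ge_atTop 1
  have hr1 : ∀ᶠ N in atTop, 1 ≤ r N := by
    filter_upwards [hn1] with N hN
    exact Real.one_le_rpow (by exact_mod_cast hN) (by norm_num)
  have hrsq : ∀ N, r N * r N = n N := fun N => by
    rw [hr_def]
    simp only
    rw [← Real.sqrt_eq_rpow, Real.mul_self_sqrt (Nat.cast_nonneg _)]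
  have hrinv : Tendsto (fun N => (r N)⁻¹) atTop (𝓝 0) :=
    ((tendsto_rpow_atTop (by norm_num : (0 : ℝ) < 1 / 2)).comp
      (tendsto_natCast_atTop_atTop.comp hn)).inv_tendsto_atTop
  set tl : ℕ → ℝ := fun N => ∑' k, a (kn (n N) + k) with htl_def
  have htl : Tendsto (fun N => r N * tl N) atTop (𝓝 0) := by
    have h1 := (hkn_tail.comp_tendsto hn).tendsto_div_nhds_zero
    refine h1.congr fun N => ?_
    simp only [Function.comp_apply]
    rw [ENNReal.tsum_toReal_eq fun k => hsup _, Real.rpow_neg (Nat.cast_nonneg _), div_inv_eq_mul,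
      mul_comm]
  set Q : ℝ := ∑' k, w k with hQ_def
  have hQ0 : 0 ≤ Q := tsum_nonneg hw0
  set ap : ℕ → ℝ := fun N => (p / ((J N : ℝ) + 1)) ^ pstar with hap_def
  have hap0 : ∀ N, 0 ≤ ap N := fun N => by positivity
  have hap : Tendsto (fun N => r N * ap N) atTop (𝓝 0) := by
    have h1 := hR2.const_mul ((p : ℝ) ^ pstar)
    rw [mul_zero] at h1
    refine h1.congr fun N => ?_
    rw [hap_def]
    simp only
    rw [← mul_one_div (p : ℝ) ((J N : ℝ) + 1), Real.mul_rpow (by positivity) (by positivity)]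
    ring
  -- The summand 1/n makes Δ positive, as its use as a balancing parameter requires, and contributes
  -- only n^{-1/2} to √n Δ.
  set Δ : ℕ → ℝ := fun N => Q * ap N + tl N + 1 / n N with hΔ_def
  have hrΔ : Tendsto (fun N => r N * Δ N) atTop (𝓝 0) := by
    have h1 := ((hap.const_mul Q).add htl).add hrinv
    simp only [mul_zero, add_zero] at h1
    refine h1.congr' ?_
    filter_upwards [hr1] with N hN
    have hr0 : r N ≠ 0 := by positivity
    rw [hΔ_def]
    simp only
    rw [← hrsq N]
    field_simp
  set H : ℕ → ℝ := fun N => 2 * Mσ ^ 2 * p * (((J N : ℝ) + 1) / N) with hH_def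
  have hrH : Tendsto (fun N => r N * H N) atTop (𝓝 0) := by
    have h1 := hR1.const_mul (2 * Mσ ^ 2 * p)
    rw [mul_zero] at h1
    refine h1.congr fun N => ?_
    rw [hH_def]
    simp only
    ring
  have hzero : ∀ {f : ℕ → ℝ}, (∀ N, 0 ≤ f N) → Tendsto (fun N => r N * f N) atTop (𝓝 0) →
      Tendsto f atTop (𝓝 0) := fun {f} hf0 hf => by
    refine squeeze_zero' (Eventually.of_forall hf0) ?_ hf
    filter_upwards [hr1] with N hN
    exact le_mul_of_one_le_left (hf0 N) hN
  have htl0 : ∀ N, 0 ≤ tl N := fun N => tsum_nonneg fun _ => ha0 _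
  have hΔ0 : ∀ N, 0 ≤ Δ N := fun N => by
    have := htl0 N
    have := hap0 N
    positivity
  have hΔlim := hzero hΔ0 hrΔ
  have hH0 : ∀ N, 0 ≤ H N := fun N => by positivity
  have hHlim := hzero hH0 hrH
  have hglim : Tendsto (fun N => √(H N)) atTop (𝓝 0) := by
    simpa using hHlim.sqrt
  have hNpos : ∀ᶠ N : ℕ in atTop, 0 < N := eventually_gt_atTop 0
  have hMJ : ∀ᶠ N : ℕ in atTop, M * ((J N : ℝ) + 1) ≤ N := by
    have h1 : Tendsto (fun N : ℕ => ((J N : ℝ) + 1) / N) atTop (𝓝 0) :=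
      hzero (fun N => by positivity) hR1
    filter_upwards [h1.eventually_le_const (by positivity : (0 : ℝ) < 1 / M), hNpos] with N h2 h3
    have h4 : (0 : ℝ) < N := by exact_mod_cast h3
    rw [div_le_div_iff₀ h4 (by linarith)] at h2
    linarith
  -- The 1 covers the total approximation error of the splines, which is at most Δ and eventually at
  -- most 1.
  set S : ℝ := (∑' k, a k) + 1 with hS_def
  have hh1 : 0 < 1 - h₀ := by linarith [hh₀.2]
  -- This is √n times the mean bound, with κ₁ = Δ and κ₂ = √(nH) inserted.
  set E : ℕ → ℝ := fun N => S * (2 * √(H N)) + 2 * S ^ 2 * (r N * Δ N) + 6 * (r N * Δ N)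
    + 22 * ((r N * Δ N) * Δ N) + 5 * (r N * H N) + 3 * S ^ 2 * (r N)⁻¹ with hE_def
  have hElim : Tendsto E atTop (𝓝 0) := by
    have h1 := ((((((hglim.const_mul 2).const_mul S).add (hrΔ.const_mul (2 * S ^ 2))).add
      (hrΔ.const_mul 6)).add ((hrΔ.mul hΔlim).const_mul 22)).add (hrH.const_mul 5)).add
      (hrinv.const_mul (3 * S ^ 2))
    simpa using h1
  intro δ hδ
  have hfinal : Tendsto (fun N => ENNReal.ofReal (1 / (1 - h₀) * E N / δ)) atTop (𝓝 0) := by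
    have h1 : Tendsto (fun N => 1 / (1 - h₀) * E N / δ) atTop (𝓝 (1 / (1 - h₀) * 0 / δ)) :=
      (hElim.const_mul _).div_const _
    simpa using ENNReal.tendsto_ofReal h1
  refine tendsto_of_tendsto_of_tendsto_of_le_of_le' tendsto_const_nhds hfinal
    (Eventually.of_forall fun N => zero_le) ?_
  filter_upwards [hn1, hr1, hNpos, hMJ, hΔlim.eventually_le_const one_pos] with N hnN hrN hN hMN hΔN
  have hn0 : 0 < n N := hnN
  have hn0' : (0 : ℝ) < n N := by exact_mod_cast hn0
  have hN' : (0 : ℝ) < N := by exact_mod_cast hN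
  have hr0 : 0 < r N := by linarith
  obtain ⟨V, fit, hV, hfitn, hfits, hfitl⟩ := hfit (J N) N hMN
  -- For a null eigenvalue φ_k is zero and is approximated by exactly zero. This removes the
  -- corresponding scores, whose independence from the errors is not available.
  have hex : ∀ k, ∃ g ∈ splineSpace p (J N), (lam k = 0 → g = 0) ∧
      ∀ x ∈ Icc (0 : ℝ) 1, |fpc lam ψ k x - g x| ≤ w k * ap N := fun k => by
    by_cases hk : lam k = 0
    · refine ⟨0, (splineSubmodule p (J N)).zero_mem, fun _ => rfl, fun x _ => ?_⟩
      have := mul_nonneg (hw0 k) (hap0 N)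
      simpa [fpc, hk] using this
    · obtain ⟨g, hg, hgx⟩ := exists_mem_splineSpace_abs_sub_le hμ.1 hqp (by omega) (J N) (hφ k)
      refine ⟨g, hg, fun h => absurd h hk, fun x hx => ?_⟩
      rw [hap_def, hpstar]
      exact hgx x hx
  choose s hs hs0 hsx using hex
  have hΔpos : 0 < Δ N := by
    have := htl0 N
    have := hap0 N
    positivity
  have hHpos : 0 < H N := by
    have : 0 < p := by omega
    positivity
  have hwsum : ∑ k ∈ Finset.range (kn (n N)), w k * ap N ≤ Q * ap N := by
    rw [← Finset.sum_mul]
    exact mul_le_mul_of_nonneg_right (hw.sum_le_tsum _ fun k _ => hw0 k) (hap0 N)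
  have hΔb : (∑ k ∈ Finset.range (kn (n N)), w k * ap N) + ∑' k, a (kn (n N) + k) ≤ Δ N := by
    have : (0 : ℝ) ≤ 1 / n N := by positivity
    change _ ≤ Q * ap N + tl N + 1 / n N
    change _ + tl N ≤ _
    linarith
  have hSb : ∑ k ∈ Finset.range (kn (n N)),
      ‖(memLp_of_mem_splineSpace (hs k)).toLp (s k)‖ ≤ S := by
    have h1 : ∀ k, ‖(memLp_of_mem_splineSpace (hs k)).toLp (s k)‖ ≤ a k + w k * ap N := fun k => by
      refine norm_toLp_le_of_abs_le _ (add_nonneg (ha0 k) (mul_nonneg (hw0 k) (hap0 N)))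
        fun x hx => ?_
      have h2 := abs_sub_abs_le_abs_sub (s k x) (fpc lam ψ k x)
      rw [abs_sub_comm] at h2
      linarith [hsx k x hx, hφa k x hx]
    refine (Finset.sum_le_sum fun k _ => h1 k).trans ?_
    rw [Finset.sum_add_distrib]
    refine add_le_add (ha.sum_le_tsum _ fun k _ => ha0 k) (hwsum.trans (le_trans ?_ hΔN))
    have : (0 : ℝ) ≤ 1 / n N := by positivity
    change _ ≤ Q * ap N + tl N + 1 / n N
    linarith [htl0 N]
  have hHb : 2 / (N : ℝ) * (Mσ ^ 2 * Module.finrank ℝ V) ≤ H N := by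
    have h1 : (Module.finrank ℝ V : ℝ) ≤ ((J N : ℝ) + 1) * p := by exact_mod_cast hV
    calc 2 / (N : ℝ) * (Mσ ^ 2 * Module.finrank ℝ V)
        ≤ 2 / (N : ℝ) * (Mσ ^ 2 * (((J N : ℝ) + 1) * p)) := by gcongr
      _ = H N := by simp only [hH_def]; ring
  -- The choice κ₂ = √(nH) equalizes κ₂/n and H/κ₂; both become √(H/n).
  have hκ₂ : 0 < r N * √(H N) := mul_pos hr0 (Real.sqrt_pos.2 hHpos)
  have hmean := hasMeanLE_covErrorBound hη heig hξ hε ha hc hφa (s := s)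
    (fun k _ => hsx k) hΔb (fun k => memLp_of_mem_splineSpace (hs k)) hn0 hN (V := V)
    (L := fun k => ‖(memLp_of_mem_splineSpace (hs k)).toLp (s k)‖) (fun k => norm_nonneg _)
    (fun k hk => by
      refine le_antisymm (norm_toLp_le_of_abs_le _ le_rfl fun x _ => ?_) (norm_nonneg _)
      simp [hs0 k hk]) hσM hHb hΔpos hκ₂ hSb
  have hbound : ∀ᵐ ω ∂P, ∀ h ∈ Icc (0 : ℝ) h₀,
      |Chat (n N) (etaHat N) ω h - Ctilde P η (n N) ω h| ≤ 1 / (1 - h₀) *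
        covErrorBound P η ξ ε σ (kn (n N)) s
          (fun k => ‖(memLp_of_mem_splineSpace (hs k)).toLp (s k)‖) (n N) N V (Δ N)
          (r N * √(H N)) ω := by
    filter_upwards [ae_all_iff.2 fun i => (hη.isL2Field i).ae_memLp] with ω hω h hh
    exact abs_Chat_sub_Ctilde_le hη hfitn hfits hfitl hs hω hn0 hN
      (fun i hi => hetaHat N i hi ω) hΔpos hκ₂ hh₀.2 hh
  have hrinv' : (n N : ℝ) ^ (-(1 / 2) : ℝ) = (r N)⁻¹ := Real.rpow_neg hn0'.le _
  refine (measure_lt_iSup_le ⟨0, left_mem_Icc.2 hh₀.1.le⟩ (by positivity)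
    (by positivity) hmean hbound).trans (ENNReal.ofReal_le_ofReal (le_of_eq ?_))
  have hg2 : √(H N) * √(H N) = H N := Real.mul_self_sqrt (hH0 N)
  have hg0 : √(H N) ≠ 0 := (Real.sqrt_pos.2 hHpos).ne'
  have e1 : r N * √(H N) / n N + H N / (r N * √(H N)) = 2 * √(H N) / r N := by
    nth_rewrite 2 [← hg2]
    rw [← hrsq N]
    field_simp
    ring
  have e2 : 6 * Δ N ^ 2 / Δ N = 6 * Δ N := by field_simp
  rw [hrinv', e1, e2, hE_def]
  simp only
  rw [← hrsq N]
  field_simp
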